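/- **Setting.** Let $\kappa\in\frac12\mathbb Z$ with $\kappa>2$, let $N\in\mathbb N$ with $4\mid N$ if $\kappa\notin\mathbb Z$, let $z\in\mathbb H$, and write $\mathfrak z=\mathfrak z_1+i\mathfrak z_2$ for a variable in $\mathbb H$. All non-integral powers are principal. For $\lambda\in\frac12\mathbb Z$ and $M=\left(\begin{smallmatrix}a&b\\c&d\end{smallmatrix}\right)\in\Gamma_0(N)$ put $$f|_\lambda M(w)=\begin{cases}(cw+d)^{-\lambda}f(Mw)&\text{if }\lambda\in\mathbb Z,\\ \left(\frac cd\right)^{-2\lambda}\varepsilon_d^{2\lambda}(cw+d)^{-\lambda}f(Mw)&\text{if }\lambda\notin\mathbb Z,\end{cases}$$ with the Kronecker symbol $\left(\frac cd\right)$ and $\varepsilon_d=1$ for $d\equiv1$, $\varepsilon_d=i$ for $d\equiv 3\pmod 4$. Define $$\Psi_{\kappa,-1,N}(z,\mathfrak z)=\sum_{M\in\Gamma_0(N)}\frac{(z-\mathfrak z)^{-1}}{(z-\overline{\mathfrak z})^{\kappa-1}}\bigg|_{\kappa,z}M,\qquad H_{\kappa,N}(z,\mathfrak z)=\sum_{M\in\langle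 T\rangle\backslash\Gamma_0(N)}\frac1{1-e^{2\pi i(\mathfrak z-z)}}\bigg|_{\kappa,z}M,$$ where $T=\left(\begin{smallmatrix}1&1\\0&1\end{smallmatrix}\right)$ (so that $H_{\kappa,N}=2\sum_{M\in\Gamma_\infty\backslash\Gamma_0(N)}$ with $\Gamma_\infty=\{\pm T^n\mid n\in\mathbb Z\}$ whenever the summands of the latter sum are well defined, i.e. unless $\kappa$ is an odd integer); undefined summands, which occur only for finitely many $M$ or cosets and only if $\mathfrak z\in\Gamma_0(N)z$, are read as $0$. A *polar harmonic Maass form* of weight $\lambda$ on $\Gamma_0(N)$ is a function $\mathcal F:\mathbb H\to\mathbb C$, real analytic outside of a closed discrete subset of $\mathbb H$, such that: $\mathcal F|_\lambda M=\mathcal F$ for all $M\in\Gamma_0(N)$; off that subset $\Delta_\lambda\mathcal F=0$ with $\Delta_\lambda=-y^2\left(\frac{\partial^2}{\partial x^2}+\frac{\partial^2}{\partial y^2}\right)+i\lambda y\left(\frac\partial{\partial x}+i\frac\partial{\partial y}\right)$; for every $w_0\in\mathbb H$ there is $n\in\mathbb N_0$ such that $(w-w_0)^n\mathcal F(w)$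 is bounded near $w_0$; and $\mathcal F$ grows at most linearly exponentially towards the cusps. Let $\mathbb H^{\mathrm{cusp}}_\lambda(N)$ be the space of those $\mathcal F$ whose singularities in $\mathbb H$ are all poles (near each point $\mathcal F$ is the sum of a meromorphic and a real analytic function), which are bounded towards all cusps, i.e. $(cw+d)^{-\lambda}\mathcal F(Mw)$ is bounded as $\operatorname{Im}w\to\infty$ for every $M=\left(\begin{smallmatrix}*&*\\c&d\end{smallmatrix}\right)\in\mathrm{SL}_2(\mathbb Z)$, and for which $\xi_\lambda(\mathcal F)=2iy^\lambda\,\overline{\frac{\partial\mathcal F}{\partial\overline w}}$ is (off the singularities) a cusp form of weight $2-\lambda$ on $\Gamma_0(N)$. The *meromorphic part* of such an $\mathcal F$ is the meromorphic function $\mathcal F^+$ on $\mathbb H$ for which, for $y=\operatorname{Im}w$ sufficiently large, $$\mathcal F^+(w)=\sum_{n\gg-\infty}c^+(n)e^{2\pi inw},\qquad \mathcal F(w)-\mathcal F^+(w)=\sum_{n<0}c^-(n)\,\Gamma(1-\lambda,-4\pi ny)\,e^{2\pi inw},$$ with $c^\pm(n)\in\mathbb C$ and $\Gamma(s,v)=\int_v^\infty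 t^{s-1}e^{-t}\,dt$. **Proposition.** The series defining $\Psi_{\kappa,-1,N}(z,\mathfrak z)$ and $H_{\kappa,N}(z,\mathfrak z)$ converge absolutely for all $\mathfrak z\in\mathbb H$. The function $$\mathfrak z\mapsto\mathfrak z_2^{\kappa-1}\Psi_{\kappa,-1,N}(z,\mathfrak z)$$ lies in $\mathbb H^{\mathrm{cusp}}_{2-\kappa}(N)$, and its meromorphic part is $$\mathfrak z\mapsto\frac{\pi}{(2i)^{\kappa-2}}H_{\kappa,N}(z,\mathfrak z).$$ -/

import Mathlib

open UpperHalfPlane Filter Topology Asymptotics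
open scoped MatrixGroups CongruenceSubgroup

noncomputable section

namespace PolarMaass

/-! Weights `κ ∈ ½ℤ` are encoded by the integer `m = 2κ`, so `κ = m / 2`, and `2 - κ` is
encoded by `4 - m`.  Integral weights are those with `m` even. -/

/-- The Kronecker symbol `(c/d)` for coprime `c, d` with `d` odd (possibly negative);
for `d < 0` it is the Jacobi symbol `(c/|d|)` times the sign `-1` exactly when `c < 0`. -/
def kronecker (c d : ℤ) : ℤ :=
  if c < 0 ∧ d < 0 then -jacobiSym c d.natAbs else jacobiSym c d.natAbs

/-- `ε_d` for odd `d`: `1` if `d ≡ 1 (mod 4)` and `i` if `d ≡ 3 (mod 4)`. -/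
def eps (d : ℤ) : ℂ := if d % 4 = 1 then 1 else Complex.I

/-- The constant (multiplier) in the slash action of weight `κ = m / 2`: it is `1` if `κ ∈ ℤ` and
`(c/d)^{-2κ} ε_d^{2κ}` otherwise. -/
def slashMultiplier (m : ℤ) (M : SL(2, ℤ)) : ℂ :=
  if Even m then 1
  else ((kronecker (M 1 0) (M 1 1) : ℤ) : ℂ) ^ (-m) * eps (M 1 1) ^ m

/-- `(c z + d)^{-κ}` with the principal branch, `κ = m / 2`. -/
def denomPow (m : ℤ) (M : SL(2, ℤ)) (z : ℍ) : ℂ :=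
  (((M 1 0 : ℤ) : ℂ) * (z : ℂ) + ((M 1 1 : ℤ) : ℂ)) ^ (-((m : ℂ) / 2))

/-- The slash action `f|_κ M` of weight `κ = m / 2`. -/
def slash (m : ℤ) (f : ℍ → ℂ) (M : SL(2, ℤ)) (z : ℍ) : ℂ :=
  slashMultiplier m M * denomPow m M z * f (M • z)

/-- `(c z + d)^{-κ} f (M z)`.  For `M ∈ SL₂(ℤ)` this describes `f` near the cusp `M ∞`; it agrees
with the slash action up to a constant of absolute value one, so that growth conditions at the
cusps can be read off from it in all weights. -/
def atCusp (m : ℤ) (f : ℍ → ℂ) (M : SL(2, ℤ)) (z : ℍ) : ℂ :=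
  denomPow m M z * f (M • z)

/-- `F` is real analytic at `z`. -/
def RegularAt (F : ℍ → ℂ) (z : ℍ) : Prop :=
  AnalyticAt ℝ (fun w : ℂ => F (ofComplex w)) (z : ℂ)

/-- `∂/∂x` for functions on (an open subset of) `ℂ`. -/
def dx (f : ℂ → ℂ) (w : ℂ) : ℂ := fderiv ℝ f w 1

/-- `∂/∂y` for functions on (an open subset of) `ℂ`. -/
def dy (f : ℂ → ℂ) (w : ℂ) : ℂ := fderiv ℝ f w Complex.I

/-- The weight `κ = m / 2` hyperbolic Laplacian
`-y² (∂²/∂x² + ∂²/∂y²) + i κ y (∂/∂x + i ∂/∂y)`. -/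
def laplacian (m : ℤ) (F : ℍ → ℂ) (z : ℍ) : ℂ :=
  let f : ℂ → ℂ := fun w => F (ofComplex w);
  -((z.im : ℂ) ^ 2) * (dx (dx f) z + dy (dy f) z)
    + Complex.I * ((m : ℂ) / 2) * (z.im : ℂ) * (dx f z + Complex.I * dy f z)

/-- The operator `ξ_κ = 2 i y^κ conj (∂/∂z̄)`, `κ = m / 2`, with
`∂/∂z̄ = ½ (∂/∂x + i ∂/∂y)`. -/
def xi (m : ℤ) (F : ℍ → ℂ) (z : ℍ) : ℂ :=
  let f : ℂ → ℂ := fun w => F (ofComplex w)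
  2 * Complex.I * ((z.im ^ ((m : ℝ) / 2) : ℝ) : ℂ)
    * (starRingEnd ℂ) ((1 / 2) * (dx f z + Complex.I * dy f z))

/-- Polar harmonic Maass forms of weight `κ = m / 2` on `Γ₀(N)` (for `m` odd it is understood
that `4 ∣ N`).  The first field says that the points where `F` is not real analytic form a
closed discrete subset of `ℍ`; the Laplace equation is required outside of that set. -/
structure IsPolarHarmonicMaassForm (m : ℤ) (N : ℕ) (F : ℍ → ℂ) : Prop where
  analytic : ∀ z : ℍ, ∀ᶠ w in 𝓝[≠] z, RegularAt F w
  slash_eq : ∀ M ∈ CongruenceSubgroup.Gamma0 N, ∀ z : ℍ, slash m F M z = F z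
  harmonic : ∀ z : ℍ, RegularAt F z → laplacian m F z = 0
  polar : ∀ z₀ : ℍ, ∃ n : ℕ, ∃ C : ℝ, ∀ᶠ w : ℍ in 𝓝 z₀, ‖((w : ℂ) - z₀) ^ n * F w‖ ≤ C
  growth : ∀ M : SL(2, ℤ), ∃ C : ℝ,
    atCusp m F M =O[atImInfty] fun z : ℍ => Real.exp (C * z.im)

/-- All singularities of `F` in `ℍ` are poles: near every point `F` is the sum of a meromorphic
function and a real analytic function. -/
def SingularitiesArePoles (F : ℍ → ℂ) : Prop :=
  ∀ z₀ : ℍ, ∃ P A : ℂ → ℂ, MeromorphicAt P (z₀ : ℂ) ∧ AnalyticAt ℝ A (z₀ : ℂ) ∧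
    ∀ᶠ w in 𝓝[≠] z₀, F w = P (w : ℂ) + A (w : ℂ)

/-- `F` is bounded towards all cusps. -/
def BoundedAtCusps (m : ℤ) (F : ℍ → ℂ) : Prop :=
  ∀ M : SL(2, ℤ), IsBoundedAtImInfty (atCusp m F M)

/-- Cusp forms of weight `κ = m / 2` on `Γ₀(N)` (for `m` odd it is understood that `4 ∣ N`). -/
structure IsCuspForm (m : ℤ) (N : ℕ) (g : ℍ → ℂ) : Prop where
  holo : DifferentiableOn ℂ (fun w : ℂ => g (ofComplex w)) {w : ℂ | 0 < w.im}
  slash_eq : ∀ M ∈ CongruenceSubgroup.Gamma0 N, ∀ z : ℍ, slash m g M z = g z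
  zero_at_cusps : ∀ M : SL(2, ℤ), IsZeroAtImInfty (atCusp m g M)

/-- The image of `F` under `ξ_κ` is a cusp form of the dual weight `2 - κ`. -/
def HasCuspidalXiImage (m : ℤ) (N : ℕ) (F : ℍ → ℂ) : Prop :=
  ∃ g : ℍ → ℂ, IsCuspForm (4 - m) N g ∧ ∀ z : ℍ, RegularAt F z → xi m F z = g z

/-- The space of polar harmonic Maass forms of weight `κ = m / 2` on `Γ₀(N)` all of whose
singularities in `ℍ` are poles, which are bounded towards all cusps, and whose image under `ξ_κ`
is a cusp form. -/
structure IsPolarHarmonicCusp (m : ℤ) (N : ℕ) (F : ℍ → ℂ) : Prop where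
  isPolarHarmonicMaassForm : IsPolarHarmonicMaassForm m N F
  singularitiesArePoles : SingularitiesArePoles F
  boundedAtCusps : BoundedAtCusps m F
  hasCuspidalXiImage : HasCuspidalXiImage m N F

/-- The incomplete gamma function `Γ(s, v) = ∫_v^∞ t^{s-1} e^{-t} dt`, used for `v > 0`. -/
def incGamma (s v : ℝ) : ℝ := ∫ t in Set.Ioi v, t ^ (s - 1) * Real.exp (-t)

/-- `P` is the meromorphic part of a polar harmonic Maass form `F` of weight `κ = m / 2` with
cuspidal image under `ξ_κ`: `P` is meromorphic on `ℍ`, and for `y ≫ 0` the decomposition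
`F = P + (F - P)` is the Fourier expansion at `i∞` (a cusp of width one),
`F = ∑_{n ≫ -∞} c⁺(n) e^{2πinz} + ∑_{n < 0} c⁻(n) Γ(1 - κ, -4πny) e^{2πinz}`.
(The terms with `n ≥ 0` which occur in the non-holomorphic part of a general polar harmonic
Maass form have a non-cuspidal image under `ξ_κ`, hence are absent.) -/
def HasMeromorphicPart (m : ℤ) (F P : ℍ → ℂ) : Prop :=
  MeromorphicOn (fun w : ℂ => P (ofComplex w)) {w : ℂ | 0 < w.im} ∧
  ∃ (cPlus cMinus : ℤ → ℂ) (n₀ : ℤ) (y₀ : ℝ),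
    (∀ n < n₀, cPlus n = 0) ∧ (∀ n, 0 ≤ n → cMinus n = 0) ∧
    ∀ z : ℍ, y₀ < z.im →
      HasSum (fun n : ℤ =>
        cPlus n * Complex.exp (2 * Real.pi * Complex.I * n * z)) (P z) ∧
      HasSum (fun n : ℤ =>
        cMinus n * (incGamma (1 - (m : ℝ) / 2) (-4 * Real.pi * n * z.im) : ℂ)
          * Complex.exp (2 * Real.pi * Complex.I * n * z)) (F z - P z)

/-- The function `z ↦ (z - 𝔷)^n / (z - conj 𝔷)^{κ + n}`, `κ = m / 2`, with the principal branch. -/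
def psiKernel (m n : ℤ) (𝔷 : ℍ) (z : ℍ) : ℂ :=
  ((z : ℂ) - 𝔷) ^ n / ((z : ℂ) - (starRingEnd ℂ) (𝔷 : ℂ)) ^ ((m : ℂ) / 2 + (n : ℂ))

/-- The summand of the elliptic Poincaré series belonging to `M ∈ Γ₀(N)`. -/
def psiTerm (m n : ℤ) (N : ℕ) (z 𝔷 : ℍ) (M : CongruenceSubgroup.Gamma0 N) : ℂ :=
  slash m (psiKernel m n 𝔷) (M : SL(2, ℤ)) z

/-- The elliptic Poincaré series `Ψ_{κ,n,N}(z, 𝔷)`, `κ = m / 2`. -/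
def Psi (m n : ℤ) (N : ℕ) (z 𝔷 : ℍ) : ℂ := ∑' M, psiTerm m n N z 𝔷 M

/-- The function `z ↦ 1 / (1 - e^{2πi(𝔷 - z)})`. -/
def hKernel (𝔷 : ℍ) (z : ℍ) : ℂ :=
  1 / (1 - Complex.exp (2 * Real.pi * Complex.I * ((𝔷 : ℂ) - z)))

/-- The subgroup of translations `{(1 n; 0 1) | n ∈ ℤ}` of `Γ₀(N)`. -/
def translations (N : ℕ) : Subgroup (CongruenceSubgroup.Gamma0 N) :=
  (Subgroup.zpowers ModularGroup.T).subgroupOf (CongruenceSubgroup.Gamma0 N)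

/-- The orbit space `{(1 n; 0 1) | n ∈ ℤ} \ Γ₀(N)`. -/
abbrev TranslationCosets (N : ℕ) : Type := Quotient (QuotientGroup.rightRel (translations N))

theorem slash_hKernel_translate (m n : ℤ) (𝔷 z : ℍ) (M : SL(2, ℤ)) :
    slash m (hKernel 𝔷) (ModularGroup.T ^ n * M) z = slash m (hKernel 𝔷) M z := by
  have h0 : (ModularGroup.T ^ n * M) 1 0 = M 1 0 := by
    simp
  have h1 : (ModularGroup.T ^ n * M) 1 1 = M 1 1 := by
    simp
  have h2 : hKernel 𝔷 ((ModularGroup.T ^ n * M) • z) = hKernel 𝔷 (M • z) := by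
    rw [mul_smul, modular_T_zpow_smul]
    unfold hKernel
    have h3 : (2 * Real.pi * Complex.I * ((𝔷 : ℂ) - ((((n : ℝ) +ᵥ (M • z) : ℍ)) : ℂ)) : ℂ)
        = 2 * Real.pi * Complex.I * ((𝔷 : ℂ) - ((M • z : ℍ) : ℂ))
          - n * (2 * Real.pi * Complex.I) := by
      rw [coe_vadd]
      push_cast
      ring
    rw [h3, Complex.exp_sub, Complex.exp_int_mul_two_pi_mul_I, div_one]
  unfold slash slashMultiplier denomPow
  rw [h0, h1, h2]

/-- The summand of `H_{κ,N}(z, 𝔷)` belonging to a coset of translations; it does not depend on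
the representative. -/
def hTerm (m : ℤ) (N : ℕ) (z 𝔷 : ℍ) : TranslationCosets N → ℂ :=
  Quotient.lift
    (fun M : CongruenceSubgroup.Gamma0 N => slash m (hKernel 𝔷) (M : SL(2, ℤ)) z) (by
      intro M M' h
      have h' : M' * M⁻¹ ∈ translations N := QuotientGroup.rightRel_apply.mp h
      obtain ⟨n, hn⟩ := Subgroup.mem_zpowers_iff.mp (Subgroup.mem_subgroupOf.mp h')
      have h2 : (M' : SL(2, ℤ)) = ModularGroup.T ^ n * (M : SL(2, ℤ)) := by
        rw [hn]
        simp
      show slash m (hKernel 𝔷) (M : SL(2, ℤ)) z = slash m (hKernel 𝔷) (M' : SL(2, ℤ)) z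
      rw [h2, slash_hKernel_translate])

/-- Petersson's function
`H_{κ,N}(z, 𝔷) = 2 ∑_{M ∈ Γ_∞ \ Γ₀(N)} (1 - e^{2πi(𝔷 - z)})⁻¹ |_{κ,z} M`, `κ = m / 2`, where
`Γ_∞ = {± (1 n; 0 1)}`.  It is written as a sum over the cosets of the group of translations:
each coset of `Γ_∞` consists of two of these (those of `M` and `-M`), with equal summands
whenever the sum over `Γ_∞ \ Γ₀(N)` is meaningful, and this accounts for the factor `2`. -/
def H (m : ℤ) (N : ℕ) (z 𝔷 : ℍ) : ℂ := ∑' q, hTerm m N z 𝔷 q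

end PolarMaass

end

namespace PolarMaass

/-! Put s = κ - 1 and let a_M be the automorphy factor of M at z, so |a_M| = |cz+d|^(-κ). The
function in question is F(w) = y^s Σ a_M (Mz - w)^(-1) (Mz - w̄)^(-s).

Convergence: M is determined by its bottom row and the integral part of a shift of Re(Mz)
(`rowFloor_injective`). The sum over rows converges because κ > 2 and the sum over translates
because s > 1. The same majorant with explicit dependence on y is O(y^(-s)), which gives the
behaviour at the cusps (`exists_tsum_kernel_le`).

Modularity: replacing M by LM reduces the claim to a termwise identity (`kernel_transform`) and to
the cocycle relation for the automorphy factor (`autFactor_cocycle`). For half-integral κ the latter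
is the theta multiplier cocycle, checked on the generators T, (1 0; 4 1) and -1 of Γ₀(4).

Harmonicity: with w and w̄ replaced by independent variables the series is jointly holomorphic off
the orbit of z (`analyticAt_kernelSeries`). Since (Mz - w̄) - (Mz - w) = 2iy, applying ∂/∂w̄ cancels
the simple pole and leaves a multiple of y^(s-1) Σ a_M (Mz - w̄)^(-κ) (`dbar_kernelSeries`). The
conjugate of this last series is a cusp form, and the Laplace equation follows because the Laplacian
factors through ∂/∂w̄. At a point of the orbit only finitely many summands are singular, each being
a simple pole plus a real analytic function (`exists_kernel_decomposition`).

Meromorphic part: for y above all Im(Mz), group the series by cosets of ⟨T⟩ and apply Poisson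
summation to each coset (`tsum_translate_kernel`). The result is a sum over n of Γ(s, 4πy|n|)/Γ(s)
times exponentials for n < 0, and of pure exponentials for n ≥ 0. The latter form the geometric
series of the summands of H. -/

/-! ### Periodicity and sign rules for the Kronecker symbol -/

/-- For a > 0 the symbol (a/·) is an even character modulo 4a. The power of 2 in a is handled by the
supplementary law modulo 8; for the odd part, b ≡ -c produces the sign χ₄(a'), which is exactly the
discrepancy between the two reciprocity signs. -/
theorem jacobiSym_reflect {a b c : ℕ} (hb : Odd b) (hc : Odd c) (h : b + c = 4 * a) :
    jacobiSym a b = jacobiSym a c := by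
  obtain ⟨e, a', ha', rfl⟩ : ∃ e a', Odd a' ∧ a = 2 ^ e * a' := by
    have ha : a ≠ 0 := by rintro rfl; rcases hb with ⟨k, rfl⟩; omega
    obtain ⟨e, a', h1, h2⟩ := Nat.exists_eq_two_pow_mul_odd ha
    exact ⟨e, a', h1, h2⟩
  have h2 : jacobiSym (2 : ℤ) b ^ e = jacobiSym (2 : ℤ) c ^ e := by
    rcases e with _ | e
    · simp
    · congr 1
      rw [jacobiSym.at_two hb, jacobiSym.at_two hc, ZMod.χ₈_nat_eq_if_mod_eight,
        ZMod.χ₈_nat_eq_if_mod_eight]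
      have : (b + c) % 8 = 0 := by
        rw [h, show 4 * (2 ^ (e + 1) * a') = 8 * (2 ^ e * a') by ring]
        omega
      rcases hb with ⟨k, rfl⟩
      rcases hc with ⟨l, rfl⟩
      split_ifs <;> omega
  have h3 : jacobiSym (a' : ℤ) b = jacobiSym (a' : ℤ) c := by
    rw [jacobiSym.quadratic_reciprocity ha' hb, jacobiSym.quadratic_reciprocity ha' hc]
    have h4 : jacobiSym (b : ℤ) a' = ZMod.χ₄ a' * jacobiSym (c : ℤ) a' := by
      rw [← jacobiSym.neg _ ha']
      apply jacobiSym.mod_left'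
      apply Int.ModEq.symm
      rw [Int.modEq_iff_dvd]
      refine ⟨4 * 2 ^ e, ?_⟩
      have : (b : ℤ) + c = 4 * (2 ^ e * a') := by exact_mod_cast h
      linarith
    rw [h4, ← mul_assoc]
    congr 1
    have hbc : (b + c) % 4 = 0 := by rw [h]; omega
    rcases hb with ⟨k, rfl⟩
    rcases hc with ⟨l, rfl⟩
    rcases ha' with ⟨j, rfl⟩
    have e1 : (2 * k + 1) / 2 = k := by omega
    have e2 : (2 * l + 1) / 2 = l := by omega
    have e3 : (2 * j + 1) / 2 = j := by omega
    rw [ZMod.χ₄_eq_neg_one_pow (by omega), e1, e2, e3, pow_mul, pow_mul]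
    rcases Nat.even_or_odd j with hj | hj <;> rcases Nat.even_or_odd l with hl | hl
    · simp [hj.neg_one_pow]
    · simp [hj.neg_one_pow]
    · have : Odd k := by rcases hl with ⟨t, rfl⟩; exact ⟨k / 2, by omega⟩
      simp [hj.neg_one_pow, hl.neg_one_pow, this.neg_one_pow]
    · have : Even k := by rcases hl with ⟨t, rfl⟩; exact ⟨k / 2, by omega⟩
      simp [hj.neg_one_pow, hl.neg_one_pow, this.neg_one_pow]
  push_cast
  rw [jacobiSym.mul_left, jacobiSym.mul_left, jacobiSym.pow_left, jacobiSym.pow_left, h2, h3]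

theorem jacobiSym_add_mul {a b : ℕ} (hb : Odd b) :
    jacobiSym a (b + 4 * a) = jacobiSym a b := by
  have h : Odd (b + 4 * a) := by rcases hb with ⟨k, rfl⟩; exact ⟨k + 2 * a, by ring⟩
  rw [jacobiSym.mod_right' a h, jacobiSym.mod_right' a hb, Nat.add_mod_right]

theorem jacobiSym_four_mul (a : ℤ) {b : ℕ} (hb : Odd b) : jacobiSym (4 * a) b = jacobiSym a b := by
  rw [jacobiSym.mul_left, jacobiSym.at_four hb, one_mul]

theorem χ₄_add_four_mul (a b : ℕ) : ZMod.χ₄ ((b + 4 * a : ℕ) : ZMod 4) = ZMod.χ₄ b := by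
  push_cast
  have : (4 : ZMod 4) = 0 := rfl
  rw [this, zero_mul, add_zero]

theorem χ₄_reflect {a b c : ℕ} (h : b + c = 4 * a) :
    ZMod.χ₄ (c : ZMod 4) = -ZMod.χ₄ (b : ZMod 4) := by
  have h1 : (c : ZMod 4) = -1 * (b : ZMod 4) := by
    have h2 : ((b + c : ℕ) : ZMod 4) = 0 := by
      rw [h]; push_cast
      have : (4 : ZMod 4) = 0 := rfl
      rw [this, zero_mul]
    push_cast at h2
    linear_combination h2
  rw [h1, map_mul, show ZMod.χ₄ (-1) = -1 from rfl, neg_one_mul]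

/-- If d and d + c have the same sign, this is periodicity in the denominator. If the signs differ,
then |d| + |d + c| = |c| and the reflection rule applies; for c < 0 it costs a sign from χ₄, which
the sign convention for c, d < 0 compensates. -/
theorem kronecker_add_right {c d : ℤ} (hc : 4 ∣ c) (hd : Odd d) :
    kronecker c (d + c) = kronecker c d := by
  obtain ⟨a, rfl⟩ := hc
  have hb : Odd d.natAbs := Int.natAbs_odd.mpr hd
  have hb' : Odd (d + 4 * a).natAbs := by
    rw [Int.natAbs_odd]; obtain ⟨k, rfl⟩ := hd; exact ⟨k + 2 * a, by ring⟩
  unfold kronecker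
  rw [jacobiSym_four_mul a hb, jacobiSym_four_mul a hb']
  have hodd := Int.odd_iff.mp hd
  generalize hB : d.natAbs = b at *
  generalize hC : (d + 4 * a).natAbs = c at *
  rcases lt_trichotomy a 0 with ha | rfl | ha
  · obtain ⟨k, rfl⟩ : ∃ k : ℕ, a = -k := ⟨a.natAbs, by omega⟩
    rw [jacobiSym.neg _ hb, jacobiSym.neg _ hb']
    rcases lt_or_ge d 0 with h1 | h1
    · rw [if_pos ⟨by omega, by omega⟩, if_pos ⟨by omega, by omega⟩,
        show c = b + 4 * k by omega, jacobiSym_add_mul hb, χ₄_add_four_mul]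
    · rw [if_neg (c := 4 * -(k : ℤ) < 0 ∧ d < 0) (by omega)]
      rcases lt_or_ge (d + 4 * -(k : ℤ)) 0 with h2 | h2
      · rw [if_pos ⟨by omega, h2⟩, χ₄_reflect (a := k) (b := b) (c := c) (by omega),
          jacobiSym_reflect (a := k) hb hb' (by omega)]
        ring
      · rw [if_neg (by omega)]
        obtain rfl : b = c + 4 * k := by omega
        rw [jacobiSym_add_mul hb', χ₄_add_four_mul]
  · simp at hC
    simp [← hB, ← hC]
  · obtain ⟨k, rfl⟩ : ∃ k : ℕ, a = k := ⟨a.natAbs, by omega⟩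
    rw [if_neg (by omega), if_neg (by omega)]
    rcases lt_or_ge d 0 with h1 | h1
    · rcases lt_or_ge (d + 4 * (k : ℤ)) 0 with h2 | h2
      · obtain rfl : b = c + 4 * k := by omega
        rw [jacobiSym_add_mul hb']
      · rw [jacobiSym_reflect (a := k) hb hb' (by omega)]
    · rw [show c = b + 4 * k by omega, jacobiSym_add_mul hb]

/-- The Jacobi symbol is unchanged, so only the sign convention intervenes. The exceptional case is
precisely the one in which the principal square root jumps in `exp_half_log_mul`. -/
theorem kronecker_add_left (c d : ℤ) :
    kronecker (c + 4 * d) d = if 0 ≤ c ∧ c + 4 * d < 0 then - kronecker c d else kronecker c d := by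
  have h : jacobiSym (c + 4 * d) d.natAbs = jacobiSym c d.natAbs := by
    apply jacobiSym.mod_left'
    apply Int.ModEq.symm
    rw [Int.modEq_iff_dvd, Int.natAbs_dvd]
    exact ⟨4, by ring⟩
  unfold kronecker
  rw [h]
  split_ifs <;> first | rfl | omega

theorem kronecker_neg_neg {c d : ℤ} (hd : Odd d) (hc : c ≠ 0) :
    kronecker (-c) (-d) = (if 0 < c then -1 else 1) * ZMod.χ₄ (d : ZMod 4) * kronecker c d := by
  have hb : Odd d.natAbs := Int.natAbs_odd.mpr hd
  have hd0 : d ≠ 0 := by rintro rfl; simp at hd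
  have h : ZMod.χ₄ (d : ZMod 4) = (if 0 < d then 1 else -1) * ZMod.χ₄ (d.natAbs : ZMod 4) := by
    split_ifs with h
    · have : (d : ZMod 4) = (d.natAbs : ZMod 4) := by
        conv_lhs => rw [← Int.natAbs_of_nonneg h.le]
        simp
      rw [this, one_mul]
    · have : (d : ZMod 4) = -1 * (d.natAbs : ZMod 4) := by
        conv_lhs => rw [show d = -(d.natAbs : ℤ) by omega]
        push_cast; simp
      rw [this, map_mul]
      rfl
  unfold kronecker
  rw [h, Int.natAbs_neg, jacobiSym.neg _ hb]
  split_ifs <;> first | omega | ring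

theorem kronecker_sq {c d : ℤ} (h : IsCoprime c d) : kronecker c d = 1 ∨ kronecker c d = -1 := by
  have h1 : c.gcd (d.natAbs : ℕ) = 1 := by
    rw [← Int.isCoprime_iff_gcd_eq_one]
    rcases Int.natAbs_eq d with h2 | h2
    · rwa [← h2]
    · rw [show ((d.natAbs : ℕ) : ℤ) = -d by omega]; exact h.neg_right
  have := jacobiSym.eq_one_or_neg_one h1
  unfold kronecker
  split_ifs <;> omega

/-! ### The multiplier and the factor cz + d -/

theorem eps_pow_four (d : ℤ) : eps d ^ 4 = 1 := by
  unfold eps; split_ifs <;> simp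

theorem eps_mod {d e : ℤ} (h : d % 4 = e % 4) : eps d = eps e := by
  unfold eps; rw [h]

theorem norm_eps (d : ℤ) : ‖eps d‖ = 1 := by
  unfold eps; split_ifs <;> simp

theorem isCoprime_row (M : SL(2, ℤ)) : IsCoprime (M 1 0) (M 1 1) := by
  have h := M.det_coe
  rw [Matrix.det_fin_two] at h
  exact ⟨-M 0 1, M 0 0, by linarith⟩

theorem norm_slashMultiplier (m : ℤ) (M : SL(2, ℤ)) : ‖slashMultiplier m M‖ = 1 := by
  unfold slashMultiplier
  split_ifs
  · simp
  · rcases kronecker_sq (isCoprime_row M) with h | h <;> simp [h, norm_eps]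

/-- `c z + d`. -/
noncomputable def cd (M : SL(2, ℤ)) (z : ℍ) : ℂ := ((M 1 0 : ℤ) : ℂ) * (z : ℂ) + ((M 1 1 : ℤ) : ℂ)

theorem cd_eq_denom (M : SL(2, ℤ)) (z : ℍ) : cd M z = denom M z := by
  rw [ModularGroup.denom_apply]; rfl

theorem cd_ne_zero (M : SL(2, ℤ)) (z : ℍ) : cd M z ≠ 0 := by
  rw [cd_eq_denom]; exact denom_ne_zero _ _

theorem coe_smul_mul_cd (M : SL(2, ℤ)) (z : ℍ) :
    ((M • z : ℍ) : ℂ) * cd M z = ((M 0 0 : ℤ) : ℂ) * (z : ℂ) + ((M 0 1 : ℤ) : ℂ) := by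
  have h := cd_ne_zero M z
  rw [specialLinearGroup_apply]
  unfold cd at *
  simp only [algebraMap_int_eq, eq_intCast, Complex.ofReal_intCast]
  exact div_mul_cancel₀ _ h

theorem cd_mul (L M : SL(2, ℤ)) (z : ℍ) : cd (L * M) z = cd L (M • z) * cd M z := by
  have h := coe_smul_mul_cd M z
  conv_rhs => rw [cd, add_mul, mul_assoc, h]
  simp only [cd, Matrix.SpecialLinearGroup.coe_mul, Matrix.mul_apply, Fin.sum_univ_two]
  push_cast
  ring

theorem coe_smul_sub (L : SL(2, ℤ)) (u w : ℍ) :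
    (((L • u : ℍ) : ℂ) - (L • w : ℍ)) * (cd L u * cd L w) = u - w := by
  have h1 := coe_smul_mul_cd L u
  have h2 := coe_smul_mul_cd L w
  have h3 : ((L 0 0 : ℤ) : ℂ) * (L 1 1 : ℤ) - (L 0 1 : ℤ) * (L 1 0 : ℤ) = 1 := by
    have h := L.det_coe
    rw [Matrix.det_fin_two] at h
    exact_mod_cast h
  calc _ = (((L • u : ℍ) : ℂ) * cd L u) * cd L w - (((L • w : ℍ) : ℂ) * cd L w) * cd L u := by ring
    _ = _ := by
      rw [h1, h2]
      unfold cd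
      linear_combination ((u : ℂ) - w) * h3

theorem coe_smul_sub_conj (L : SL(2, ℤ)) (u w : ℍ) :
    (((L • u : ℍ) : ℂ) - (starRingEnd ℂ) (L • w : ℍ)) * (cd L u * (starRingEnd ℂ) (cd L w)) =
      u - (starRingEnd ℂ) (w : ℂ) := by
  have h1 := coe_smul_mul_cd L u
  have h2 := congrArg (starRingEnd ℂ) (coe_smul_mul_cd L w)
  have h3 : ((L 0 0 : ℤ) : ℂ) * (L 1 1 : ℤ) - (L 0 1 : ℤ) * (L 1 0 : ℤ) = 1 := by
    have h := L.det_coe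
    rw [Matrix.det_fin_two] at h
    exact_mod_cast h
  simp only [map_mul, map_add, map_intCast] at h2
  calc _ = (((L • u : ℍ) : ℂ) * cd L u) * (starRingEnd ℂ) (cd L w)
        - ((starRingEnd ℂ) ((L • w : ℍ) : ℂ) * (starRingEnd ℂ) (cd L w)) * cd L u := by ring
    _ = _ := by
      rw [h1, h2]
      unfold cd
      simp only [map_mul, map_add, map_intCast]
      linear_combination ((u : ℂ) - (starRingEnd ℂ) (w : ℂ)) * h3

theorem im_smul_mul (L : SL(2, ℤ)) (w : ℍ) : (L • w).im * ‖cd L w‖ ^ 2 = w.im := by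
  have h := congrArg Complex.im (coe_smul_sub_conj L w w)
  rw [Complex.mul_conj, Complex.im_mul_ofReal, Complex.normSq_eq_norm_sq] at h
  simp only [Complex.sub_im, Complex.conj_im, coe_im] at h
  linarith

theorem cd_im (M : SL(2, ℤ)) (z : ℍ) : (cd M z).im = (M 1 0 : ℤ) * z.im := by
  simp [cd]

theorem denomPow_eq (m : ℤ) (M : SL(2, ℤ)) (z : ℍ) : denomPow m M z = cd M z ^ (-((m : ℂ) / 2)) :=
  rfl

/-- The automorphy factor of the slash action. -/
noncomputable def autFactor (m : ℤ) (M : SL(2, ℤ)) (z : ℍ) : ℂ := slashMultiplier m M * denomPow m M z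

theorem norm_autFactor (m : ℤ) (M : SL(2, ℤ)) (z : ℍ) :
    ‖autFactor m M z‖ = ‖cd M z‖ ^ (-((m : ℝ) / 2)) := by
  rw [autFactor, norm_mul, norm_slashMultiplier, one_mul, denomPow_eq,
    show (-((m : ℂ) / 2)) = ((-((m : ℝ) / 2) : ℝ) : ℂ) by push_cast; ring,
    Complex.norm_cpow_real]

/-! ### Generators of Γ₀(4) -/

theorem exists_two_mul_abs_add_mul_le {c : ℤ} (hc : c ≠ 0) (d : ℤ) :
    ∃ n : ℤ, 2 * |d + c * n| ≤ |c| := by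
  have h1 := Int.emod_add_mul_ediv d c
  have h2 := Int.emod_nonneg d hc
  have h3 := Int.emod_lt_abs d hc
  rcases le_or_gt (2 * (d % c)) |c| with h | h
  · refine ⟨-(d / c), ?_⟩
    rw [show d + c * -(d / c) = d % c by linarith, abs_of_nonneg h2]
    exact h
  · refine ⟨-(d / c) - c.sign, ?_⟩
    have h4 : c * c.sign = |c| := by rw [mul_comm, Int.sign_mul_self_eq_abs]
    rw [show d + c * (-(d / c) - c.sign) = d % c - |c| by linarith, abs_of_nonpos (by linarith)]
    linarith

/-- The matrix `(1 0; n 1)`. -/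
def lowerTriangular (n : ℤ) : SL(2, ℤ) := ModularGroup.S * ModularGroup.T ^ (-n) * ModularGroup.S⁻¹

theorem coe_lowerTriangular (n : ℤ) : (lowerTriangular n : Matrix (Fin 2) (Fin 2) ℤ) = !![1, 0; n, 1] := by
  rw [lowerTriangular, Matrix.SpecialLinearGroup.coe_mul, Matrix.SpecialLinearGroup.coe_mul,
    ModularGroup.coe_T_zpow, Matrix.SpecialLinearGroup.coe_inv, Matrix.adjugate_fin_two,
    ModularGroup.coe_S]
  ext i j
  fin_cases i <;> fin_cases j <;> simp [Matrix.mul_apply]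

theorem lowerTriangular_zpow (n k : ℤ) : lowerTriangular n ^ k = lowerTriangular (n * k) := by
  rw [lowerTriangular, conj_zpow, ← zpow_mul, lowerTriangular]
  ring_nf

theorem eq_T_zpow_or_neg {M : SL(2, ℤ)} (h : M 1 0 = 0) :
    ∃ n : ℤ, M = ModularGroup.T ^ n ∨ M = -ModularGroup.T ^ n := by
  have hd := M.det_coe
  rw [Matrix.det_fin_two, h, mul_zero, sub_zero] at hd
  rcases Int.mul_eq_one_iff_eq_one_or_neg_one.mp hd with ⟨h1, h2⟩ | ⟨h1, h2⟩
  · refine ⟨M 0 1, Or.inl ?_⟩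
    ext i j
    fin_cases i <;> fin_cases j <;> simp [ModularGroup.coe_T_zpow, h, h1, h2]
  · refine ⟨-M 0 1, Or.inr ?_⟩
    ext i j
    fin_cases i <;> fin_cases j <;> simp [ModularGroup.coe_T_zpow, h, h1, h2]

theorem mem_Gamma0_iff {N : ℕ} {M : SL(2, ℤ)} :
    M ∈ CongruenceSubgroup.Gamma0 N ↔ (N : ℤ) ∣ M 1 0 := by
  rw [CongruenceSubgroup.Gamma0_mem, ZMod.intCast_zmod_eq_zero_iff_dvd]

theorem odd_of_mem_Gamma0 {M : SL(2, ℤ)} (h : (4 : ℤ) ∣ M 1 0) : Odd (M 1 1) := by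
  have h1 := isCoprime_row M
  rw [← Int.not_even_iff_odd, even_iff_two_dvd]
  intro h2
  have h3 := h1.isUnit_of_dvd' (dvd_trans (by norm_num) h) h2
  rw [Int.isUnit_iff] at h3
  omega

/-- A Euclidean algorithm on the bottom row (c, d): right multiplication by a power of T makes 2|d|
≤ |c|, and then a power of (1 0; 4 1) makes |c| ≤ 2|d|. This decreases |c| until c = 0, where only
±Tⁿ remains. -/
theorem Gamma0_four_le (S : Subgroup SL(2, ℤ)) (hT : ModularGroup.T ∈ S)
    (hV : lowerTriangular 4 ∈ S) (hneg : -1 ∈ S) : CongruenceSubgroup.Gamma0 4 ≤ S := by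
  intro M hM
  rw [mem_Gamma0_iff] at hM
  obtain ⟨k, hk⟩ : ∃ k, k = (M 1 0).natAbs := ⟨_, rfl⟩
  induction k using Nat.strong_induction_on generalizing M with
  | _ k ih =>
    by_cases hc : M 1 0 = 0
    · obtain ⟨n, rfl | rfl⟩ := eq_T_zpow_or_neg hc
      · exact S.zpow_mem hT n
      · rw [← neg_one_mul]; exact S.mul_mem hneg (S.zpow_mem hT n)
    · obtain ⟨n, hn⟩ := exists_two_mul_abs_add_mul_le hc (M 1 1)
      set M₁ := M * ModularGroup.T ^ n with hM₁
      have h10 : M₁ 1 0 = M 1 0 := by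
        simp [hM₁, Matrix.mul_apply, ModularGroup.coe_T_zpow]
      have h11 : M₁ 1 1 = M 1 1 + M 1 0 * n := by
        simp [hM₁, Matrix.mul_apply, ModularGroup.coe_T_zpow]; ring
      have ho := odd_of_mem_Gamma0 (M := M₁) (by rw [h10]; exact hM)
      rw [← h11] at hn
      have h0 : M₁ 1 1 ≠ 0 := by intro h; rw [h] at ho; simp at ho
      obtain ⟨l, hl⟩ := exists_two_mul_abs_add_mul_le (c := 4 * M₁ 1 1) (by simpa using h0) (M₁ 1 0)
      set M₂ := M₁ * lowerTriangular 4 ^ l with hM₂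
      have h20 : M₂ 1 0 = M₁ 1 0 + 4 * M₁ 1 1 * l := by
        simp [hM₂, lowerTriangular_zpow, Matrix.mul_apply, coe_lowerTriangular]; ring
      rw [← h20] at hl
      have h4 : (4 : ℤ) ∣ M₂ 1 0 := by
        rw [h20, h10]; exact dvd_add hM ⟨M₁ 1 1 * l, by ring⟩
      rw [h10] at h20
      -- The descent is strict: d is odd, so 2|d| ≡ 2 (mod 4) cannot equal the old |c|, which is
      -- divisible by 4.
      have key : (M₂ 1 0).natAbs < k := by
        obtain ⟨c, hc'⟩ := hM
        obtain ⟨c', hc''⟩ := h4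
        obtain ⟨e, he⟩ := ho
        push_cast at hc'
        simp only [Int.abs_eq_natAbs] at hn hl
        omega
      have h5 := ih _ key h4 rfl
      have h6 : M = M₂ * (lowerTriangular 4 ^ l)⁻¹ * (ModularGroup.T ^ n)⁻¹ := by
        rw [hM₂, hM₁]; group
      rw [h6]
      exact S.mul_mem (S.mul_mem h5 (S.inv_mem (S.zpow_mem hV l))) (S.inv_mem (S.zpow_mem hT n))

/-! ### The cocycle relation for the automorphy factor -/

theorem autFactor_ne_zero (m : ℤ) (M : SL(2, ℤ)) (z : ℍ) : autFactor m M z ≠ 0 := by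
  rw [← norm_ne_zero_iff, norm_autFactor]
  exact (Real.rpow_pos_of_pos (norm_pos_iff.mpr (cd_ne_zero M z)) _).ne'

theorem autFactor_one_eq (M : SL(2, ℤ)) (z : ℍ) :
    autFactor 1 M z = kronecker (M 1 0) (M 1 1) * eps (M 1 1) * Complex.exp (-(Complex.log (cd M z)) / 2) := by
  rw [autFactor, denomPow_eq, Complex.cpow_def_of_ne_zero (cd_ne_zero M z), slashMultiplier,
    if_neg (by decide)]
  congr 1
  · rcases kronecker_sq (isCoprime_row M) with h | h <;> rw [h] <;> simp
  · congr 1; push_cast; ring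

/-- The power with exponent -m/2 is exp(-log/2)^m for one and the same logarithm, and a sign is its
own odd power. Hence the cocycle relation is needed in weight 1/2 only. -/
theorem autFactor_eq_zpow {m : ℤ} (hm : Odd m) (M : SL(2, ℤ)) (z : ℍ) :
    autFactor m M z = autFactor 1 M z ^ m := by
  rw [autFactor_one_eq, autFactor, denomPow_eq, Complex.cpow_def_of_ne_zero (cd_ne_zero M z),
    slashMultiplier, if_neg (by rwa [Int.not_even_iff_odd]), mul_zpow, mul_zpow,
    ← Complex.exp_int_mul]
  congr 1
  · congr 1
    rcases kronecker_sq (isCoprime_row M) with h | h <;> rw [h] <;> simp [hm.neg_one_zpow, hm.neg.neg_one_zpow]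
  · congr 1; ring

theorem log_mul_sub {a b : ℂ} (ha : a ≠ 0) (hb : b ≠ 0) (h : Real.pi < a.arg + b.arg) :
    Complex.log (a * b) = Complex.log a + Complex.log b - 2 * Real.pi * Complex.I := by
  rw [← Complex.log_exp (x := Complex.log a + Complex.log b - 2 * Real.pi * Complex.I),
    Complex.exp_sub, Complex.exp_add, Complex.exp_log ha, Complex.exp_log hb,
    Complex.exp_two_pi_mul_I, div_one]
  · simp [Complex.log_im]; linarith
  · simp [Complex.log_im]; linarith [a.arg_le_pi, b.arg_le_pi, Real.pi_pos]

theorem arg_pos_of_im_pos {a : ℂ} (h : 0 < a.im) : 0 < a.arg := by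
  refine lt_of_le_of_ne (Complex.arg_nonneg_iff.mpr h.le) fun h0 => ?_
  have := Complex.arg_eq_zero_iff.mp h0.symm
  linarith [this.2]

theorem arg_lt_pi_of_im_pos {a : ℂ} (h : 0 < a.im) : a.arg < Real.pi :=
  Complex.arg_lt_pi_iff.mpr (Or.inr h.ne')

theorem im_mul_eq (a b : ℂ) :
    (a * b).im = ‖a‖ * ‖b‖ * Real.sin (a.arg + b.arg) := by
  conv_lhs => rw [← Complex.norm_mul_exp_arg_mul_I a, ← Complex.norm_mul_exp_arg_mul_I b]
  rw [show (‖a‖ : ℂ) * Complex.exp (a.arg * Complex.I) * (‖b‖ * Complex.exp (b.arg * Complex.I)) =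
    ((‖a‖ * ‖b‖ : ℝ) : ℂ) * Complex.exp ((a.arg + b.arg : ℝ) * Complex.I) by
      push_cast; rw [add_mul, Complex.exp_add]; ring, Complex.im_ofReal_mul,
    Complex.exp_ofReal_mul_I_im]

/-- The principal roots fail to multiply exactly when arg a + arg b > π. Since 0 < arg b < π, this
can be read off from the signs of Im a and Im(ab), which for factors cz + d are the signs of
integers. -/
theorem exp_half_log_mul {a b : ℂ} (ha : a ≠ 0) (hb : 0 < b.im) :
    Complex.exp (-Complex.log (a * b) / 2) =
      (if 0 ≤ a.im ∧ (a * b).im < 0 then -1 else 1) *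
        (Complex.exp (-Complex.log a / 2) * Complex.exp (-Complex.log b / 2)) := by
  have hb0 : b ≠ 0 := by rintro rfl; simp at hb
  have h1 := arg_pos_of_im_pos hb
  have h2 := arg_lt_pi_of_im_pos hb
  have hn : 0 < ‖a‖ * ‖b‖ := by positivity
  split_ifs with h
  · have h3 : Real.pi < a.arg + b.arg := by
      by_contra! hcon
      have h4 := Complex.arg_nonneg_iff.mpr h.1
      have h5 := Real.sin_nonneg_of_nonneg_of_le_pi (by linarith) hcon
      have h6 := h.2
      rw [im_mul_eq] at h6
      nlinarith
    rw [log_mul_sub ha hb0 h3, ← Complex.exp_add,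
      show -(Complex.log a + Complex.log b - 2 * Real.pi * Complex.I) / 2 =
        -Complex.log a / 2 + -Complex.log b / 2 + Real.pi * Complex.I by ring,
      Complex.exp_add, Complex.exp_pi_mul_I]
    ring
  · have h3 : a.arg + b.arg ≤ Real.pi := by
      rcases lt_or_ge a.im 0 with h4 | h4
      · linarith [Complex.arg_neg_iff.mpr h4]
      · by_contra! hcon
        apply h
        refine ⟨h4, ?_⟩
        rw [im_mul_eq]
        have h5 : Real.sin (a.arg + b.arg) < 0 := by
          have := Real.sin_pos_of_pos_of_lt_pi (x := a.arg + b.arg - Real.pi) (by linarith)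
            (by linarith [a.arg_le_pi])
          rw [Real.sin_sub_pi] at this
          linarith
        nlinarith
    rw [(Complex.log_mul_eq_add_log_iff ha hb0).mpr ⟨by linarith [a.neg_pi_lt_arg], h3⟩,
      ← Complex.exp_add, one_mul]
    ring_nf

theorem exp_half_log_neg {w : ℂ} (hw : w.im ≠ 0) :
    Complex.exp (-Complex.log (-w) / 2) =
      (if 0 < w.im then Complex.I else -Complex.I) * Complex.exp (-Complex.log w / 2) := by
  have hw0 : w ≠ 0 := by rintro rfl; simp at hw
  split_ifs with h
  · have : Complex.log (-w) = Complex.log w - Real.pi * Complex.I := by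
      rw [Complex.log, Complex.log, Complex.arg_neg_eq_arg_sub_pi_of_im_pos h, norm_neg]
      push_cast; ring
    rw [this, show -(Complex.log w - Real.pi * Complex.I) / 2 =
      Real.pi / 2 * Complex.I + -Complex.log w / 2 by ring, Complex.exp_add,
      Complex.exp_pi_div_two_mul_I]
  · have h' : w.im < 0 := lt_of_le_of_ne (not_lt.mp h) hw
    have : Complex.log (-w) = Complex.log w + Real.pi * Complex.I := by
      rw [Complex.log, Complex.log, Complex.arg_neg_eq_arg_add_pi_of_im_neg h', norm_neg]
      push_cast; ring
    rw [this, show -(Complex.log w + Real.pi * Complex.I) / 2 =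
      -Real.pi / 2 * Complex.I + -Complex.log w / 2 by ring, Complex.exp_add,
      Complex.exp_neg_pi_div_two_mul_I]

theorem Gamma0_odd {L : SL(2, ℤ)} (hL : L ∈ CongruenceSubgroup.Gamma0 4) : Odd (L 1 1) :=
  odd_of_mem_Gamma0 (mem_Gamma0_iff.mp hL)

theorem autFactor_one_mul_T {L : SL(2, ℤ)} (hL : L ∈ CongruenceSubgroup.Gamma0 4) (z : ℍ) :
    autFactor 1 (L * ModularGroup.T) z =
      autFactor 1 L (ModularGroup.T • z) * autFactor 1 ModularGroup.T z := by
  have h10 : (L * ModularGroup.T) 1 0 = L 1 0 := by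
    simp [Matrix.mul_apply, ModularGroup.coe_T]
  have h11 : (L * ModularGroup.T) 1 1 = L 1 1 + L 1 0 := by
    simp [Matrix.mul_apply, ModularGroup.coe_T]; ring
  have hT0 : ModularGroup.T 1 0 = 0 := by simp [ModularGroup.coe_T]
  have hT1 : ModularGroup.T 1 1 = 1 := by simp [ModularGroup.coe_T]
  have hcd : cd ModularGroup.T z = 1 := by simp [cd, hT0, hT1]
  have h4 := mem_Gamma0_iff.mp hL
  rw [autFactor_one_eq, autFactor_one_eq, autFactor_one_eq, cd_mul, hcd, h10, h11, hT0, hT1,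
    kronecker_add_right h4 (Gamma0_odd hL), eps_mod (d := L 1 1 + L 1 0) (e := L 1 1) (by
      push_cast at h4; omega)]
  simp [kronecker, eps]

theorem mul_neg_iff_neg_left_of_pos {x y : ℝ} (hy : 0 < y) : x * y < 0 ↔ x < 0 :=
  ⟨fun h => by
    by_contra! h'
    exact absurd (mul_nonneg h' hy.le) (not_le.mpr h), fun h => mul_neg_of_neg_of_pos h hy⟩

/-- The sign from the square root and the sign from the Kronecker symbol occur under the same
condition 0 ≤ c, c + 4d < 0, because Im(cz + d) has the sign of c. The factor ε_d is unaffected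
since d does not change. -/
theorem autFactor_one_mul_lowerTriangular {L : SL(2, ℤ)} (z : ℍ) :
    autFactor 1 (L * lowerTriangular 4) z =
      autFactor 1 L (lowerTriangular 4 • z) * autFactor 1 (lowerTriangular 4) z := by
  have h10 : (L * lowerTriangular 4) 1 0 = L 1 0 + 4 * L 1 1 := by
    simp [Matrix.mul_apply, coe_lowerTriangular]; ring
  have h11 : (L * lowerTriangular 4) 1 1 = L 1 1 := by
    simp [Matrix.mul_apply, coe_lowerTriangular]
  have hT0 : lowerTriangular 4 1 0 = 4 := by simp [coe_lowerTriangular]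
  have hT1 : lowerTriangular 4 1 1 = 1 := by simp [coe_lowerTriangular]
  have him : 0 < (cd (lowerTriangular 4) z).im := by
    rw [cd_im, hT0]; have := z.im_pos; push_cast; positivity
  have hk : kronecker 4 1 = 1 := by simp [kronecker]
  have he : eps 1 = 1 := by simp [eps]
  have hiff : (0 ≤ (cd L (lowerTriangular 4 • z)).im ∧
      (cd L (lowerTriangular 4 • z) * cd (lowerTriangular 4) z).im < 0) ↔
      (0 ≤ L 1 0 ∧ L 1 0 + 4 * L 1 1 < 0) := by
    rw [← cd_mul, cd_im, cd_im, h10, mul_nonneg_iff_of_pos_right (im_pos _),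
      mul_neg_iff_neg_left_of_pos (im_pos _)]
    norm_cast
  rw [autFactor_one_eq, autFactor_one_eq, autFactor_one_eq, cd_mul, h10, h11, hT0, hT1,
    kronecker_add_left, exp_half_log_mul (cd_ne_zero _ _) him, hk, he]
  simp only [hiff]
  split_ifs <;> push_cast <;> ring

theorem autFactor_one_neg (z : ℍ) : autFactor 1 (-1) z = 1 := by
  have h0 : (-1 : SL(2, ℤ)) 1 0 = 0 := by simp
  have h1 : (-1 : SL(2, ℤ)) 1 1 = -1 := by simp
  rw [autFactor_one_eq, cd, h0, h1]
  have : -(Complex.log (((0 : ℤ) : ℂ) * (z : ℂ) + ((-1 : ℤ) : ℂ))) / 2 =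
      -Real.pi / 2 * Complex.I := by
    push_cast
    rw [zero_mul, zero_add, Complex.log_neg_one]; ring
  rw [this, Complex.exp_neg_pi_div_two_mul_I]
  simp [kronecker, eps]

theorem χ₄_cast_of_emod_one {d : ℤ} (h : d % 4 = 1) : ZMod.χ₄ (d : ZMod 4) = 1 := by
  rw [ZMod.χ₄_int_eq_if_mod_four, if_neg (by omega), if_pos h]

theorem χ₄_cast_of_emod_three {d : ℤ} (h : d % 4 = 3) : ZMod.χ₄ (d : ZMod 4) = -1 := by
  rw [ZMod.χ₄_int_eq_if_mod_four, if_neg (by omega), if_neg (by omega)]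

/-- The root of -(cz+d) contributes ±i according to the sign of c, the Kronecker symbol contributes
that sign together with χ₄(d), and passing from ε_d to ε_{-d} contributes the remaining power of i.
For c = 0 the value lies on the real axis, where the branch cut requires a separate computation. -/
theorem autFactor_one_mul_neg {L : SL(2, ℤ)} (hL : L ∈ CongruenceSubgroup.Gamma0 4) (z : ℍ) :
    autFactor 1 (L * -1) z = autFactor 1 L z := by
  rw [mul_neg, mul_one]
  by_cases hc : L 1 0 = 0
  · obtain ⟨n, rfl | rfl⟩ := eq_T_zpow_or_neg hc
    · rw [autFactor_one_eq, autFactor_one_eq]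
      have e0 : (-ModularGroup.T ^ n) 1 0 = 0 := by simp [ModularGroup.coe_T_zpow]
      have e1 : (-ModularGroup.T ^ n) 1 1 = -1 := by simp [ModularGroup.coe_T_zpow]
      have e2 : (ModularGroup.T ^ n) 1 1 = 1 := by simp [ModularGroup.coe_T_zpow]
      have h1 := autFactor_one_neg z
      have h0 : (-1 : SL(2, ℤ)) 1 0 = 0 := by simp
      have h1' : (-1 : SL(2, ℤ)) 1 1 = -1 := by simp
      rw [autFactor_one_eq, cd, h0, h1'] at h1
      rw [cd, cd, e0, e1, h1, hc, e2]
      simp [kronecker, eps]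
    · rw [autFactor_one_eq, autFactor_one_eq]
      have e0 : (-ModularGroup.T ^ n) 1 0 = 0 := by simp [ModularGroup.coe_T_zpow]
      have e1 : (-ModularGroup.T ^ n) 1 1 = -1 := by simp [ModularGroup.coe_T_zpow]
      have e2 : (ModularGroup.T ^ n) 1 1 = 1 := by simp [ModularGroup.coe_T_zpow]
      have e3 : (ModularGroup.T ^ n) 1 0 = 0 := by simp [ModularGroup.coe_T_zpow]
      have h1 := autFactor_one_neg z
      have h0 : (-1 : SL(2, ℤ)) 1 0 = 0 := by simp
      have h1' : (-1 : SL(2, ℤ)) 1 1 = -1 := by simp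
      rw [autFactor_one_eq, cd, h0, h1'] at h1
      rw [neg_neg, cd, cd, e2, e3, e0, e1, h1]
      simp [kronecker, eps]
  · have h10 : (-L) 1 0 = -L 1 0 := by simp
    have h11 : (-L) 1 1 = -L 1 1 := by simp
    have hcd : cd (-L) z = -cd L z := by rw [cd, cd, h10, h11]; push_cast; ring
    have hw : (cd L z).im ≠ 0 := by
      rw [cd_im]; exact mul_ne_zero (by exact_mod_cast hc) z.im_ne_zero
    have hiff : 0 < (cd L z).im ↔ 0 < L 1 0 := by
      rw [cd_im, mul_pos_iff_of_pos_right (im_pos _)]; norm_cast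
    have hodd := Gamma0_odd hL
    rw [autFactor_one_eq, autFactor_one_eq, hcd, exp_half_log_neg hw, h10, h11,
      kronecker_neg_neg hodd hc]
    simp only [hiff]
    have h4 : L 1 1 % 4 = 1 ∨ L 1 1 % 4 = 3 := by rcases hodd with ⟨k, hk⟩; omega
    rcases h4 with h4 | h4
    · have e1 : eps (-L 1 1) = Complex.I := by unfold eps; rw [if_neg (by omega)]
      have e2 : eps (L 1 1) = 1 := by unfold eps; rw [if_pos h4]
      rw [e1, e2, χ₄_cast_of_emod_one h4]
      split_ifs <;> push_cast <;> ring_nf <;> rw [Complex.I_sq] <;> ring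
    · have e1 : eps (-L 1 1) = 1 := by unfold eps; rw [if_pos (by omega)]
      have e2 : eps (L 1 1) = Complex.I := by unfold eps; rw [if_neg (by omega)]
      rw [e1, e2, χ₄_cast_of_emod_three h4]
      split_ifs <;> push_cast <;> ring

theorem autFactor_one_one (z : ℍ) : autFactor 1 1 z = 1 := by
  rw [autFactor_one_eq, cd]
  simp [kronecker, eps]

/-- The elements of `Γ₀(4)` for which the cocycle relation of the theta multiplier holds. -/
def cocycleSubgroup : Subgroup SL(2, ℤ) where
  carrier := {M | M ∈ CongruenceSubgroup.Gamma0 4 ∧ ∀ L ∈ CongruenceSubgroup.Gamma0 4, ∀ z : ℍ,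
    autFactor 1 (L * M) z = autFactor 1 L (M • z) * autFactor 1 M z}
  one_mem' := ⟨one_mem _, fun L _ z => by rw [mul_one, one_smul, autFactor_one_one, mul_one]⟩
  mul_mem' := by
    rintro M M' ⟨hM, h⟩ ⟨hM', h'⟩
    refine ⟨mul_mem hM hM', fun L hL z => ?_⟩
    rw [← mul_assoc, h' _ (mul_mem hL hM), h L hL, h' M hM, mul_smul, mul_assoc]
  inv_mem' := by
    rintro M ⟨hM, h⟩
    refine ⟨inv_mem hM, fun L hL z => ?_⟩
    -- The relation for M⁻¹ follows from the relation for M applied to L M⁻¹ and to M⁻¹, both at the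
    -- point M⁻¹z.
    have h1 := h (L * M⁻¹) (mul_mem hL (inv_mem hM)) (M⁻¹ • z)
    have h2 := h M⁻¹ (inv_mem hM) (M⁻¹ • z)
    rw [inv_mul_cancel, autFactor_one_one, smul_inv_smul] at h2
    rw [inv_mul_cancel_right, smul_inv_smul] at h1
    have h3 := autFactor_ne_zero 1 M (M⁻¹ • z)
    rw [h1]
    linear_combination (autFactor 1 (L * M⁻¹) z) * h2

theorem autFactor_one_cocycle {L M : SL(2, ℤ)} (hL : L ∈ CongruenceSubgroup.Gamma0 4)
    (hM : M ∈ CongruenceSubgroup.Gamma0 4) (z : ℍ) :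
    autFactor 1 (L * M) z = autFactor 1 L (M • z) * autFactor 1 M z := by
  have h : CongruenceSubgroup.Gamma0 4 ≤ cocycleSubgroup := by
    apply Gamma0_four_le
    · refine ⟨?_, fun L hL z => autFactor_one_mul_T hL z⟩
      rw [mem_Gamma0_iff]; simp [ModularGroup.coe_T]
    · refine ⟨?_, fun L hL z => autFactor_one_mul_lowerTriangular z⟩
      rw [mem_Gamma0_iff]; simp [coe_lowerTriangular]
    · refine ⟨?_, fun L hL z => ?_⟩
      · rw [mem_Gamma0_iff]; simp
      · rw [autFactor_one_mul_neg hL, autFactor_one_neg, mul_one, ModularGroup.SL_neg_smul, one_smul]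
  exact (h hM).2 L hL z

theorem autFactor_cocycle {m : ℤ} {N : ℕ} (hmN : Odd m → 4 ∣ N) {L M : SL(2, ℤ)}
    (hL : L ∈ CongruenceSubgroup.Gamma0 N) (hM : M ∈ CongruenceSubgroup.Gamma0 N) (z : ℍ) :
    autFactor m (L * M) z = autFactor m L (M • z) * autFactor m M z := by
  rcases Int.even_or_odd m with hm | hm
  · obtain ⟨k, rfl⟩ := hm
    have hk : (-(((k + k : ℤ) : ℂ) / 2)) = ((-k : ℤ) : ℂ) := by push_cast; ring
    simp only [autFactor, denomPow_eq, slashMultiplier, if_pos (Even.add_self k), hk,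
      Complex.cpow_intCast, one_mul, cd_mul, mul_zpow]
  · have h4 : ∀ {M : SL(2, ℤ)}, M ∈ CongruenceSubgroup.Gamma0 N →
        M ∈ CongruenceSubgroup.Gamma0 4 := fun h => by
      rw [mem_Gamma0_iff] at *
      exact dvd_trans (by exact_mod_cast hmN hm) h
    rw [autFactor_eq_zpow hm, autFactor_eq_zpow hm, autFactor_eq_zpow hm,
      autFactor_one_cocycle (h4 hL) (h4 hM), mul_zpow]

/-! ### Transformation of the kernels -/

/-- Comparison of logarithms in `(L u - conj (L w)) j(L, u) conj (j(L, w)) = u - conj w`. -/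
theorem log_sub_conj (L : SL(2, ℤ)) (u w : ℍ) :
    Complex.log (u - (starRingEnd ℂ) (w : ℂ)) =
      Complex.log (((L • u : ℍ) : ℂ) - (starRingEnd ℂ) (L • w : ℍ)) + Complex.log (cd L u) +
        (starRingEnd ℂ) (Complex.log (cd L w)) := by
  set q := ((L • u : ℍ) : ℂ) - (starRingEnd ℂ) (L • w : ℍ) with hq
  set p := (u : ℂ) - (starRingEnd ℂ) (w : ℂ) with hp
  have hqim : 0 < q.im := by
    have h1 := (L • u).im_pos
    have h2 := (L • w).im_pos
    simp only [hq, Complex.sub_im, Complex.conj_im, coe_im]; linarith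
  have hpim : 0 < p.im := by
    have h1 := u.im_pos
    have h2 := w.im_pos
    simp only [hp, Complex.sub_im, Complex.conj_im, coe_im]; linarith
  have hq0 : q ≠ 0 := by intro h; simp [h] at hqim
  have hp0 : p ≠ 0 := by intro h; simp [h] at hpim
  have hx : ∃ n : ℤ, Complex.log p = Complex.log q + Complex.log (cd L u) +
      (starRingEnd ℂ) (Complex.log (cd L w)) + n * (2 * Real.pi * Complex.I) := by
    rw [← Complex.exp_eq_exp_iff_exists_int, Complex.exp_log hp0, Complex.exp_add, Complex.exp_add,
      Complex.exp_log hq0, Complex.exp_log (cd_ne_zero _ _), Complex.exp_conj,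
      Complex.exp_log (cd_ne_zero _ _), hp, hq, ← coe_smul_sub_conj L u w]
    ring
  obtain ⟨n, hn⟩ := hx
  have him := congrArg Complex.im hn
  have him2 : (n * (2 * Real.pi * Complex.I) : ℂ).im = n * (2 * Real.pi) := by simp
  rw [Complex.add_im, Complex.add_im, Complex.add_im, him2, Complex.conj_im, Complex.log_im,
    Complex.log_im, Complex.log_im, Complex.log_im] at him
  have a1 := arg_pos_of_im_pos hpim
  have a2 := arg_lt_pi_of_im_pos hpim
  have a3 := arg_pos_of_im_pos hqim
  have a4 := arg_lt_pi_of_im_pos hqim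
  have hpi := Real.pi_pos
  -- The arguments of p and q lie in (0, π). Those of the two factors cd have the same sign, that of
  -- the lower left entry, and enter with opposite signs because of the conjugation. The total
  -- discrepancy is therefore less than 2π.
  have hn0 : n = 0 := by
    have key : |(n : ℝ)| * (2 * Real.pi) < 1 * (2 * Real.pi) := by
      rw [← abs_of_pos (show 0 < 2 * Real.pi by positivity), ← abs_mul,
        abs_of_pos (show 0 < 2 * Real.pi by positivity), one_mul, abs_lt]
      rcases lt_trichotomy (L 1 0) 0 with hc | hc | hc
      · have b1 : (cd L u).arg < 0 := Complex.arg_neg_iff.mpr (by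
          rw [cd_im]; exact mul_neg_of_neg_of_pos (by exact_mod_cast hc) u.im_pos)
        have b2 : (cd L w).arg < 0 := Complex.arg_neg_iff.mpr (by
          rw [cd_im]; exact mul_neg_of_neg_of_pos (by exact_mod_cast hc) w.im_pos)
        have b3 := (cd L u).neg_pi_lt_arg
        have b4 := (cd L w).neg_pi_lt_arg
        constructor <;> linarith
      · have : cd L u = cd L w := by simp [cd, hc]
        rw [this] at him
        constructor <;> linarith
      · have b1 : 0 < (cd L u).arg := arg_pos_of_im_pos (by
          rw [cd_im]; exact mul_pos (by exact_mod_cast hc) u.im_pos)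
        have b2 : 0 < (cd L w).arg := arg_pos_of_im_pos (by
          rw [cd_im]; exact mul_pos (by exact_mod_cast hc) w.im_pos)
        have b3 := (cd L u).arg_le_pi
        have b4 := (cd L w).arg_le_pi
        constructor <;> linarith
    have := lt_of_mul_lt_mul_right key (by positivity)
    have h1 : |n| < 1 := by exact_mod_cast this
    exact Int.abs_lt_one_iff.mp h1
  rw [hn, hn0]
  simp

theorem sub_conj_im_pos (u w : ℍ) : 0 < ((u : ℂ) - (starRingEnd ℂ) (w : ℂ)).im := by
  have h1 := u.im_pos
  have h2 := w.im_pos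
  simp only [Complex.sub_im, Complex.conj_im, coe_im]; linarith

theorem sub_conj_ne_zero (u w : ℍ) : (u : ℂ) - (starRingEnd ℂ) (w : ℂ) ≠ 0 := by
  intro h
  have := sub_conj_im_pos u w
  simp [h] at this

theorem psiTerm_eq (m n : ℤ) (N : ℕ) (z 𝔷 : ℍ) (M : CongruenceSubgroup.Gamma0 N) :
    psiTerm m n N z 𝔷 M = autFactor m M z * psiKernel m n 𝔷 ((M : SL(2, ℤ)) • z) := rfl

theorem psiKernel_neg_one_eq (m : ℤ) (𝔷 u : ℍ) :
    psiKernel m (-1) 𝔷 u = ((u : ℂ) - 𝔷)⁻¹ *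
      ((u : ℂ) - (starRingEnd ℂ) (𝔷 : ℂ)) ^ ((1 - (m : ℝ) / 2 : ℝ) : ℂ) := by
  rw [psiKernel, zpow_neg_one, div_eq_mul_inv, ← Complex.cpow_neg]
  push_cast
  ring_nf

theorem norm_psiKernel_neg_one (m : ℤ) (𝔷 u : ℍ) :
    ‖psiKernel m (-1) 𝔷 u‖ = ‖(u : ℂ) - 𝔷‖⁻¹ *
      ‖(u : ℂ) - (starRingEnd ℂ) (𝔷 : ℂ)‖ ^ (1 - (m : ℝ) / 2) := by
  rw [psiKernel_neg_one_eq, norm_mul, norm_inv, Complex.norm_cpow_real]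

theorem slashMultiplier_dual (m : ℤ) (L : SL(2, ℤ)) :
    slashMultiplier (4 - m) L * slashMultiplier m L = 1 := by
  have hpar : Even (4 - m) ↔ Even m := by
    rw [Int.even_sub]; simp [show Even (4 : ℤ) by decide]
  unfold slashMultiplier
  simp only [hpar]
  split_ifs with h
  · simp
  · have he : eps (L 1 1) ≠ 0 := by rw [← norm_ne_zero_iff, norm_eps]; simp
    have h4 : eps (L 1 1) ^ (4 - m) * eps (L 1 1) ^ m = 1 := by
      rw [← zpow_add₀ he, sub_add_cancel]; exact_mod_cast eps_pow_four _
    have hk : ((kronecker (L 1 0) (L 1 1) : ℤ) : ℂ) ^ (-(4 - m)) *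
        ((kronecker (L 1 0) (L 1 1) : ℤ) : ℂ) ^ (-m) = 1 := by
      rcases kronecker_sq (isCoprime_row L) with h' | h' <;> rw [h']
      · simp
      · push_cast
        rw [← zpow_add₀ (by norm_num), show -(4 - m) + -m = -4 by ring]
        norm_num
    linear_combination eps (L 1 1) ^ (4 - m) * eps (L 1 1) ^ m * hk + h4

theorem conj_slashMultiplier_mul (m : ℤ) (L : SL(2, ℤ)) :
    (starRingEnd ℂ) (slashMultiplier m L) * slashMultiplier m L = 1 := by
  rw [mul_comm, Complex.mul_conj, Complex.normSq_eq_norm_sq, norm_slashMultiplier]; simp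

theorem im_smul_rpow (L : SL(2, ℤ)) (w : ℍ) (a : ℝ) :
    (((L • w).im ^ a : ℝ) : ℂ) = ((w.im ^ a : ℝ) : ℂ) *
      Complex.exp (-a * (Complex.log (cd L w) + (starRingEnd ℂ) (Complex.log (cd L w)))) := by
  have hn : 0 < ‖cd L w‖ := norm_pos_iff.mpr (cd_ne_zero L w)
  have h1 : (L • w).im = w.im * (‖cd L w‖ ^ 2)⁻¹ := by
    rw [← im_smul_mul L w]; field_simp
  have h2 : Complex.exp (-a * (Complex.log (cd L w) + (starRingEnd ℂ) (Complex.log (cd L w)))) =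
      ((((‖cd L w‖ ^ 2)⁻¹) ^ a : ℝ) : ℂ) := by
    rw [Complex.add_conj, Complex.log_re, Real.rpow_def_of_pos (by positivity), Real.log_inv,
      Real.log_pow]
    push_cast
    ring_nf
  rw [h1, Real.mul_rpow w.im_pos.le (by positivity), h2]
  push_cast
  ring

/-- The kernel has weight κ in u, and the factor Im(w)^(κ-1) turns the remaining powers of j(L, w)
and its conjugate into weight 2 - κ in w. Once `log_sub_conj` has settled the branches, every power
is an exponential of the same three logarithms and the exponents agree linearly. -/
theorem kernel_transform (m : ℤ) (L : SL(2, ℤ)) (u w : ℍ) :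
    autFactor (4 - m) L w * ((((L • w).im ^ ((m : ℝ) / 2 - 1) : ℝ) : ℂ) *
      (autFactor m L u * psiKernel m (-1) (L • w) (L • u))) =
    ((w.im ^ ((m : ℝ) / 2 - 1) : ℝ) : ℂ) * psiKernel m (-1) w u := by
  rw [psiKernel_neg_one_eq, psiKernel_neg_one_eq, autFactor, autFactor, denomPow_eq, denomPow_eq,
    Complex.cpow_def_of_ne_zero (sub_conj_ne_zero _ _),
    Complex.cpow_def_of_ne_zero (sub_conj_ne_zero _ _),
    Complex.cpow_def_of_ne_zero (cd_ne_zero _ _), Complex.cpow_def_of_ne_zero (cd_ne_zero _ _),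
    im_smul_rpow, log_sub_conj L u w, ← coe_smul_sub L u w, mul_inv, mul_inv]
  have h := slashMultiplier_dual m L
  have e1 : (cd L u)⁻¹ = Complex.exp (-Complex.log (cd L u)) := by
    rw [Complex.exp_neg, Complex.exp_log (cd_ne_zero _ _)]
  have e2 : (cd L w)⁻¹ = Complex.exp (-Complex.log (cd L w)) := by
    rw [Complex.exp_neg, Complex.exp_log (cd_ne_zero _ _)]
  rw [e1, e2]
  generalize (((L • u : ℍ) : ℂ) - (L • w : ℍ))⁻¹ = X
  generalize Complex.log (((L • u : ℍ) : ℂ) - (starRingEnd ℂ) ((L • w : ℍ) : ℂ)) = q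
  generalize (starRingEnd ℂ) (Complex.log (cd L w)) = c
  generalize Complex.log (cd L w) = lw
  generalize Complex.log (cd L u) = lu
  generalize ((w.im ^ ((m : ℝ) / 2 - 1) : ℝ) : ℂ) = Y
  have key : Complex.exp (lw * -(((4 - m : ℤ) : ℂ) / 2)) *
      Complex.exp (-(((m : ℝ) / 2 - 1 : ℝ) : ℂ) * (lw + c)) * Complex.exp (lu * -((m : ℂ) / 2)) *
      Complex.exp (q * ((1 - (m : ℝ) / 2 : ℝ) : ℂ)) =
      Complex.exp (-lu) * Complex.exp (-lw) *
        Complex.exp ((q + lu + c) * ((1 - (m : ℝ) / 2 : ℝ) : ℂ)) := by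
    simp only [← Complex.exp_add]
    congr 1
    push_cast
    ring
  linear_combination (slashMultiplier (4 - m) L * slashMultiplier m L * Y * X) * key +
    Y * X * (Complex.exp (-lu) * Complex.exp (-lw) *
        Complex.exp ((q + lu + c) * ((1 - (m : ℝ) / 2 : ℝ) : ℂ))) * h

/-- The analogue for the kernel of the ξ-image: weight κ in u and, after conjugation, weight κ in w.
-/
theorem cuspKernel_transform (m : ℤ) (L : SL(2, ℤ)) (u w : ℍ) :
    (starRingEnd ℂ) (autFactor m L w) * (autFactor m L u *
      (((L • u : ℍ) : ℂ) - (starRingEnd ℂ) ((L • w : ℍ) : ℂ)) ^ ((-((m : ℝ) / 2) : ℝ) : ℂ)) =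
    ((u : ℂ) - (starRingEnd ℂ) (w : ℂ)) ^ ((-((m : ℝ) / 2) : ℝ) : ℂ) := by
  rw [autFactor, autFactor, denomPow_eq, denomPow_eq,
    Complex.cpow_def_of_ne_zero (sub_conj_ne_zero _ _),
    Complex.cpow_def_of_ne_zero (sub_conj_ne_zero _ _),
    Complex.cpow_def_of_ne_zero (cd_ne_zero _ _), Complex.cpow_def_of_ne_zero (cd_ne_zero _ _),
    log_sub_conj L u w, map_mul, ← Complex.exp_conj, map_mul]
  have h := conj_slashMultiplier_mul m L
  have hm : (starRingEnd ℂ) (-((m : ℂ) / 2)) = -((m : ℂ) / 2) := by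
    rw [map_neg, map_div₀, map_intCast, map_ofNat]
  rw [hm]
  generalize Complex.log (((L • u : ℍ) : ℂ) - (starRingEnd ℂ) ((L • w : ℍ) : ℂ)) = q
  generalize (starRingEnd ℂ) (Complex.log (cd L w)) = c
  generalize Complex.log (cd L u) = lu
  have key : Complex.exp (c * -((m : ℂ) / 2)) * Complex.exp (lu * -((m : ℂ) / 2)) *
      Complex.exp (q * ((-((m : ℝ) / 2) : ℝ) : ℂ)) =
        Complex.exp ((q + lu + c) * ((-((m : ℝ) / 2) : ℝ) : ℂ)) := by
    simp only [← Complex.exp_add]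
    congr 1
    push_cast
    ring
  linear_combination ((starRingEnd ℂ) (slashMultiplier m L) * slashMultiplier m L) * key +
    Complex.exp ((q + lu + c) * ((-((m : ℝ) / 2) : ℝ) : ℂ)) * h

/-! ### Convergence and uniform majorants -/

theorem norm_autFactor_mul (m : ℤ) (L M : SL(2, ℤ)) (z : ℍ) :
    ‖autFactor m (L * M) z‖ = ‖autFactor m L (M • z)‖ * ‖autFactor m M z‖ := by
  rw [norm_autFactor, norm_autFactor, norm_autFactor, cd_mul, norm_mul,
    Real.mul_rpow (norm_nonneg _) (norm_nonneg _)]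

theorem eq_T_zpow_mul {M M' : SL(2, ℤ)} (h0 : M 1 0 = M' 1 0) (h1 : M 1 1 = M' 1 1) :
    ∃ n : ℤ, M' = ModularGroup.T ^ n * M := by
  have hd := M.det_coe
  rw [Matrix.det_fin_two] at hd
  have e0 : (M' * M⁻¹) 1 0 = 0 := by
    simp [Matrix.mul_apply, Matrix.SpecialLinearGroup.coe_inv, Matrix.adjugate_fin_two, ← h0, ← h1]
    ring
  have e1 : (M' * M⁻¹) 1 1 = 1 := by
    simp [Matrix.mul_apply, Matrix.SpecialLinearGroup.coe_inv, Matrix.adjugate_fin_two, ← h0, ← h1]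
    linarith
  obtain ⟨n, h | h⟩ := eq_T_zpow_or_neg e0
  · exact ⟨n, by rw [← h]; simp⟩
  · rw [h] at e1
    simp [ModularGroup.coe_T_zpow] at e1

/-- The bottom row of `M` and the integral part of `Re (M z) - X`. -/
noncomputable def rowFloor (X : ℝ) (z : ℍ) (M : SL(2, ℤ)) : (Fin 2 → ℤ) × ℤ :=
  (M 1, ⌊(M • z).re - X⌋)

/-- Matrices with the same bottom row differ by some Tⁿ on the left, which shifts Re(Mz) by n and is
therefore detected by the floor. -/
theorem rowFloor_injective (X : ℝ) (z : ℍ) : Function.Injective (rowFloor X z) := by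
  intro M M' h
  rw [rowFloor, rowFloor, Prod.mk.injEq] at h
  obtain ⟨n, rfl⟩ := eq_T_zpow_mul (congrFun h.1 0) (congrFun h.1 1)
  have h2 := h.2
  rw [mul_smul, modular_T_zpow_smul, vadd_re, add_sub_assoc, add_comm, Int.floor_add_intCast] at h2
  obtain rfl : n = 0 := by omega
  simp

theorem row_ne_zero (M : SL(2, ℤ)) : M 1 ≠ 0 := by
  intro h
  have := isCoprime_row M
  rw [congrFun h 0, congrFun h 1] at this
  exact not_isCoprime_zero_zero this

theorem norm_cd_rpow_le {k : ℝ} (hk : 0 ≤ k) (z : ℍ) (M : SL(2, ℤ)) :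
    ‖cd M z‖ ^ (-k) ≤ EisensteinSeries.r z ^ (-k) * ‖(M 1 : Fin 2 → ℤ)‖ ^ (-k) :=
  EisensteinSeries.summand_bound z hk (M 1)

/-- The bottom row is a nonzero integral vector, so |cz + d| is bounded below by a positive constant
depending on z alone. -/
theorem exists_im_smul_le (z : ℍ) : ∃ B : ℝ, 0 < B ∧ ∀ M : SL(2, ℤ), (M • z).im ≤ B := by
  refine ⟨z.im / EisensteinSeries.r z ^ 2, div_pos z.im_pos (pow_pos (EisensteinSeries.r_pos z) 2),
    fun M => ?_⟩
  rw [le_div_iff₀ (pow_pos (EisensteinSeries.r_pos z) 2), ← im_smul_mul M z]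
  gcongr
  · exact (EisensteinSeries.r_pos z).le
  · refine le_trans ?_ (EisensteinSeries.r_mul_max_le z (row_ne_zero M))
    refine le_mul_of_one_le_right (EisensteinSeries.r_pos z).le ?_
    have : 0 < ‖(M 1 : Fin 2 → ℤ)‖ := norm_pos_iff.mpr (row_ne_zero M)
    rw [EisensteinSeries.norm_eq_max_natAbs] at *
    exact_mod_cast this

/-- By injectivity of `rowFloor` the sum is dominated by a product of a sum over ℤ² and a sum over
ℤ. The explicit product bound is what later yields the decay rate towards the cusps. -/
theorem summable_of_rowFloor_le {k : ℝ} (hk : 2 < k) (X : ℝ) (z : ℍ) {b : ℤ → ℝ} (hb : Summable b)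
    (hb0 : ∀ n, 0 ≤ b n) :
    Summable (fun M : SL(2, ℤ) => ‖cd M z‖ ^ (-k) * b ⌊(M • z).re - X⌋) ∧
    ∑' M : SL(2, ℤ), ‖cd M z‖ ^ (-k) * b ⌊(M • z).re - X⌋ ≤
      (EisensteinSeries.r z ^ (-k) * ∑' x : Fin 2 → ℤ, ‖x‖ ^ (-k)) * ∑' n, b n := by
  have hs := (EisensteinSeries.summable_one_div_norm_rpow hk).mul_left (EisensteinSeries.r z ^ (-k))
  have hr : 0 ≤ EisensteinSeries.r z ^ (-k) := Real.rpow_nonneg (EisensteinSeries.r_pos z).le _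
  have hn : ∀ x : Fin 2 → ℤ, 0 ≤ EisensteinSeries.r z ^ (-k) * ‖x‖ ^ (-k) := fun x =>
    mul_nonneg hr (Real.rpow_nonneg (norm_nonneg _) _)
  have hp : Summable fun p : (Fin 2 → ℤ) × ℤ =>
      EisensteinSeries.r z ^ (-k) * ‖p.1‖ ^ (-k) * b p.2 :=
    hs.mul_of_nonneg hb hn hb0
  have hle : ∀ M : SL(2, ℤ), ‖cd M z‖ ^ (-k) * b ⌊(M • z).re - X⌋ ≤
      EisensteinSeries.r z ^ (-k) * ‖(rowFloor X z M).1‖ ^ (-k) * b (rowFloor X z M).2 := fun M =>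
    mul_le_mul_of_nonneg_right (norm_cd_rpow_le (by linarith) z M) (hb0 _)
  have hsum : Summable (fun M : SL(2, ℤ) => ‖cd M z‖ ^ (-k) * b ⌊(M • z).re - X⌋) :=
    Summable.of_nonneg_of_le
      (fun M => mul_nonneg (Real.rpow_nonneg (norm_nonneg _) _) (hb0 _)) hle
      (hp.comp_injective (rowFloor_injective X z))
  refine ⟨hsum, ?_⟩
  rw [← Summable.tsum_mul_left _ (EisensteinSeries.summable_one_div_norm_rpow hk),
    hs.tsum_mul_tsum hb hp]
  exact Summable.tsum_le_tsum_of_inj (rowFloor X z) (rowFloor_injective X z)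
    (fun p _ => mul_nonneg (hn _) (hb0 _)) hle hsum hp

theorem summable_abs_add_rpow {a ε : ℝ} (ha : 1 < a) (hε : 0 < ε) :
    Summable fun n : ℤ => (ε * (|(n : ℝ)| + 1)) ^ (-a) := by
  have h : Summable fun n : ℕ => ((n : ℝ) + 1) ^ (-a) := by
    have := (summable_nat_add_iff 1).mpr (Real.summable_nat_rpow.mpr (show -a < -1 by linarith))
    simpa using this
  have h2 : Summable fun n : ℤ => (|(n : ℝ)| + 1) ^ (-a) := by
    apply Summable.of_nat_of_neg
    · simpa using h
    · simpa using h
  refine (h2.mul_left (ε ^ (-a))).congr fun n => ?_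
  rw [Real.mul_rpow hε.le (by positivity)]

theorem summable_norm_cd_mul_norm_sub {k : ℝ} (hk : 2 < k) (z : ℍ) {s₀ : ℂ} (hs₀ : s₀.im < 0) :
    ∃ r > 0, ∃ b : SL(2, ℤ) → ℝ, Summable b ∧ ∀ s ∈ Metric.ball s₀ r, s.im < 0 ∧
      ∀ M : SL(2, ℤ), ‖cd M z‖ ^ (-k) * ‖((M • z : ℍ) : ℂ) - s‖ ^ (1 - k) ≤ b M := by
  set r := -s₀.im / 2 with hr
  have hr0 : 0 < r := by linarith
  -- The imaginary part bounds the distance below by r, the real part by |n| - 1 - r. The two bounds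
  -- coincide at |n| + 1 = 2(r + 1), where ε(|n| + 1) takes the same value r.
  set ε := r / (2 * (r + 1)) with hε
  have hε0 : 0 < ε := by positivity
  refine ⟨r, hr0, _, (summable_of_rowFloor_le hk s₀.re z (summable_abs_add_rpow
    (show 1 < k - 1 by linarith) hε0) fun n => by positivity).1, fun s hs => ?_⟩
  rw [Metric.mem_ball, dist_eq_norm] at hs
  have h1 := (Complex.abs_im_le_norm (s - s₀)).trans_lt hs
  have h2 := (Complex.abs_re_le_norm (s - s₀)).trans_lt hs
  rw [Complex.sub_im, abs_lt] at h1
  rw [Complex.sub_re, abs_lt] at h2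
  refine ⟨by linarith, fun M => ?_⟩
  refine mul_le_mul_of_nonneg_left ?_ (Real.rpow_nonneg (norm_nonneg _) _)
  rw [show -(k - 1) = 1 - k by ring]
  refine Real.rpow_le_rpow_of_nonpos (by positivity) ?_ (by linarith)
  set n := ⌊(M • z).re - s₀.re⌋ with hn
  have h3 := Int.floor_le ((M • z).re - s₀.re)
  have h4 := Int.lt_floor_add_one ((M • z).re - s₀.re)
  rw [← hn] at h3 h4
  have h5 : r ≤ ‖((M • z : ℍ) : ℂ) - s‖ := by
    refine le_trans ?_ (Complex.abs_im_le_norm _)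
    rw [Complex.sub_im, coe_im]
    have := (M • z).im_pos
    exact le_trans (by linarith) (le_abs_self _)
  have h6 : |(n : ℝ)| - 1 - r ≤ ‖((M • z : ℍ) : ℂ) - s‖ := by
    refine le_trans ?_ (Complex.abs_re_le_norm _)
    rw [Complex.sub_re, coe_re]
    rcases abs_cases (n : ℝ) with ⟨h, _⟩ | ⟨h, _⟩ <;>
      rcases abs_cases ((M • z).re - s.re) with ⟨h', _⟩ | ⟨h', _⟩ <;> rw [h, h'] <;> linarith
  have h7 : ε * (2 * (r + 1)) = r := by rw [hε]; field_simp
  rcases le_or_gt (|(n : ℝ)| + 1) (2 * (r + 1)) with h8 | h8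
  · refine le_trans ?_ h5
    nlinarith
  · refine le_trans ?_ h6
    have : ε < 1 := by nlinarith
    nlinarith

theorem hasSum_inv_mul_inv_add_one {Y : ℝ} (hY : 0 < Y) :
    HasSum (fun n : ℕ => ((n + Y) * (n + Y + 1))⁻¹) Y⁻¹ := by
  rw [hasSum_iff_tendsto_nat_of_nonneg (fun n => by positivity)]
  have h : ∀ n : ℕ, ∑ i ∈ Finset.range n, (((i : ℝ) + Y) * (i + Y + 1))⁻¹ = Y⁻¹ - (n + Y)⁻¹ := by
    intro n
    induction n with
    | zero => simp
    | succ n ih =>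
      rw [Finset.sum_range_succ, ih]
      push_cast
      have : (0 : ℝ) < n + Y := by positivity
      have : (0 : ℝ) < n + 1 + Y := by positivity
      field_simp
      ring
  simp_rw [h]
  have : Tendsto (fun n : ℕ => ((n : ℝ) + Y)⁻¹) atTop (𝓝 0) :=
    tendsto_inv_atTop_zero.comp (tendsto_atTop_add_const_right _ _ tendsto_natCast_atTop_atTop)
  simpa using tendsto_const_nhds.sub this

/-- Comparison with the telescoping series of 1/((|n|+Y)(|n|+Y+1)), whose sum over ℤ is 1/Y +
1/(Y+1) ≤ 2/Y, after extracting Y^(2-k). This gives the exact power of Y needed. -/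
theorem tsum_abs_add_rpow_le {k Y : ℝ} (hk : 2 < k) (hY : 1 ≤ Y) :
    Summable (fun n : ℤ => (|(n : ℝ)| + Y) ^ (-k)) ∧
      ∑' n : ℤ, (|(n : ℝ)| + Y) ^ (-k) ≤ 4 * Y ^ (1 - k) := by
  have hY0 : 0 < Y := by linarith
  have h1 : HasSum (fun n : ℤ => ((|(n : ℝ)| + Y) * (|(n : ℝ)| + Y + 1))⁻¹) (Y⁻¹ + (Y + 1)⁻¹) := by
    apply HasSum.of_nat_of_neg_add_one
    · simpa using hasSum_inv_mul_inv_add_one hY0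
    · convert hasSum_inv_mul_inv_add_one (show 0 < Y + 1 by linarith) using 2 with n
      push_cast
      rw [abs_of_nonpos (by linarith [(Nat.cast_nonneg n : (0 : ℝ) ≤ n)])]
      ring_nf
  have h2 := h1.mul_left (2 * Y ^ (2 - k))
  have hle : ∀ n : ℤ, (|(n : ℝ)| + Y) ^ (-k) ≤
      2 * Y ^ (2 - k) * ((|(n : ℝ)| + Y) * (|(n : ℝ)| + Y + 1))⁻¹ := by
    intro n
    have ha : 0 ≤ |(n : ℝ)| := abs_nonneg _
    generalize |(n : ℝ)| = a at ha
    have hp : 0 < a + Y := by linarith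
    have e1 : (a + Y) ^ (-k) = (a + Y) ^ (2 - k) * ((a + Y) ^ 2)⁻¹ := by
      rw [show -k = 2 - k + -2 by ring, Real.rpow_add hp, Real.rpow_neg hp.le]
      norm_cast
    have e2 : (a + Y) ^ (2 - k) ≤ Y ^ (2 - k) :=
      Real.rpow_le_rpow_of_nonpos hY0 (by linarith) (by linarith)
    have e3 : ((a + Y) ^ 2)⁻¹ ≤ 2 * ((a + Y) * (a + Y + 1))⁻¹ := by
      rw [inv_eq_one_div, ← div_eq_mul_inv, div_le_div_iff₀ (by positivity) (by positivity)]
      nlinarith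
    rw [e1]
    calc _ ≤ Y ^ (2 - k) * (2 * ((a + Y) * (a + Y + 1))⁻¹) :=
          mul_le_mul e2 e3 (by positivity) (by positivity)
      _ = _ := by ring
  have hs := Summable.of_nonneg_of_le (fun n => by positivity) hle h2.summable
  refine ⟨hs, (hs.tsum_le_tsum hle h2.summable).trans ?_⟩
  rw [h2.tsum_eq]
  have e1 : Y ^ (1 - k) = Y ^ (2 - k) * Y⁻¹ := by
    rw [show 1 - k = 2 - k + -1 by ring, Real.rpow_add hY0, Real.rpow_neg_one]
  have e2 : (Y + 1)⁻¹ ≤ Y⁻¹ := by gcongr; linarith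
  have e3 : 0 < Y ^ (2 - k) := by positivity
  rw [e1]
  nlinarith

theorem abs_floor_add_le {u w : ℂ} (hY : 4 ≤ |w.im|)
    (h : |w.im| ≤ 2 * |u.im - w.im|) :
    8⁻¹ * (|((⌊u.re - w.re⌋ : ℤ) : ℝ)| + |w.im|) ≤ ‖u - w‖ := by
  have h1 := Complex.abs_im_le_norm (u - w)
  have h2 := Complex.abs_re_le_norm (u - w)
  rw [Complex.sub_im] at h1
  rw [Complex.sub_re] at h2
  set n := ⌊u.re - w.re⌋ with hn
  have h3 := Int.floor_le (u.re - w.re)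
  have h4 := Int.lt_floor_add_one (u.re - w.re)
  rw [← hn] at h3 h4
  have h5 : |(n : ℝ)| - 1 ≤ |u.re - w.re| := by
    rcases abs_cases (n : ℝ) with ⟨h, _⟩ | ⟨h, _⟩ <;>
      rcases abs_cases (u.re - w.re) with ⟨h', _⟩ | ⟨h', _⟩ <;> rw [h, h'] <;> linarith
  have := abs_nonneg (n : ℝ)
  linarith

/-- Once Im w is at least twice the height of the orbit of z, both |Mz - w| and |Mz - w̄| are at
least a constant times |n| + Im w, with n the floor of Re(Mz) - Re w. One majorant thus serves the
Poincaré series and the cusp form. -/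
theorem exists_tsum_kernel_le {k : ℝ} (hk : 2 < k) (z : ℍ) : ∃ C y₀ : ℝ, ∀ w : ℍ, y₀ ≤ w.im →
    ∃ b : SL(2, ℤ) → ℝ, Summable b ∧ ∑' M, b M ≤ C * w.im ^ (1 - k) ∧ ∀ M : SL(2, ℤ),
      ‖cd M z‖ ^ (-k) * (‖((M • z : ℍ) : ℂ) - w‖⁻¹ *
        ‖((M • z : ℍ) : ℂ) - (starRingEnd ℂ) (w : ℂ)‖ ^ (1 - k)) ≤ b M ∧
      ‖cd M z‖ ^ (-k) * ‖((M • z : ℍ) : ℂ) - (starRingEnd ℂ) (w : ℂ)‖ ^ (-k) ≤ b M := by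
  obtain ⟨B, hB, hle⟩ := exists_im_smul_le z
  refine ⟨(EisensteinSeries.r z ^ (-k) * ∑' x : Fin 2 → ℤ, ‖x‖ ^ (-k)) * (8⁻¹ ^ (-k) * 4),
    max 4 (2 * B), fun w hw => ?_⟩
  have hw4 : 4 ≤ w.im := (le_max_left _ _).trans hw
  have hwB : 2 * B ≤ w.im := (le_max_right _ _).trans hw
  have hw0 := w.im_pos
  obtain ⟨hs, hts⟩ := tsum_abs_add_rpow_le hk (show 1 ≤ w.im by linarith)
  have hs' := hs.mul_left (8⁻¹ ^ (-k))
  obtain ⟨h1, h2⟩ := summable_of_rowFloor_le hk w.re z hs' (fun n => by positivity)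
  refine ⟨_, h1, h2.trans ?_, fun M => ?_⟩
  · have hA : 0 ≤ EisensteinSeries.r z ^ (-k) * ∑' x : Fin 2 → ℤ, ‖x‖ ^ (-k) := mul_nonneg
      (Real.rpow_nonneg (EisensteinSeries.r_pos z).le _)
      (tsum_nonneg fun x => Real.rpow_nonneg (norm_nonneg _) _)
    rw [tsum_mul_left]
    calc _ ≤ (EisensteinSeries.r z ^ (-k) * ∑' x : Fin 2 → ℤ, ‖x‖ ^ (-k)) *
          (8⁻¹ ^ (-k) * (4 * w.im ^ (1 - k))) := by gcongr
      _ = _ := by ring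
  · have h3 := hle M
    have h4 := (M • z).im_pos
    have a1 := abs_floor_add_le (u := ((M • z : ℍ) : ℂ)) (w := (w : ℂ))
      (by rw [coe_im, abs_of_pos hw0]; exact hw4)
      (by rw [coe_im, coe_im, abs_of_pos hw0, abs_of_neg (by linarith)]; linarith)
    have a2 := abs_floor_add_le (u := ((M • z : ℍ) : ℂ)) (w := (starRingEnd ℂ) (w : ℂ))
      (by rw [Complex.conj_im, coe_im, abs_neg, abs_of_pos hw0]; exact hw4)
      (by rw [Complex.conj_im, coe_im, coe_im, abs_neg, abs_of_pos hw0, abs_of_pos (by linarith)]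
          linarith)
    rw [Complex.conj_im, Complex.conj_re, abs_neg] at a2
    simp only [coe_im, coe_re, abs_of_pos hw0] at a1 a2
    set t := 8⁻¹ * (|((⌊(M • z).re - w.re⌋ : ℤ) : ℝ)| + w.im) with ht
    have ht0 : 0 < t := by positivity
    have e : (8⁻¹ : ℝ) ^ (-k) * (|((⌊(M • z).re - w.re⌋ : ℤ) : ℝ)| + w.im) ^ (-k) = t ^ (-k) := by
      rw [ht, Real.mul_rpow (by norm_num) (by positivity)]
    rw [e]
    constructor
    · refine mul_le_mul_of_nonneg_left ?_ (Real.rpow_nonneg (norm_nonneg _) _)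
      have e2 : t ^ (-k) = t⁻¹ * t ^ (1 - k) := by
        rw [← Real.rpow_neg_one, ← Real.rpow_add ht0]; ring_nf
      rw [e2]
      exact mul_le_mul (inv_anti₀ ht0 a1) (Real.rpow_le_rpow_of_nonpos ht0 a2 (by linarith))
        (Real.rpow_nonneg (norm_nonneg _) _) (by positivity)
    · refine mul_le_mul_of_nonneg_left ?_ (Real.rpow_nonneg (norm_nonneg _) _)
      exact Real.rpow_le_rpow_of_nonpos ht0 a2 (by linarith)

/-! ### Laplace transforms and the incomplete gamma function -/

open MeasureTheory

theorem integrableOn_rpow_mul_exp_neg {s b : ℝ} (hs : 0 < s) (hb : 0 < b) :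
    IntegrableOn (fun t : ℝ => t ^ (s - 1) * Real.exp (-(b * t))) (Set.Ioi 0) := by
  have h := integrableOn_rpow_mul_exp_neg_mul_rpow (p := 1) (s := s - 1) (b := b) (by linarith)
    one_pos hb
  simpa using h

theorem norm_rpow_mul_cexp (s : ℝ) (r : ℂ) {t : ℝ} (ht : 0 < t) :
    ‖((t ^ (s - 1) : ℝ) : ℂ) * Complex.exp (-(r * t))‖ = t ^ (s - 1) * Real.exp (-(r.re * t)) := by
  rw [norm_mul, Complex.norm_real, Real.norm_of_nonneg (by positivity), Complex.norm_exp]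
  simp

theorem aestronglyMeasurable_rpow_mul_cexp (s : ℝ) (r : ℂ) :
    AEStronglyMeasurable (fun t : ℝ => ((t ^ (s - 1) : ℝ) : ℂ) * Complex.exp (-(r * t)))
      (volume.restrict (Set.Ioi 0)) := by
  apply ContinuousOn.aestronglyMeasurable _ measurableSet_Ioi
  apply ContinuousOn.mul
  · apply Complex.continuous_ofReal.comp_continuousOn
    exact ContinuousOn.rpow_const continuousOn_id fun x hx => Or.inl (ne_of_gt hx)
  · fun_prop

theorem integrableOn_rpow_mul_cexp {s : ℝ} (hs : 0 < s) {r : ℂ} (hr : 0 < r.re) :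
    IntegrableOn (fun t : ℝ => ((t ^ (s - 1) : ℝ) : ℂ) * Complex.exp (-(r * t))) (Set.Ioi 0) := by
  refine (integrableOn_rpow_mul_exp_neg hs hr).mono' (aestronglyMeasurable_rpow_mul_cexp s r) ?_
  filter_upwards [ae_restrict_mem measurableSet_Ioi] with t ht
  exact (norm_rpow_mul_cexp s r ht).le

/-- The Laplace transform of `t ^ (s - 1)` at complex arguments. -/
theorem integral_rpow_mul_cexp {s : ℝ} (hs : 0 < s) {r : ℂ} (hr : 0 < r.re) :
    ∫ t : ℝ in Set.Ioi 0, ((t ^ (s - 1) : ℝ) : ℂ) * Complex.exp (-(r * t)) =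
      r ^ (-(s : ℂ)) * Real.Gamma s := by
  have hopen : IsOpen {r : ℂ | 0 < r.re} := isOpen_lt continuous_const Complex.continuous_re
  have hd1 : DifferentiableOn ℂ (fun r : ℂ => ∫ t : ℝ in Set.Ioi 0,
      ((t ^ (s - 1) : ℝ) : ℂ) * Complex.exp (-(r * t))) {r : ℂ | 0 < r.re} := by
    intro r₀ hr₀
    have hr₀' : 0 < r₀.re := hr₀
    have hε : 0 < r₀.re / 2 := by linarith
    refine DifferentiableAt.differentiableWithinAt (HasDerivAt.differentiableAt
      (hasDerivAt_integral_of_dominated_loc_of_deriv_le (Metric.ball_mem_nhds r₀ hε)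
        (F' := fun r t => -(((t ^ ((s + 1) - 1) : ℝ) : ℂ) * Complex.exp (-(r * t))))
        (bound := fun t => t ^ ((s + 1) - 1) * Real.exp (-(r₀.re / 2 * t))) ?_ ?_ ?_ ?_ ?_ ?_).2)
    · exact Eventually.of_forall fun r => aestronglyMeasurable_rpow_mul_cexp s r
    · exact integrableOn_rpow_mul_cexp hs hr₀
    · exact (aestronglyMeasurable_rpow_mul_cexp (s + 1) r₀).neg
    · filter_upwards [ae_restrict_mem measurableSet_Ioi] with t ht r hr
      have ht' : 0 < t := ht
      rw [norm_neg, norm_rpow_mul_cexp _ _ ht']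
      have h1 := (Complex.abs_re_le_norm (r - r₀)).trans_lt (by simpa [dist_eq_norm] using hr)
      rw [Complex.sub_re, abs_lt] at h1
      gcongr
      linarith
    · exact integrableOn_rpow_mul_exp_neg (by linarith) hε
    · filter_upwards [ae_restrict_mem measurableSet_Ioi] with t ht r hr
      have ht' : 0 < t := ht
      have h1 : HasDerivAt (fun r : ℂ => Complex.exp (-(r * t))) (Complex.exp (-(r * t)) * -(1 * t)) r :=
        (((hasDerivAt_id r).mul_const (t : ℂ)).neg).cexp
      refine (h1.const_mul (((t ^ (s - 1) : ℝ) : ℂ))).congr_deriv ?_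
      rw [show s + 1 - 1 = (s - 1) + 1 by ring, Real.rpow_add_one ht'.ne']
      push_cast
      ring
  have hd2 : DifferentiableOn ℂ (fun r : ℂ => r ^ (-(s : ℂ)) * Real.Gamma s) {r : ℂ | 0 < r.re} := by
    intro r hr
    apply DifferentiableAt.differentiableWithinAt
    apply DifferentiableAt.mul_const
    exact DifferentiableAt.cpow_const differentiableAt_id (Or.inl hr)
  have hconv : IsPreconnected {r : ℂ | 0 < r.re} :=
    (convex_halfSpace_re_gt 0).isPreconnected
  -- Identity theorem on the right half plane: both sides are holomorphic and agree for real r > 0,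
  -- in particular along a sequence tending to 1.
  refine AnalyticOnNhd.eqOn_of_preconnected_of_frequently_eq (hd1.analyticOnNhd hopen)
    (hd2.analyticOnNhd hopen) hconv (z₀ := 1) (by simp) ?_ hr
  have hreal : ∀ x : ℝ, 0 < x → ∫ t : ℝ in Set.Ioi 0,
      ((t ^ (s - 1) : ℝ) : ℂ) * Complex.exp (-((x : ℂ) * t)) =
        (x : ℂ) ^ (-(s : ℂ)) * Real.Gamma s := by
    intro x hx
    have := Real.integral_rpow_mul_exp_neg_mul_Ioi hs hx
    rw [one_div, Real.inv_rpow hx.le, ← Real.rpow_neg hx.le] at this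
    have h2 := congrArg (fun y : ℝ => (y : ℂ)) this
    rw [← integral_complex_ofReal] at h2
    push_cast [Complex.ofReal_cpow hx.le] at h2 ⊢
    exact h2
  have ht : Tendsto (fun n : ℕ => ((1 + 1 / ((n : ℝ) + 1) : ℝ) : ℂ)) atTop (𝓝[≠] 1) := by
    rw [tendsto_nhdsWithin_iff]
    constructor
    · have h1 : Tendsto (fun n : ℕ => 1 + 1 / ((n : ℝ) + 1)) atTop (𝓝 (1 + 0)) :=
        tendsto_const_nhds.add tendsto_one_div_add_atTop_nhds_zero_nat
      rw [add_zero] at h1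
      exact_mod_cast (Complex.continuous_ofReal.tendsto 1).comp h1
    · refine Eventually.of_forall fun n => ?_
      have : (0 : ℝ) < 1 / ((n : ℝ) + 1) := by positivity
      simp only [Set.mem_compl_iff, Set.mem_singleton_iff]
      intro h
      have h' : (1 + 1 / ((n : ℝ) + 1)) = 1 := by exact_mod_cast h
      linarith
  exact ht.frequently (Frequently.of_forall fun n => hreal _ (by positivity))

/-- The density `x ^ (s - 1) e ^ (-x)` extended by `0` to `x ≤ 0`. -/
noncomputable def gammaDensity (s x : ℝ) : ℝ := max 0 x ^ (s - 1) * Real.exp (-max 0 x)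

theorem continuous_gammaDensity {s : ℝ} (hs : 1 < s) : Continuous (gammaDensity s) := by
  unfold gammaDensity
  apply Continuous.mul
  · exact (continuous_const.max continuous_id).rpow_const fun x => Or.inr (by linarith)
  · fun_prop

theorem gammaDensity_of_nonpos {s x : ℝ} (hs : 1 < s) (hx : x ≤ 0) : gammaDensity s x = 0 := by
  rw [gammaDensity, max_eq_left hx, Real.zero_rpow (by linarith), zero_mul]

theorem gammaDensity_of_pos {s x : ℝ} (hx : 0 < x) :
    gammaDensity s x = x ^ (s - 1) * Real.exp (-x) := by
  rw [gammaDensity, max_eq_right hx.le]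

/-- The normalized upper incomplete gamma function `Γ(s, t) / Γ(s)`, extended by `1` to `t ≤ 0`. -/
noncomputable def gammaTail (s t : ℝ) : ℝ := 1 - (∫ x in (0 : ℝ)..t, gammaDensity s x) / Real.Gamma s

theorem hasDerivAt_gammaTail {s : ℝ} (hs : 1 < s) (t : ℝ) :
    HasDerivAt (gammaTail s) (-(gammaDensity s t / Real.Gamma s)) t := by
  have h := ((continuous_gammaDensity hs).integral_hasStrictDerivAt 0 t).hasDerivAt
  exact (h.div_const (Real.Gamma s)).const_sub 1

theorem gammaTail_of_nonpos {s t : ℝ} (hs : 1 < s) (ht : t ≤ 0) : gammaTail s t = 1 := by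
  have : ∫ x in (0 : ℝ)..t, gammaDensity s x = ∫ x in (0 : ℝ)..t, (0 : ℝ) := by
    apply intervalIntegral.integral_congr
    intro x hx
    rw [Set.uIcc_of_ge ht] at hx
    exact gammaDensity_of_nonpos hs hx.2
  rw [gammaTail, this]
  simp

theorem gammaTail_of_nonneg {s t : ℝ} (hs : 1 < s) (ht : 0 ≤ t) :
    gammaTail s t = incGamma s t / Real.Gamma s := by
  have hG := Real.Gamma_pos_of_pos (show 0 < s by linarith)
  have hint : IntegrableOn (gammaDensity s) (Set.Ioi 0) := by
    refine (integrableOn_rpow_mul_exp_neg (show 0 < s by linarith) one_pos).congr_fun (fun x hx => ?_)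
      measurableSet_Ioi
    simp [gammaDensity_of_pos (show 0 < x from hx)]
  have h0 : ∫ x in Set.Ioi 0, gammaDensity s x = Real.Gamma s := by
    rw [Real.Gamma_eq_integral (by linarith)]
    exact setIntegral_congr_fun measurableSet_Ioi fun x hx => by
      simp [gammaDensity_of_pos (show 0 < x from hx), mul_comm]
  have h1 : ∫ x in Set.Ioi t, gammaDensity s x = incGamma s t :=
    setIntegral_congr_fun measurableSet_Ioi fun x hx =>
      gammaDensity_of_pos (ht.trans_lt (show t < x from hx))
  rw [gammaTail, ← intervalIntegral.integral_Ioi_sub_Ioi hint ht, h0, h1]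
  field_simp
  ring

theorem incGamma_nonneg {s t : ℝ} (ht : 0 ≤ t) : 0 ≤ incGamma s t :=
  setIntegral_nonneg measurableSet_Ioi fun x hx => by
    have : 0 < x := ht.trans_lt hx
    positivity

/-- Write e^(-x) = e^(-3x/4) e^(-x/4) and bound the first factor by its value at t. A rate strictly
above 1/2 is what matters: the exponentials multiplying the tail grow with rate up to c/2, and the
surplus keeps the estimates uniform over the cosets. -/
theorem incGamma_le {s t : ℝ} (hs : 0 < s) (ht : 0 ≤ t) :
    incGamma s t ≤ Real.exp (-(3 * t / 4)) * (4 ^ s * Real.Gamma s) := by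
  have h1 : Set.Ioi t ⊆ Set.Ioi 0 := Set.Ioi_subset_Ioi ht
  have hi := integrableOn_rpow_mul_exp_neg hs (show (0 : ℝ) < 1 / 4 by norm_num)
  have h2 : incGamma s t ≤ ∫ x in Set.Ioi t, Real.exp (-(3 * t / 4)) *
      (x ^ (s - 1) * Real.exp (-(1 / 4 * x))) := by
    refine setIntegral_mono_on ?_ ((hi.mono_set h1).const_mul _) measurableSet_Ioi fun x hx => ?_
    · have := (integrableOn_rpow_mul_exp_neg hs one_pos).mono_set h1
      simpa using this
    · have hx' : t < x := hx
      have hx0 : 0 < x := ht.trans_lt hx'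
      rw [mul_left_comm, ← Real.exp_add]
      gcongr
      linarith
  refine h2.trans ?_
  rw [integral_const_mul]
  gcongr
  have h3 := Real.integral_rpow_mul_exp_neg_mul_Ioi hs (show (0 : ℝ) < 1 / 4 by norm_num)
  rw [one_div_one_div] at h3
  rw [← h3]
  exact setIntegral_mono_set hi
    ((ae_restrict_mem measurableSet_Ioi).mono fun x hx => by
      have : 0 < x := hx
      simp only [Pi.zero_apply]; positivity) (LE.le.eventuallyLE h1)

theorem gammaTail_nonneg {s : ℝ} (hs : 1 < s) (t : ℝ) : 0 ≤ gammaTail s t := by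
  rcases le_total t 0 with h | h
  · rw [gammaTail_of_nonpos hs h]; exact zero_le_one
  · rw [gammaTail_of_nonneg hs h]
    exact div_nonneg (incGamma_nonneg h) (Real.Gamma_pos_of_pos (by linarith)).le

theorem gammaTail_le {s t : ℝ} (hs : 1 < s) (ht : 0 ≤ t) :
    gammaTail s t ≤ 4 ^ s * Real.exp (-(3 * t / 4)) := by
  have hG := Real.Gamma_pos_of_pos (show 0 < s by linarith)
  rw [gammaTail_of_nonneg hs ht, div_le_iff₀ hG]
  calc _ ≤ _ := incGamma_le (by linarith) ht
    _ = _ := by ring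

/-! ### Poisson summation for the translates of the kernel -/

/-- The function on the real line to which Poisson summation is applied. -/
noncomputable def tailExp (s c : ℝ) (l : ℂ) (t : ℝ) : ℂ := gammaTail s (c * t) * Complex.exp (l * t)

theorem continuous_tailExp {s : ℝ} (hs : 1 < s) (c : ℝ) (l : ℂ) : Continuous (tailExp s c l) := by
  have h : Continuous (gammaTail s) :=
    continuous_iff_continuousAt.mpr fun t => (hasDerivAt_gammaTail hs t).continuousAt
  unfold tailExp
  fun_prop

theorem norm_tailExp {s : ℝ} (hs : 1 < s) (c : ℝ) (l : ℂ) (t : ℝ) :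
    ‖tailExp s c l t‖ = gammaTail s (c * t) * Real.exp (l.re * t) := by
  rw [tailExp, norm_mul, Complex.norm_real, Real.norm_of_nonneg (gammaTail_nonneg hs _),
    Complex.norm_exp]
  simp

theorem norm_tailExp_le {s c a : ℝ} (hs : 1 < s) (hc : 0 < c) {l : ℂ} (hl : a ≤ l.re)
    (hl' : l.re ≤ 3 * c / 4 - a) (t : ℝ) :
    ‖tailExp s c l t‖ ≤ 4 ^ s * Real.exp (-a * |t|) := by
  rw [norm_tailExp hs]
  rcases le_total t 0 with ht | ht
  · rw [gammaTail_of_nonpos hs (mul_nonpos_of_nonneg_of_nonpos hc.le ht), abs_of_nonpos ht]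
    have h1 : (1 : ℝ) ≤ 4 ^ s := Real.one_le_rpow (by norm_num) (by linarith)
    exact mul_le_mul h1 (Real.exp_le_exp.mpr (by nlinarith)) (Real.exp_pos _).le (by positivity)
  · rw [abs_of_nonneg ht]
    calc _ ≤ 4 ^ s * Real.exp (-(3 * (c * t) / 4)) * Real.exp (l.re * t) := by
          gcongr; exact gammaTail_le hs (by positivity)
      _ = 4 ^ s * Real.exp (-(3 * (c * t) / 4) + l.re * t) := by rw [mul_assoc, ← Real.exp_add]
      _ ≤ _ := by gcongr; nlinarith

theorem integrable_exp_neg_mul_abs {a : ℝ} (ha : 0 < a) :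
    Integrable fun t : ℝ => Real.exp (-a * |t|) := by
  rw [← integrableOn_univ, ← Set.Iic_union_Ioi (a := (0 : ℝ))]
  apply IntegrableOn.union
  · refine (integrableOn_exp_mul_Iic ha 0).congr_fun (fun x hx => ?_) measurableSet_Iic
    rw [abs_of_nonpos hx]; ring_nf
  · refine (integrableOn_exp_mul_Ioi (neg_lt_zero.mpr ha) 0).congr_fun (fun x hx => ?_)
      measurableSet_Ioi
    simp only
    rw [abs_of_pos hx]

theorem integrable_tailExp {s c : ℝ} (hs : 1 < s) (hc : 0 < c) {l : ℂ} (hl : 0 < l.re)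
    (hl' : l.re < c / 2) : Integrable (tailExp s c l) := by
  set a := min l.re (c / 2 - l.re) with ha
  have ha0 : 0 < a := lt_min hl (by linarith)
  refine ((integrable_exp_neg_mul_abs ha0).const_mul (4 ^ s)).mono'
    (continuous_tailExp hs c l).aestronglyMeasurable (Eventually.of_forall fun t => ?_)
  exact norm_tailExp_le hs hc (min_le_left _ _) (by linarith [min_le_right l.re (c / 2 - l.re)]) t

/-- Integration by parts: the derivative of `gammaTail` is minus the normalized gamma density,
supported on t > 0, so what remains is a Laplace transform. -/
theorem integral_tailExp {s c : ℝ} (hs : 1 < s) (hc : 0 < c) {l : ℂ} (hl : 0 < l.re)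
    (hl' : l.re < c / 2) :
    ∫ t, tailExp s c l t = (c ^ s : ℝ) * (c - l) ^ (-(s : ℂ)) / l := by
  have hl0 : l ≠ 0 := by rintro rfl; simp at hl
  have hG := Real.Gamma_pos_of_pos (show 0 < s by linarith)
  have hd1 : ∀ x : ℝ, HasDerivAt (fun t : ℝ => ((gammaTail s (c * t) : ℝ) : ℂ))
      ((-(gammaDensity s (c * x) / Real.Gamma s) * c : ℝ) : ℂ) x := fun x => by
    have h1 : HasDerivAt (fun t : ℝ => c * t) c x := by
      simpa using (hasDerivAt_id x).const_mul c
    exact ((hasDerivAt_gammaTail hs (c * x)).comp x h1).ofReal_comp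
  have hd2 : ∀ x : ℝ, HasDerivAt (fun t : ℝ => Complex.exp (l * t) / l) (Complex.exp (l * x)) x :=
    fun x => by
    have h1 : HasDerivAt (fun t : ℝ => l * (t : ℂ)) l x := by
      simpa using (hasDerivAt_id x).ofReal_comp.const_mul l
    have h2 := h1.cexp.div_const l
    rwa [mul_div_assoc, div_self hl0, mul_one] at h2
  have hI := integrable_tailExp hs hc hl hl'
  have hsupp : ∀ t : ℝ, t ∉ Set.Ioi (0 : ℝ) →
      ((-(gammaDensity s (c * t) / Real.Gamma s) * c : ℝ) : ℂ) * (Complex.exp (l * t) / l) = 0 := by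
    intro t ht
    rw [gammaDensity_of_nonpos hs (mul_nonpos_of_nonneg_of_nonpos hc.le (not_lt.mp ht))]
    simp
  have hform : ∀ t ∈ Set.Ioi (0 : ℝ),
      ((-(gammaDensity s (c * t) / Real.Gamma s) * c : ℝ) : ℂ) * (Complex.exp (l * t) / l) =
      (-((c ^ s : ℝ) / (Real.Gamma s * l))) *
        (((t ^ (s - 1) : ℝ) : ℂ) * Complex.exp (-((c - l) * t))) := by
    intro t ht
    have ht' : 0 < t := ht
    rw [gammaDensity_of_pos (by positivity), Real.mul_rpow hc.le ht'.le,
      show -(((c : ℂ) - l) * t) = -((c * t : ℝ) : ℂ) + l * t by push_cast; ring, Complex.exp_add,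
      Real.rpow_sub_one hc.ne' s]
    have hG' : ((Real.Gamma s : ℝ) : ℂ) ≠ 0 := by exact_mod_cast hG.ne'
    have hc' : (c : ℂ) ≠ 0 := by exact_mod_cast hc.ne'
    push_cast
    field_simp
  have hre : 0 < ((c : ℂ) - l).re := by simp; linarith
  have hint : IntegrableOn (fun t : ℝ => ((-(gammaDensity s (c * t) / Real.Gamma s) * c : ℝ) : ℂ) *
      (Complex.exp (l * t) / l)) (Set.Ioi 0) := by
    have h : IntegrableOn (fun t : ℝ => (-((c ^ s : ℝ) / (Real.Gamma s * l))) *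
        (((t ^ (s - 1) : ℝ) : ℂ) * Complex.exp (-((c - l) * t)))) (Set.Ioi 0) :=
      (integrableOn_rpow_mul_cexp (show 0 < s by linarith) hre).const_mul _
    exact h.congr_fun (fun t ht => (hform t ht).symm) measurableSet_Ioi
  have hparts := integral_mul_deriv_eq_deriv_mul_of_integrable (fun x _ => hd1 x) (fun x _ => hd2 x)
    hI ?_ ?_
  · have e0 : ∫ t, tailExp s c l t = ∫ t : ℝ, ((gammaTail s (c * t) : ℝ) : ℂ) * Complex.exp (l * t) :=
      rfl
    rw [e0, hparts, ← setIntegral_eq_integral_of_forall_compl_eq_zero hsupp,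
      setIntegral_congr_fun measurableSet_Ioi hform, integral_const_mul,
      integral_rpow_mul_cexp (by linarith) hre]
    have hG' : ((Real.Gamma s : ℝ) : ℂ) ≠ 0 := by exact_mod_cast hG.ne'
    field_simp
  · exact (integrableOn_iff_integrable_of_support_subset (fun t ht => by
      by_contra h; exact ht (hsupp t h))).mp hint
  · have := hI.div_const l
    refine this.congr (Eventually.of_forall fun t => ?_)
    simp only [tailExp, Pi.mul_apply]
    ring

open MeasureTheory

theorem isBigO_exp_neg_mul_abs {a : ℝ} (ha : 0 < a) (b : ℝ) :
    (fun t : ℝ => Real.exp (-a * |t|)) =O[cocompact ℝ] fun t => |t| ^ (-b) :=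
  ((isLittleO_exp_neg_mul_rpow_atTop ha (-b)).isBigO).comp_tendsto
    (tendsto_norm_cocompact_atTop (E := ℝ))

/-- A frequency x only shifts l by -2πix. The real part of l is unchanged, so the preceding integral
applies verbatim. -/
theorem fourier_tailExp {s c : ℝ} (hs : 1 < s) (hc : 0 < c) {l : ℂ} (hl : 0 < l.re)
    (hl' : l.re < c / 2) (x : ℝ) :
    FourierTransform.fourier (tailExp s c l) x =
      (c ^ s : ℝ) * (c - (l - 2 * Real.pi * Complex.I * x)) ^ (-(s : ℂ)) /
        (l - 2 * Real.pi * Complex.I * x) := by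
  have hre : (l - 2 * Real.pi * Complex.I * x).re = l.re := by simp
  rw [Real.fourier_real_eq_integral_exp_smul,
    ← integral_tailExp hs hc (l := l - 2 * Real.pi * Complex.I * x) (by rwa [hre]) (by rwa [hre])]
  congr 1
  ext t
  rw [tailExp, tailExp, smul_eq_mul, mul_left_comm, ← Complex.exp_add]
  congr 2
  push_cast
  ring

theorem isBigO_fourier_tailExp {s c : ℝ} (hs : 1 < s) (hc : 0 < c) {l : ℂ} (hl : 0 < l.re)
    (hl' : l.re < c / 2) :
    FourierTransform.fourier (tailExp s c l) =O[cocompact ℝ] fun t => |t| ^ (-(s + 1)) := by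
  refine IsBigO.of_bound (c ^ s) ?_
  have h := (tendsto_norm_cocompact_atTop (E := ℝ)).eventually_ge_atTop
    (max 1 (max ‖l‖ ‖(c : ℂ) - l‖))
  filter_upwards [h] with x hx
  simp only [max_le_iff, Real.norm_eq_abs] at hx
  obtain ⟨h1, h2, h3⟩ := hx
  have hx0 : 0 < |x| := by linarith
  have hn : ‖2 * Real.pi * Complex.I * (x : ℂ)‖ = 2 * Real.pi * |x| := by
    simp [abs_of_pos Real.pi_pos]
  have hpi := Real.pi_gt_three
  have e1 : |x| ≤ ‖l - 2 * Real.pi * Complex.I * x‖ := by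
    have := norm_sub_norm_le (2 * Real.pi * Complex.I * (x : ℂ)) l
    rw [hn, norm_sub_rev] at this
    nlinarith
  have e2 : |x| ≤ ‖(c : ℂ) - (l - 2 * Real.pi * Complex.I * x)‖ := by
    have := norm_sub_norm_le (2 * Real.pi * Complex.I * (x : ℂ)) (-(c - l))
    rw [hn, norm_neg, sub_neg_eq_add] at this
    rw [show (c : ℂ) - (l - 2 * Real.pi * Complex.I * x) =
      2 * Real.pi * Complex.I * x + (c - l) by ring]
    nlinarith
  rw [fourier_tailExp hs hc hl hl', norm_div, norm_mul, Complex.norm_real,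
    Real.norm_of_nonneg (by positivity), show (-(s : ℂ)) = ((-s : ℝ) : ℂ) by push_cast; ring,
    Complex.norm_cpow_real, Real.norm_of_nonneg (by positivity), mul_div_assoc,
    show -(s + 1) = -s + -1 by ring, Real.rpow_add hx0, Real.rpow_neg_one, div_eq_mul_inv]
  refine mul_le_mul_of_nonneg_left ?_ (by positivity)
  exact mul_le_mul (Real.rpow_le_rpow_of_nonpos hx0 e2 (by linarith)) (inv_anti₀ hx0 e1)
    (by positivity) (by positivity)

theorem tsum_tailExp {s c : ℝ} (hs : 1 < s) (hc : 0 < c) {l : ℂ} (hl : 0 < l.re)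
    (hl' : l.re < c / 2) :
    ∑' n : ℤ, tailExp s c l n = ∑' n : ℤ, (c ^ s : ℝ) *
      (c - (l + 2 * Real.pi * Complex.I * n)) ^ (-(s : ℂ)) / (l + 2 * Real.pi * Complex.I * n) := by
  set a := min l.re (c / 2 - l.re) with ha
  have ha0 : 0 < a := lt_min hl (by linarith)
  have hO : tailExp s c l =O[cocompact ℝ] fun t => |t| ^ (-(s + 1)) := by
    refine IsBigO.trans (IsBigO.of_bound (4 ^ s) (Eventually.of_forall fun t => ?_))
      (isBigO_exp_neg_mul_abs ha0 (s + 1))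
    rw [Real.norm_of_nonneg (Real.exp_pos _).le]
    exact norm_tailExp_le hs hc (min_le_left _ _) (by linarith [min_le_right l.re (c / 2 - l.re)]) t
  have h := Real.tsum_eq_tsum_fourier_of_rpow_decay (continuous_tailExp hs c l)
    (show 1 < s + 1 by linarith) hO (isBigO_fourier_tailExp hs hc hl hl') 0
  simp only [zero_add] at h
  rw [h, ← (Equiv.neg ℤ).tsum_eq]
  congr 1
  ext n
  rw [fourier_tailExp hs hc hl hl']
  simp [sub_eq_add_neg]

theorem log_neg_two_pi_I_mul {p : ℂ} (hp : 0 < p.im) :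
    Complex.log (-(2 * Real.pi * Complex.I * p)) =
      (Real.log (2 * Real.pi) : ℝ) - Real.pi / 2 * Complex.I + Complex.log p := by
  have hp0 : p ≠ 0 := by rintro rfl; simp at hp
  have h1 := arg_pos_of_im_pos hp
  have h2 := arg_lt_pi_of_im_pos hp
  have hpi := Real.pi_pos
  rw [show -(2 * Real.pi * Complex.I * p) = ((2 * Real.pi : ℝ) : ℂ) * (-Complex.I * p) by
      push_cast; ring,
    Complex.log_ofReal_mul (by positivity) (mul_ne_zero (by simp) hp0),
    (Complex.log_mul_eq_add_log_iff (by simp) hp0).mpr, Complex.log_neg_I]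
  · ring
  · rw [Complex.arg_neg_I]; constructor <;> linarith

/-- With l = 2πi(u - w) and c = 4π Im w one has l + 2πin = 2πi(u + n - w) and c - l - 2πin = -2πi(u
+ n - w̄). The powers of 2π cancel, and those of 2 and i collect in π/(2i)^(s-1). -/
theorem poisson_kernel_term {s : ℝ} (u w : ℍ) (n : ℤ) :
    ((w.im ^ s : ℝ) : ℂ) * (((u : ℂ) + n - w)⁻¹ *
      ((u : ℂ) + n - (starRingEnd ℂ) (w : ℂ)) ^ (-(s : ℂ))) =
    Real.pi / (2 * Complex.I) ^ ((s : ℂ) - 1) * (((4 * Real.pi * w.im) ^ s : ℝ) *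
      (((4 * Real.pi * w.im : ℝ) : ℂ) - (2 * Real.pi * Complex.I * ((u : ℂ) - w) +
        2 * Real.pi * Complex.I * n)) ^ (-(s : ℂ)) /
      (2 * Real.pi * Complex.I * ((u : ℂ) - w) + 2 * Real.pi * Complex.I * n)) := by
  have hpi : (Real.pi : ℂ) ≠ 0 := by exact_mod_cast Real.pi_ne_zero
  have hw := w.im_pos
  have hp : 0 < ((u : ℂ) + n - (starRingEnd ℂ) (w : ℂ)).im := by
    have := sub_conj_im_pos u w
    simpa using this
  have hp0 : (u : ℂ) + n - (starRingEnd ℂ) (w : ℂ) ≠ 0 := by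
    intro h; simp [h] at hp
  have hconj : (starRingEnd ℂ) (w : ℂ) = w - 2 * w.im * Complex.I := by
    apply Complex.ext <;> simp
    ring
  have e1 : ((4 * Real.pi * w.im : ℝ) : ℂ) - (2 * Real.pi * Complex.I * ((u : ℂ) - w) +
        2 * Real.pi * Complex.I * n) =
      -(2 * Real.pi * Complex.I * ((u : ℂ) + n - (starRingEnd ℂ) (w : ℂ))) := by
    rw [hconj]
    push_cast
    linear_combination (4 * Real.pi * w.im : ℂ) * Complex.I_sq
  have e2 : 2 * Real.pi * Complex.I * ((u : ℂ) - w) + 2 * Real.pi * Complex.I * n =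
      2 * Real.pi * Complex.I * ((u : ℂ) + n - w) := by ring
  have hne : -(2 * Real.pi * Complex.I * ((u : ℂ) + n - (starRingEnd ℂ) (w : ℂ))) ≠ 0 :=
    neg_ne_zero.mpr (mul_ne_zero (by simp) hp0)
  have hI : (2 * Complex.I : ℂ) ≠ 0 := by simp
  have hlog2I : Complex.log (2 * Complex.I) = (Real.log 2 : ℝ) + Real.pi / 2 * Complex.I := by
    rw [show (2 * Complex.I : ℂ) = ((2 : ℝ) : ℂ) * Complex.I by push_cast; ring,
      Complex.log_ofReal_mul (by norm_num) Complex.I_ne_zero, Complex.log_I]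
  have hW : ((w.im ^ s : ℝ) : ℂ) = Complex.exp (Real.log w.im * s) := by
    rw [Real.rpow_def_of_pos hw]; push_cast; rfl
  have h4 : (((4 * Real.pi * w.im) ^ s : ℝ) : ℂ) =
      Complex.exp ((Real.log (2 * Real.pi) + Real.log 2 + Real.log w.im) * s) := by
    rw [show 4 * Real.pi * w.im = (2 * Real.pi) * 2 * w.im by ring,
      Real.rpow_def_of_pos (by positivity), Real.log_mul (by positivity) hw.ne',
      Real.log_mul (by positivity) (by norm_num)]
    push_cast; rfl
  rw [e1, e2, Complex.cpow_def_of_ne_zero hne, log_neg_two_pi_I_mul hp,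
    Complex.cpow_def_of_ne_zero hp0, Complex.cpow_def_of_ne_zero hI, hlog2I, hW, h4, div_mul_eq_mul_div,
    div_eq_mul_inv _ (Complex.exp _), ← Complex.exp_neg]
  have h6 : Complex.exp (-(((Real.log 2 : ℝ) + Real.pi / 2 * Complex.I) * ((s : ℂ) - 1))) =
      Complex.exp (-(((Real.log 2 : ℝ) + Real.pi / 2 * Complex.I) * s)) * (2 * Complex.I) := by
    rw [← Complex.exp_log hI, hlog2I, ← Complex.exp_add]
    congr 1
    ring
  rw [h6]
  generalize (u : ℂ) + n - w = D
  generalize Complex.log ((u : ℂ) + n - (starRingEnd ℂ) (w : ℂ)) = q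
  have key : Complex.exp ((Real.log w.im : ℝ) * s) * Complex.exp (q * -s) =
      Complex.exp ((Real.log (2 * Real.pi) + Real.log 2 + Real.log w.im) * s) *
      Complex.exp ((Real.log (2 * Real.pi) - Real.pi / 2 * Complex.I + q) * -s) *
      Complex.exp (-(((Real.log 2 : ℝ) + Real.pi / 2 * Complex.I) * s)) := by
    simp only [← Complex.exp_add]
    congr 1
    ring
  have h7 : (Real.pi : ℂ) * (2 * Real.pi * Complex.I * D)⁻¹ * (2 * Complex.I) = D⁻¹ := by
    rw [mul_inv, mul_inv, mul_inv]
    have : Complex.I ≠ 0 := Complex.I_ne_zero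
    field_simp
  calc _ = Complex.exp ((Real.log w.im : ℝ) * s) * Complex.exp (q * -s) * D⁻¹ := by ring
    _ = _ := by
      rw [key, ← h7]
      ring

/-- The Fourier expansion of the summation over translates of the kernel. -/
theorem tsum_translate_kernel {s : ℝ} (hs : 1 < s) {u w : ℍ} (huw : u.im < w.im) :
    ((w.im ^ s : ℝ) : ℂ) * ∑' n : ℤ, (((u : ℂ) + n - w)⁻¹ *
      ((u : ℂ) + n - (starRingEnd ℂ) (w : ℂ)) ^ (-(s : ℂ))) =
    Real.pi / (2 * Complex.I) ^ ((s : ℂ) - 1) *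
      ∑' n : ℤ, tailExp s (4 * Real.pi * w.im) (2 * Real.pi * Complex.I * ((u : ℂ) - w)) n := by
  have hpi := Real.pi_pos
  have hu := u.im_pos
  have hw := w.im_pos
  have hre : (2 * Real.pi * Complex.I * ((u : ℂ) - w)).re = 2 * Real.pi * (w.im - u.im) := by
    simp
    ring
  rw [tsum_tailExp hs (by positivity) (by rw [hre]; nlinarith) (by rw [hre]; nlinarith),
    ← tsum_mul_left, ← tsum_mul_left]
  exact tsum_congr fun n => poisson_kernel_term u w n

/-! ### Joint analyticity in w and w̄ as independent variables -/

theorem analyticAt_clm_apply_snd_fst {V : Type*} [NormedAddCommGroup V] [NormedSpace ℂ V]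
    {Q : ℂ → V →L[ℂ] ℂ} {f : ℂ → V} {ζ₀ σ₀ : ℂ} (hQ : AnalyticAt ℂ Q σ₀) (hf : AnalyticAt ℂ f ζ₀) :
    AnalyticAt ℂ (fun p : ℂ × ℂ => Q p.2 (f p.1)) (ζ₀, σ₀) :=
  AnalyticAt.fun_comp (g := fun x : (V →L[ℂ] ℂ) × V => ContinuousLinearMap.id ℂ (V →L[ℂ] ℂ) x.1 x.2)
    (f := fun p : ℂ × ℂ => (Q p.2, f p.1))
    ((ContinuousLinearMap.id ℂ (V →L[ℂ] ℂ)).analyticAt_bilinear _)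
    ((AnalyticAt.fun_comp (g := Q) (f := Prod.snd) hQ analyticAt_snd).prod
      (AnalyticAt.fun_comp (g := f) (f := Prod.fst) hf analyticAt_fst))

/-- The variables are separated by a duality: Σ (ζ - ζ₀)ⁿ Rₙ is a holomorphic V-valued function of
ζ, Σ q_i(σ) ev_i is a holomorphic function of σ with values in the dual, and the series is their
pairing. Evaluation is bilinear and continuous, hence the result is jointly analytic. -/
theorem analyticAt_tsum_resolvent_mul_of_powers {ι V : Type*} [NormedAddCommGroup V]
    [NormedSpace ℂ V] [CompleteSpace V] {r : ι → ℂ} {B : ℝ} (hB : 0 < B) (hr : ∀ i, ‖r i‖ ≤ B)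
    {ev : ι → V →L[ℂ] ℂ} (hev : ∀ i, ‖ev i‖ ≤ 1) {R : ℕ → V} (hR : ∀ n, ‖R n‖ ≤ B ^ (n + 1))
    (hevR : ∀ i n, ev i (R n) = r i ^ (n + 1))
    {q : ι → ℂ → ℂ} {b : ι → ℝ} (hb : Summable b) {ζ₀ σ₀ : ℂ} {ρ : ℝ} (hρ : 0 < ρ)
    (hq : ∀ i, DifferentiableOn ℂ (q i) (Metric.ball σ₀ ρ))
    (hqb : ∀ i, ∀ σ ∈ Metric.ball σ₀ ρ, ‖q i σ‖ ≤ b i) :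
    AnalyticAt ℂ (fun p : ℂ × ℂ => ∑' i, q i p.2 * (r i * (1 - (p.1 - ζ₀) * r i)⁻¹)) (ζ₀, σ₀) := by
  set η := (2 * B)⁻¹ with hη
  have hη0 : 0 < η := by positivity
  have hηB : η * B = 2⁻¹ := by rw [hη]; field_simp
  have hgb : ∀ n : ℕ, ∀ ζ ∈ Metric.ball ζ₀ η, ‖(ζ - ζ₀) ^ n • R n‖ ≤ B * (2⁻¹) ^ n := by
    intro n ζ hζ
    rw [Metric.mem_ball, dist_eq_norm] at hζ
    rw [norm_smul, norm_pow]
    calc ‖ζ - ζ₀‖ ^ n * ‖R n‖ ≤ η ^ n * B ^ (n + 1) := by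
          gcongr
          exact hR n
      _ = B * (η * B) ^ n := by ring
      _ = _ := by rw [hηB]
  have hgs : Summable fun n : ℕ => B * (2⁻¹ : ℝ) ^ n :=
    (summable_geometric_of_lt_one (by norm_num) (by norm_num)).mul_left _
  have hf : DifferentiableOn ℂ (fun ζ => ∑' n : ℕ, (ζ - ζ₀) ^ n • R n) (Metric.ball ζ₀ η) :=
    Complex.differentiableOn_tsum_of_summable_norm hgs
      (fun n => (by fun_prop : Differentiable ℂ fun ζ : ℂ =>
        (ζ - ζ₀) ^ n • R n).differentiableOn) Metric.isOpen_ball hgb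
  have hQb : ∀ i, ∀ σ ∈ Metric.ball σ₀ ρ, ‖q i σ • ev i‖ ≤ b i := fun i σ hσ => by
    rw [norm_smul]
    exact (mul_le_of_le_one_right (norm_nonneg _) (hev i)).trans (hqb i σ hσ)
  have hQ : DifferentiableOn ℂ (fun σ => ∑' i, q i σ • ev i) (Metric.ball σ₀ ρ) :=
    Complex.differentiableOn_tsum_of_summable_norm (F := fun i σ => q i σ • ev i) hb
      (fun i => (hq i).smul_const (ev i)) Metric.isOpen_ball hQb
  refine (analyticAt_clm_apply_snd_fst (hQ.analyticAt (Metric.ball_mem_nhds _ hρ))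
    (hf.analyticAt (Metric.ball_mem_nhds _ hη0))).congr ?_
  have hmem : Metric.ball ζ₀ η ×ˢ Metric.ball σ₀ ρ ∈ 𝓝 (ζ₀, σ₀) :=
    prod_mem_nhds (Metric.ball_mem_nhds _ hη0) (Metric.ball_mem_nhds _ hρ)
  filter_upwards [hmem] with p hp
  have hs1 : Summable fun i => q i p.2 • ev i := Summable.of_norm_bounded hb fun i => hQb i _ hp.2
  have hs2 : Summable fun n : ℕ => (p.1 - ζ₀) ^ n • R n :=
    Summable.of_norm_bounded hgs fun n => hgb n _ hp.1
  set X := ∑' n : ℕ, (p.1 - ζ₀) ^ n • R n with hX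
  have hXi : ∀ i, ev i X = r i * (1 - (p.1 - ζ₀) * r i)⁻¹ := by
    intro i
    rw [hX, (ev i).map_tsum hs2]
    have h2 : ∀ n : ℕ, ev i ((p.1 - ζ₀) ^ n • R n) = r i * ((p.1 - ζ₀) * r i) ^ n := by
      intro n
      rw [map_smul, hevR, smul_eq_mul, mul_pow]
      ring
    simp_rw [h2]
    rw [tsum_mul_left, tsum_geometric_of_norm_lt_one]
    have h3 := hp.1
    rw [Metric.mem_ball, dist_eq_norm] at h3
    rw [norm_mul]
    calc ‖p.1 - ζ₀‖ * ‖r i‖ ≤ η * B := by gcongr; exact hr i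
      _ < 1 := by rw [hηB]; norm_num
  have h4 := (ContinuousLinearMap.apply ℂ ℂ X).map_tsum hs1
  simp only [ContinuousLinearMap.apply_apply, _root_.smul_apply, smul_eq_mul, hXi] at h4
  exact h4

open scoped BoundedContinuousFunction in
/-- A sum of products of resolvents in one variable and of a normally convergent family of
holomorphic functions in another one is jointly analytic. -/
theorem analyticAt_tsum_resolvent_mul {ι : Type*} {r : ι → ℂ} {B : ℝ} (hr : ∀ i, ‖r i‖ ≤ B)
    {q : ι → ℂ → ℂ} {b : ι → ℝ} (hb : Summable b) {ζ₀ σ₀ : ℂ} {ρ : ℝ} (hρ : 0 < ρ)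
    (hq : ∀ i, DifferentiableOn ℂ (q i) (Metric.ball σ₀ ρ))
    (hqb : ∀ i, ∀ σ ∈ Metric.ball σ₀ ρ, ‖q i σ‖ ≤ b i) :
    AnalyticAt ℂ (fun p : ℂ × ℂ => ∑' i, q i p.2 * (r i * (1 - (p.1 - ζ₀) * r i)⁻¹)) (ζ₀, σ₀) := by
  -- With the discrete topology the bounded continuous functions are all bounded functions on ι.
  -- This is the Banach space V, with Rₙ the powers of r.
  let : TopologicalSpace ι := ⊥
  have : DiscreteTopology ι := ⟨rfl⟩
  obtain ⟨B', hB', hr'⟩ : ∃ B' > 0, ∀ i, ‖r i‖ ≤ B' :=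
    ⟨max B 1, lt_max_of_lt_right one_pos, fun i => (hr i).trans (le_max_left _ _)⟩
  let R : ι →ᵇ ℂ := BoundedContinuousFunction.ofNormedAddCommGroupDiscrete r B' hr'
  have hR : ‖R‖ ≤ B' := BoundedContinuousFunction.norm_ofNormedAddCommGroup_le _ hB'.le hr'
  exact analyticAt_tsum_resolvent_mul_of_powers hB' hr'
    (ev := fun i => BoundedContinuousFunction.evalCLM ℂ i)
    (fun i => ContinuousLinearMap.opNorm_le_bound _ zero_le_one fun x => by
      rw [one_mul]; exact x.norm_coe_le_norm i)
    (R := fun n => R ^ (n + 1))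
    (fun n => (norm_pow_le' R (Nat.succ_pos n)).trans (by gcongr))
    (fun i n => rfl) hb hρ hq hqb

/-- The kernel series as a function of two independent variables in place of `w` and `conj w`. -/
noncomputable def kernelSeries {ι : Type*} (a u : ι → ℂ) (s : ℝ) (p : ℂ × ℂ) : ℂ :=
  ∑' i, a i * (u i - p.2) ^ (-(s : ℂ)) * (u i - p.1)⁻¹

/-- With r = (u - ζ₀)^(-1), bounded by 1/δ, the Cauchy factor (u - ζ)^(-1) is the resolvent r(1 - (ζ
- ζ₀)r)^(-1). -/
theorem analyticAt_kernelSeries {ι : Type*} {a u : ι → ℂ} {s : ℝ} {b : ι → ℝ} (hb : Summable b)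
    {ζ₀ σ₀ : ℂ} {ρ δ : ℝ} (hρ : 0 < ρ) (hδ : 0 < δ) (hu : ∀ i, 0 < (u i).im)
    (hδu : ∀ i, δ ≤ ‖u i - ζ₀‖)
    (hball : ∀ σ ∈ Metric.ball σ₀ ρ, σ.im < 0 ∧ ∀ i, ‖a i‖ * ‖u i - σ‖ ^ (-s) ≤ b i) :
    AnalyticAt ℂ (kernelSeries a u s) (ζ₀, σ₀) := by
  have h := analyticAt_tsum_resolvent_mul (r := fun i => (u i - ζ₀)⁻¹) (B := δ⁻¹)
    (q := fun i σ => a i * (u i - σ) ^ (-(s : ℂ))) (b := b) (ζ₀ := ζ₀) (σ₀ := σ₀) (ρ := ρ)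
    (fun i => by rw [norm_inv]; exact inv_anti₀ hδ (hδu i)) hb hρ ?_ ?_
  · refine h.congr ?_
    have hmem : Metric.ball ζ₀ δ ×ˢ Set.univ ∈ 𝓝 (ζ₀, σ₀) :=
      prod_mem_nhds (Metric.ball_mem_nhds _ hδ) univ_mem
    filter_upwards [hmem] with p hp
    refine tsum_congr fun i => ?_
    congr 1
    have h1 : u i - ζ₀ ≠ 0 := by
      intro h; have := hδu i; rw [h, norm_zero] at this; linarith
    rw [← mul_inv]
    congr 1
    field_simp
    ring
  · intro i σ hσ
    refine DifferentiableAt.differentiableWithinAt (DifferentiableAt.const_mul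
      (DifferentiableAt.cpow_const (by fun_prop) (Or.inr ?_)) _)
    have h1 := hu i
    have h2 := (hball σ hσ).1
    rw [Complex.sub_im]
    linarith
  · intro i σ hσ
    rw [norm_mul, show (-(s : ℂ)) = ((-s : ℝ) : ℂ) by push_cast; ring, Complex.norm_cpow_real]
    exact (hball σ hσ).2 i

theorem deriv_kernelSeries {ι : Type*} {a u : ι → ℂ} {s : ℝ} {b : ι → ℝ} (hb : Summable b)
    {ζ₀ σ₀ : ℂ} {ρ δ : ℝ} (hρ : 0 < ρ) (hδ : 0 < δ) (hu : ∀ i, 0 < (u i).im)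
    (hδu : ∀ i, δ ≤ ‖u i - ζ₀‖)
    (hball : ∀ σ ∈ Metric.ball σ₀ ρ, σ.im < 0 ∧ ∀ i, ‖a i‖ * ‖u i - σ‖ ^ (-s) ≤ b i) :
    HasSum (fun i => s * (a i * (u i - σ₀) ^ (-((s + 1 : ℝ) : ℂ)) * (u i - ζ₀)⁻¹))
      (deriv (fun σ => kernelSeries a u s (ζ₀, σ)) σ₀) := by
  have hne : ∀ i, ∀ σ ∈ Metric.ball σ₀ ρ, u i - σ ∈ Complex.slitPlane := fun i σ hσ => by
    refine Or.inr ?_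
    have h1 := hu i
    have h2 := (hball σ hσ).1
    rw [Complex.sub_im]
    linarith
  have hd : ∀ i, ∀ σ ∈ Metric.ball σ₀ ρ, HasDerivAt
      (fun σ => a i * (u i - σ) ^ (-(s : ℂ)) * (u i - ζ₀)⁻¹)
      (s * (a i * (u i - σ) ^ (-((s + 1 : ℝ) : ℂ)) * (u i - ζ₀)⁻¹)) σ := fun i σ hσ => by
    have h1 : HasDerivAt (fun σ => u i - σ) (-1) σ := by
      simpa using (hasDerivAt_id σ).const_sub (u i)
    refine (((h1.cpow_const (hne i σ hσ)).const_mul (a i)).mul_const _).congr_deriv ?_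
    rw [show -(s : ℂ) - 1 = -((s + 1 : ℝ) : ℂ) by push_cast; ring]
    ring
  have h := Complex.hasSum_deriv_of_summable_norm (U := Metric.ball σ₀ ρ) (z := σ₀)
    (F := fun i σ => a i * (u i - σ) ^ (-(s : ℂ)) * (u i - ζ₀)⁻¹) (u := fun i => b i * δ⁻¹)
    (hb.mul_right _) (fun i σ hσ => (hd i σ hσ).differentiableAt.differentiableWithinAt)
    Metric.isOpen_ball (fun i σ hσ => ?_) (Metric.mem_ball_self hρ)
  · have he : ∀ i, deriv (fun σ => a i * (u i - σ) ^ (-(s : ℂ)) * (u i - ζ₀)⁻¹) σ₀ = _ := fun i =>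
      (hd i σ₀ (Metric.mem_ball_self hρ)).deriv
    simp_rw [he] at h
    exact h
  · rw [norm_mul, norm_mul, norm_inv, show (-(s : ℂ)) = ((-s : ℝ) : ℂ) by push_cast; ring,
      Complex.norm_cpow_real]
    have hbi := (hball σ hσ).2 i
    exact mul_le_mul hbi (inv_anti₀ hδ (hδu i)) (by positivity) (le_trans (by positivity) hbi)

/-! ### Wirtinger derivatives -/

theorem hasFDerivAt_im_rpow (s : ℝ) {ζ : ℂ} (hζ : 0 < ζ.im) :
    HasFDerivAt (fun ζ : ℂ => ((ζ.im ^ s : ℝ) : ℂ))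
      (Complex.ofRealCLM.comp ((s * ζ.im ^ (s - 1)) • Complex.imCLM)) ζ := by
  have h1 : HasFDerivAt (fun ζ : ℂ => ζ.im) Complex.imCLM ζ := Complex.imCLM.hasFDerivAt
  exact Complex.ofRealCLM.hasFDerivAt.comp ζ (h1.rpow_const (Or.inl hζ.ne'))

theorem hasFDerivAt_comp_conj {A : ℂ × ℂ → ℂ} {ζ : ℂ}
    (hA : DifferentiableAt ℂ A (ζ, (starRingEnd ℂ) ζ)) :
    ∃ A' : ℂ →L[ℝ] ℂ, HasFDerivAt (fun ζ : ℂ => A (ζ, (starRingEnd ℂ) ζ)) A' ζ ∧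
      A' 1 + Complex.I * A' Complex.I = 2 * deriv (fun σ => A (ζ, σ)) ((starRingEnd ℂ) ζ) := by
  set L := fderiv ℂ A (ζ, (starRingEnd ℂ) ζ) with hL
  have h1 : HasFDerivAt A (L.restrictScalars ℝ) (ζ, (starRingEnd ℂ) ζ) :=
    hA.hasFDerivAt.restrictScalars ℝ
  have h2 : HasFDerivAt (fun ζ : ℂ => (ζ, (starRingEnd ℂ) ζ))
      ((ContinuousLinearMap.id ℝ ℂ).prod (Complex.conjCLE : ℂ →L[ℝ] ℂ)) ζ :=
    (hasFDerivAt_id ζ).prodMk Complex.conjCLE.hasFDerivAt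
  refine ⟨_, h1.comp ζ h2, ?_⟩
  have h3 : deriv (fun σ => A (ζ, σ)) ((starRingEnd ℂ) ζ) = L (0, 1) := by
    have h4 : HasDerivAt (fun σ : ℂ => (ζ, σ)) ((0 : ℂ), (1 : ℂ)) ((starRingEnd ℂ) ζ) :=
      (hasDerivAt_const _ ζ).prodMk (hasDerivAt_id _)
    exact (hA.hasFDerivAt.comp_hasDerivAt _ h4).deriv
  have h5 : ∀ v w : ℂ, L (v, w) = v * L (1, 0) + w * L (0, 1) := by
    intro v w
    rw [← smul_eq_mul, ← smul_eq_mul, ← map_smul, ← map_smul, ← map_add]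
    simp
  rw [h3]
  simp only [ContinuousLinearMap.comp_apply, ContinuousLinearMap.prod_apply,
    ContinuousLinearMap.coe_restrictScalars', ContinuousLinearMap.id_apply,
    ContinuousLinearEquiv.coe_coe, Complex.conjCLE_apply, map_one, Complex.conj_I]
  rw [h5 1 1, h5 Complex.I]
  linear_combination (L (1, 0) - L (0, 1)) * Complex.I_sq

/-- `2 ∂/∂w̄` of `Im(w)^s A(w, conj w)` for holomorphic `A`. -/
theorem dbar_im_rpow_mul {A : ℂ × ℂ → ℂ} {ζ : ℂ} (s : ℝ) (hζ : 0 < ζ.im)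
    (hA : DifferentiableAt ℂ A (ζ, (starRingEnd ℂ) ζ)) :
    dx (fun ζ : ℂ => ((ζ.im ^ s : ℝ) : ℂ) * A (ζ, (starRingEnd ℂ) ζ)) ζ +
      Complex.I * dy (fun ζ : ℂ => ((ζ.im ^ s : ℝ) : ℂ) * A (ζ, (starRingEnd ℂ) ζ)) ζ =
    Complex.I * s * ((ζ.im ^ (s - 1) : ℝ) : ℂ) * A (ζ, (starRingEnd ℂ) ζ) +
      2 * ((ζ.im ^ s : ℝ) : ℂ) * deriv (fun σ => A (ζ, σ)) ((starRingEnd ℂ) ζ) := by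
  obtain ⟨A', h1, h2⟩ := hasFDerivAt_comp_conj hA
  have h3 := (hasFDerivAt_im_rpow s hζ).fun_mul h1
  rw [dx, dy, h3.fderiv]
  simp
  linear_combination ((ζ.im ^ s : ℝ) : ℂ) * h2

theorem analyticAt_im_rpow (s : ℝ) {ζ : ℂ} (hζ : 0 < ζ.im) :
    AnalyticAt ℝ (fun ζ : ℂ => ((ζ.im ^ s : ℝ) : ℂ)) ζ := by
  have h1 : AnalyticAt ℝ (fun ζ : ℂ => ζ.im) ζ := Complex.imCLM.analyticAt ζ
  have h2 : AnalyticAt ℝ (fun ζ : ℂ => Real.exp (Real.log ζ.im * s)) ζ :=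
    AnalyticAt.fun_comp (g := fun t : ℝ => Real.exp (Real.log t * s))
      (((analyticAt_log hζ).fun_mul analyticAt_const).rexp') h1
  refine (AnalyticAt.fun_comp (Complex.ofRealCLM.analyticAt _) h2).congr ?_
  filter_upwards [(isOpen_lt continuous_const Complex.continuous_im).mem_nhds hζ] with w hw
  rw [Real.rpow_def_of_pos hw]
  rfl

theorem analyticAt_comp_conj {A : ℂ × ℂ → ℂ} {ζ : ℂ} (hA : AnalyticAt ℂ A (ζ, (starRingEnd ℂ) ζ)) :
    AnalyticAt ℝ (fun ζ : ℂ => A (ζ, (starRingEnd ℂ) ζ)) ζ := by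
  have h1 : AnalyticAt ℝ (fun ζ : ℂ => (starRingEnd ℂ) ζ) ζ :=
    (Complex.conjCLE : ℂ →L[ℝ] ℂ).analyticAt ζ
  exact AnalyticAt.fun_comp (g := A) hA.restrictScalars (analyticAt_id.prod h1)

/-- The action of `∂/∂w̄` on the kernel series. -/
theorem dbar_kernelSeries {ι : Type*} {a u : ι → ℂ} {s : ℝ} {b : ι → ℝ} (hb : Summable b)
    {ζ : ℂ} {ρ δ : ℝ} (hζ : 0 < ζ.im) (hρ : 0 < ρ) (hδ : 0 < δ) (hu : ∀ i, 0 < (u i).im)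
    (hδu : ∀ i, δ ≤ ‖u i - ζ‖)
    (hball : ∀ σ ∈ Metric.ball ((starRingEnd ℂ) ζ) ρ,
      σ.im < 0 ∧ ∀ i, ‖a i‖ * ‖u i - σ‖ ^ (-s) ≤ b i) :
    dx (fun ζ : ℂ => ((ζ.im ^ s : ℝ) : ℂ) * kernelSeries a u s (ζ, (starRingEnd ℂ) ζ)) ζ +
      Complex.I * dy (fun ζ : ℂ => ((ζ.im ^ s : ℝ) : ℂ) *
        kernelSeries a u s (ζ, (starRingEnd ℂ) ζ)) ζ =
    Complex.I * s * ((ζ.im ^ (s - 1) : ℝ) : ℂ) *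
      ∑' i, a i * (u i - (starRingEnd ℂ) ζ) ^ (-((s + 1 : ℝ) : ℂ)) := by
  have hA := analyticAt_kernelSeries hb hρ hδ hu hδu hball
  have hq := deriv_kernelSeries hb hρ hδ hu hδu hball
  rw [dbar_im_rpow_mul s hζ hA.differentiableAt, ← hq.tsum_eq, kernelSeries]
  have hs1 : Summable fun i => a i * (u i - (starRingEnd ℂ) ζ) ^ (-(s : ℂ)) * (u i - ζ)⁻¹ := by
    refine Summable.of_norm_bounded (hb.mul_right δ⁻¹) fun i => ?_
    rw [norm_mul, norm_mul, norm_inv, show (-(s : ℂ)) = ((-s : ℝ) : ℂ) by push_cast; ring,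
      Complex.norm_cpow_real]
    have hbi := (hball _ (Metric.mem_ball_self hρ)).2 i
    exact mul_le_mul hbi (inv_anti₀ hδ (hδu i)) (by positivity) (le_trans (by positivity) hbi)
  rw [← tsum_mul_left, ← tsum_mul_left, ← tsum_mul_left,
    ← (hs1.mul_left _).tsum_add (hq.summable.mul_left _)]
  refine tsum_congr fun i => ?_
  have h1 : u i - ζ ≠ 0 := by
    intro h; have := hδu i; rw [h, norm_zero] at this; linarith
  have h2 : u i - (starRingEnd ℂ) ζ ≠ 0 := by
    intro h
    have := congrArg Complex.im h
    simp at this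
    have := hu i
    linarith
  have e1 : (u i - (starRingEnd ℂ) ζ) ^ (-(s : ℂ)) =
      (u i - (starRingEnd ℂ) ζ) ^ (-((s + 1 : ℝ) : ℂ)) * (u i - (starRingEnd ℂ) ζ) := by
    rw [show -(s : ℂ) = -((s + 1 : ℝ) : ℂ) + 1 by push_cast; ring, Complex.cpow_add _ _ h2,
      Complex.cpow_one]
  have e2 : ((ζ.im ^ s : ℝ) : ℂ) = ((ζ.im ^ (s - 1) : ℝ) : ℂ) * ζ.im := by
    rw [← Complex.ofReal_mul, ← Real.rpow_add_one hζ.ne', sub_add_cancel]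
  -- The decisive cancellation: the two contributions combine to is y^(s-1) X ((u - ζ̄) - 2iy)/(u -
  -- ζ), with X the power of u - ζ̄, and the numerator (u - ζ̄) - 2iy is u - ζ.
  have e3 : (starRingEnd ℂ) ζ = ζ - 2 * ζ.im * Complex.I := by
    apply Complex.ext <;> simp
    ring
  rw [e1, e2]
  generalize (u i - (starRingEnd ℂ) ζ) ^ (-((s + 1 : ℝ) : ℂ)) = X
  rw [e3]
  field_simp
  linear_combination (s * ((ζ.im ^ (s - 1) : ℝ) : ℂ) * a i * X * 2 * (ζ.im : ℂ)) * Complex.I_sq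

/-! ### The weighted Poincaré series off the orbit of z -/

/-- The points `M z` for `M ∈ Γ₀(N)`. -/
noncomputable def orbitPoint (N : ℕ) (z : ℍ) (M : CongruenceSubgroup.Gamma0 N) : ℂ :=
  (((M : SL(2, ℤ)) • z : ℍ) : ℂ)

/-- The automorphy factors of `M ∈ Γ₀(N)` at `z`. -/
noncomputable def orbitCoeff (m : ℤ) (N : ℕ) (z : ℍ) (M : CongruenceSubgroup.Gamma0 N) : ℂ :=
  autFactor m M z

/-- The function `w ↦ Im(w) ^ (κ - 1) Ψ_{κ,-1,N}(z, w)`. -/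
noncomputable def weightedPsi (m : ℤ) (N : ℕ) (z w : ℍ) : ℂ :=
  ((w.im ^ ((m : ℝ) / 2 - 1) : ℝ) : ℂ) * Psi m (-1) N z w

theorem orbitPoint_im_pos (N : ℕ) (z : ℍ) (M : CongruenceSubgroup.Gamma0 N) :
    0 < (orbitPoint N z M).im := ((M : SL(2, ℤ)) • z).im_pos

theorem psiTerm_neg_one_eq (m : ℤ) (N : ℕ) (z w : ℍ) (M : CongruenceSubgroup.Gamma0 N) :
    psiTerm m (-1) N z w M = orbitCoeff m N z M *
      (orbitPoint N z M - (starRingEnd ℂ) (w : ℂ)) ^ (-(((m : ℝ) / 2 - 1 : ℝ) : ℂ)) *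
      (orbitPoint N z M - w)⁻¹ := by
  rw [psiTerm_eq, psiKernel_neg_one_eq, orbitCoeff, orbitPoint,
    show (((1 - (m : ℝ) / 2 : ℝ) : ℂ)) = -(((m : ℝ) / 2 - 1 : ℝ) : ℂ) by push_cast; ring]
  ring

theorem Psi_eq_kernelSeries (m : ℤ) (N : ℕ) (z w : ℍ) :
    Psi m (-1) N z w = kernelSeries (orbitCoeff m N z) (orbitPoint N z) ((m : ℝ) / 2 - 1)
      (w, (starRingEnd ℂ) (w : ℂ)) :=
  tsum_congr fun M => psiTerm_neg_one_eq m N z w M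

theorem exists_bound_orbit {m : ℤ} (hm : 4 < m) (N : ℕ) (z : ℍ) {σ₀ : ℂ} (hσ₀ : σ₀.im < 0) :
    ∃ ρ > 0, ∃ b : CongruenceSubgroup.Gamma0 N → ℝ, Summable b ∧ ∀ σ ∈ Metric.ball σ₀ ρ, σ.im < 0 ∧
      ∀ M, ‖orbitCoeff m N z M‖ * ‖orbitPoint N z M - σ‖ ^ (-((m : ℝ) / 2 - 1)) ≤ b M := by
  have hk : (2 : ℝ) < (m : ℝ) / 2 := by
    have : (4 : ℝ) < m := by exact_mod_cast hm
    linarith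
  obtain ⟨ρ, hρ, b, hb, h⟩ := summable_norm_cd_mul_norm_sub hk z hσ₀
  refine ⟨ρ, hρ, _, hb.comp_injective (Subtype.val_injective (p := (· ∈ CongruenceSubgroup.Gamma0 N))),
    fun σ hσ => ⟨(h σ hσ).1, fun M => ?_⟩⟩
  rw [orbitCoeff, norm_autFactor, neg_sub]
  exact (h σ hσ).2 M

/-- If Mz is close to w, then |cz + d| and |Mz - w̄| are bounded above, so the corresponding terms
of a convergent series stay away from 0. The exponent 3 is merely a convenient choice above 2. -/
theorem finite_smul_near (z w : ℍ) :
    {M : SL(2, ℤ) | ‖((M • z : ℍ) : ℂ) - w‖ < w.im / 2}.Finite := by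
  have hw := w.im_pos
  obtain ⟨ρ, hρ, b, hb, h⟩ := summable_norm_cd_mul_norm_sub (k := 3) (by norm_num) z
    (s₀ := (starRingEnd ℂ) (w : ℂ)) (by simpa using hw)
  have hb' := (h _ (Metric.mem_ball_self hρ)).2
  set c : ℝ := (2 * z.im / w.im) ^ (-(3 : ℝ) / 2) * (3 * w.im) ^ (-(2 : ℝ)) with hc
  have hz := z.im_pos
  have hc0 : 0 < c := by positivity
  have hfin : {M : SL(2, ℤ) | ¬ b M < c}.Finite :=
    hb.tendsto_cofinite_zero.eventually (gt_mem_nhds hc0)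
  refine hfin.subset fun M hM => not_lt.mpr (le_trans ?_ (hb' M))
  have hM' : ‖((M • z : ℍ) : ℂ) - w‖ < w.im / 2 := hM
  have h1 := (Complex.abs_im_le_norm (((M • z : ℍ) : ℂ) - w)).trans_lt hM'
  rw [Complex.sub_im, abs_lt, coe_im, coe_im] at h1
  have h2 : w.im / 2 ≤ (M • z).im := by linarith
  have hcd : 0 < ‖cd M z‖ := norm_pos_iff.mpr (cd_ne_zero M z)
  have h3 : ‖cd M z‖ ^ 2 ≤ 2 * z.im / w.im := by
    rw [le_div_iff₀ hw]
    have := im_smul_mul M z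
    nlinarith [sq_nonneg ‖cd M z‖]
  have h4 : (2 * z.im / w.im) ^ (-(3 : ℝ) / 2) ≤ ‖cd M z‖ ^ (-(3 : ℝ)) := by
    calc _ ≤ (‖cd M z‖ ^ 2) ^ (-(3 : ℝ) / 2) :=
          Real.rpow_le_rpow_of_nonpos (by positivity) h3 (by norm_num)
      _ = _ := by
        rw [← Real.rpow_natCast, ← Real.rpow_mul hcd.le]
        norm_num
  have h5 : ‖((M • z : ℍ) : ℂ) - (starRingEnd ℂ) (w : ℂ)‖ ≤ 3 * w.im := by
    have e : ((M • z : ℍ) : ℂ) - (starRingEnd ℂ) (w : ℂ) =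
        (((M • z : ℍ) : ℂ) - w) + ((2 * w.im : ℝ) : ℂ) * Complex.I := by
      apply Complex.ext <;> simp
      ring
    rw [e]
    refine (norm_add_le _ _).trans ?_
    rw [norm_mul, Complex.norm_I, Complex.norm_real, Real.norm_of_nonneg (by positivity)]
    linarith
  rw [hc]
  have h6 : 0 < ‖((M • z : ℍ) : ℂ) - (starRingEnd ℂ) (w : ℂ)‖ :=
    norm_pos_iff.mpr (sub_conj_ne_zero _ _)
  rw [show (1 : ℝ) - 3 = -2 by norm_num]
  exact mul_le_mul h4 (Real.rpow_le_rpow_of_nonpos h6 h5 (by norm_num)) (by positivity)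
    (by positivity)

theorem exists_le_norm_smul_sub (z w : ℍ) :
    ∃ δ > 0, ∀ M : SL(2, ℤ), ((M • z : ℍ) : ℂ) ≠ w → δ ≤ ‖((M • z : ℍ) : ℂ) - w‖ := by
  have hw := w.im_pos
  have h1 : ∀ᶠ δ : ℝ in 𝓝[>] 0, ∀ M ∈ {M : SL(2, ℤ) | ‖((M • z : ℍ) : ℂ) - w‖ < w.im / 2},
      ((M • z : ℍ) : ℂ) ≠ w → δ ≤ ‖((M • z : ℍ) : ℂ) - w‖ := by
    rw [Filter.eventually_all_finite (finite_smul_near z w)]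
    intro M _
    by_cases hM : ((M • z : ℍ) : ℂ) = w
    · exact Eventually.of_forall fun δ h => absurd hM h
    · have h2 : 0 < ‖((M • z : ℍ) : ℂ) - w‖ := norm_pos_iff.mpr (sub_ne_zero.mpr hM)
      filter_upwards [nhdsWithin_le_nhds (ge_mem_nhds h2)] with δ hδ _ using hδ
  obtain ⟨δ, ⟨h2, h3⟩, h4⟩ := (h1.and (nhdsWithin_le_nhds (ge_mem_nhds (half_pos hw)))
    |>.and self_mem_nhdsWithin).exists
  refine ⟨δ, h4, fun M hM => ?_⟩
  by_cases h5 : ‖((M • z : ℍ) : ℂ) - w‖ < w.im / 2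
  · exact h2 M h5 hM
  · exact h3.trans (not_lt.mp h5)

theorem conj_coe_im_neg (w : ℍ) : ((starRingEnd ℂ) (w : ℂ)).im < 0 := by
  simpa using w.im_pos

theorem summable_psiTerm {m : ℤ} (hm : 4 < m) (N : ℕ) (z w : ℍ) :
    Summable (psiTerm m (-1) N z w) := by
  obtain ⟨ρ, hρ, b, hb, h⟩ := exists_bound_orbit hm N z (conj_coe_im_neg w)
  obtain ⟨δ, hδ, hδ'⟩ := exists_le_norm_smul_sub z w
  refine Summable.of_norm_bounded (hb.mul_right δ⁻¹) fun M => ?_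
  have hbM := (h _ (Metric.mem_ball_self hρ)).2 M
  have hb0 : 0 ≤ b M := le_trans (by positivity) hbM
  rw [psiTerm_neg_one_eq]
  -- When Mz = w the summand is 0, by the convention that the inverse of 0 is 0.
  by_cases hM : orbitPoint N z M = w
  · rw [hM]
    simp
    positivity
  · rw [norm_mul, norm_mul, norm_inv, ← Complex.ofReal_neg, Complex.norm_cpow_real]
    exact mul_le_mul hbM (inv_anti₀ hδ (hδ' M hM)) (by positivity) hb0

theorem weightedPsi_ofComplex (m : ℤ) (N : ℕ) (z : ℍ) {ζ : ℂ} (hζ : 0 < ζ.im) :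
    weightedPsi m N z (ofComplex ζ) = ((ζ.im ^ ((m : ℝ) / 2 - 1) : ℝ) : ℂ) *
      kernelSeries (orbitCoeff m N z) (orbitPoint N z) ((m : ℝ) / 2 - 1) (ζ, (starRingEnd ℂ) ζ) := by
  rw [weightedPsi, Psi_eq_kernelSeries, ofComplex_apply_of_im_pos hζ]
  rfl

theorem eventually_im_pos {ζ : ℂ} (hζ : 0 < ζ.im) : ∀ᶠ ξ in 𝓝 ζ, 0 < ξ.im :=
  (isOpen_lt continuous_const Complex.continuous_im).mem_nhds hζ

theorem weightedPsi_eventuallyEq (m : ℤ) (N : ℕ) (z : ℍ) {ζ : ℂ} (hζ : 0 < ζ.im) :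
    (fun ξ : ℂ => weightedPsi m N z (ofComplex ξ)) =ᶠ[𝓝 ζ]
      fun ξ => ((ξ.im ^ ((m : ℝ) / 2 - 1) : ℝ) : ℂ) * kernelSeries (orbitCoeff m N z)
        (orbitPoint N z) ((m : ℝ) / 2 - 1) (ξ, (starRingEnd ℂ) ξ) := by
  filter_upwards [eventually_im_pos hζ] with ξ hξ using weightedPsi_ofComplex m N z hξ

/-- Points outside of the orbit of `z`. -/
def OffOrbit (z w : ℍ) : Prop := ∀ M : SL(2, ℤ), ((M • z : ℍ) : ℂ) ≠ w

theorem regularAt_weightedPsi {m : ℤ} (hm : 4 < m) (N : ℕ) {z w : ℍ} (hw : OffOrbit z w) :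
    RegularAt (weightedPsi m N z) w := by
  obtain ⟨ρ, hρ, b, hb, h⟩ := exists_bound_orbit hm N z (conj_coe_im_neg w)
  obtain ⟨δ, hδ, hδ'⟩ := exists_le_norm_smul_sub z w
  have h1 := analyticAt_kernelSeries hb hρ hδ (orbitPoint_im_pos N z) (fun M => hδ' M (hw M)) h
  exact ((analyticAt_im_rpow _ w.im_pos).fun_mul (analyticAt_comp_conj h1)).congr
    (weightedPsi_eventuallyEq m N z w.im_pos).symm

theorem eventually_offOrbit (z w : ℍ) : ∀ᶠ w' in 𝓝[≠] w, OffOrbit z w' := by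
  obtain ⟨δ, hδ, hδ'⟩ := exists_le_norm_smul_sub z w
  have h1 : ∀ᶠ w' : ℍ in 𝓝 w, ‖(w' : ℂ) - w‖ < δ := by
    have : Tendsto (fun w' : ℍ => ‖(w' : ℂ) - w‖) (𝓝 w) (𝓝 ‖(w : ℂ) - w‖) :=
      ((continuous_coe.sub continuous_const).norm).tendsto w
    rw [sub_self, norm_zero] at this
    exact this.eventually (gt_mem_nhds hδ)
  filter_upwards [nhdsWithin_le_nhds h1, self_mem_nhdsWithin] with w' h2 h3 M hM
  rw [← hM] at h2
  refine absurd (hδ' M fun h4 => h3 ?_) (not_le.mpr h2)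
  rw [Set.mem_singleton_iff]
  apply UpperHalfPlane.ext
  rw [← hM, h4]

/-- The series `∑ a_M (M z - σ) ^ (-κ)`. -/
noncomputable def cuspSeries (m : ℤ) (N : ℕ) (z : ℍ) (σ : ℂ) : ℂ :=
  ∑' M : CongruenceSubgroup.Gamma0 N,
    orbitCoeff m N z M * (orbitPoint N z M - σ) ^ (-((m : ℝ) / 2 - 1 + 1 : ℝ) : ℂ)

theorem norm_cuspSeries_term_le {m : ℤ} {N : ℕ} {z : ℍ} {σ : ℂ} {η B : ℝ} (hη : 0 < η)
    (hσ : σ.im ≤ -η) {M : CongruenceSubgroup.Gamma0 N}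
    (hB : ‖orbitCoeff m N z M‖ * ‖orbitPoint N z M - σ‖ ^ (-((m : ℝ) / 2 - 1)) ≤ B) :
    ‖orbitCoeff m N z M * (orbitPoint N z M - σ) ^ (-((m : ℝ) / 2 - 1 + 1 : ℝ) : ℂ)‖ ≤ B * η⁻¹ := by
  have h1 : η ≤ ‖orbitPoint N z M - σ‖ := by
    refine le_trans ?_ (Complex.abs_im_le_norm _)
    rw [Complex.sub_im]
    have := orbitPoint_im_pos N z M
    exact le_trans (by linarith) (le_abs_self _)
  have h2 : 0 < ‖orbitPoint N z M - σ‖ := hη.trans_le h1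
  rw [norm_mul, ← Complex.ofReal_neg, Complex.norm_cpow_real, neg_add, Real.rpow_add h2,
    Real.rpow_neg_one, ← mul_assoc]
  exact mul_le_mul hB (inv_anti₀ hη h1) (by positivity) (le_trans (by positivity) hB)

theorem differentiableAt_cuspSeries {m : ℤ} (hm : 4 < m) (N : ℕ) (z : ℍ) {σ₀ : ℂ} (hσ₀ : σ₀.im < 0) :
    DifferentiableAt ℂ (cuspSeries m N z) σ₀ := by
  obtain ⟨ρ, hρ, b, hb, h⟩ := exists_bound_orbit hm N z hσ₀
  have hη : 0 < -σ₀.im / 2 := by linarith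
  have hopen : IsOpen (Metric.ball σ₀ ρ ∩ {σ : ℂ | σ.im < -(-σ₀.im / 2)}) :=
    Metric.isOpen_ball.inter (isOpen_lt Complex.continuous_im continuous_const)
  refine (Complex.differentiableOn_tsum_of_summable_norm (hb.mul_right (-σ₀.im / 2)⁻¹)
    (fun M σ hσ => ?_) hopen (fun M σ hσ => ?_)).differentiableAt (hopen.mem_nhds ?_)
  · refine DifferentiableAt.differentiableWithinAt (DifferentiableAt.const_mul
      (DifferentiableAt.cpow_const (by fun_prop) (Or.inr ?_)) _)
    have h1 := orbitPoint_im_pos N z M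
    have h2 := (h σ hσ.1).1
    rw [Complex.sub_im]
    linarith
  · exact norm_cuspSeries_term_le hη (le_of_lt hσ.2) ((h σ hσ.1).2 M)
  · refine ⟨Metric.mem_ball_self hρ, ?_⟩
    change σ₀.im < -(-σ₀.im / 2)
    linarith

theorem dbar_weightedPsi {m : ℤ} (hm : 4 < m) (N : ℕ) {z w : ℍ} (hw : OffOrbit z w) :
    dx (fun ξ : ℂ => weightedPsi m N z (ofComplex ξ)) w +
      Complex.I * dy (fun ξ : ℂ => weightedPsi m N z (ofComplex ξ)) w =
    Complex.I * ((m : ℝ) / 2 - 1 : ℝ) * ((w.im ^ ((m : ℝ) / 2 - 1 - 1) : ℝ) : ℂ) *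
      cuspSeries m N z ((starRingEnd ℂ) w) := by
  obtain ⟨ρ, hρ, b, hb, h⟩ := exists_bound_orbit hm N z (conj_coe_im_neg w)
  obtain ⟨δ, hδ, hδ'⟩ := exists_le_norm_smul_sub z w
  have h1 := dbar_kernelSeries hb w.im_pos hρ hδ (orbitPoint_im_pos N z) (fun M => hδ' M (hw M)) h
  rw [dx, dy, (weightedPsi_eventuallyEq m N z w.im_pos).fderiv_eq]
  exact h1

/-! ### The Laplace equation and the image under ξ -/

theorem analyticAt_fderiv_apply {f : ℂ → ℂ} {ζ : ℂ} (hf : AnalyticAt ℝ f ζ) (v : ℂ) :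
    AnalyticAt ℝ (fun ξ => fderiv ℝ f ξ v) ζ :=
  AnalyticAt.fun_comp (g := ContinuousLinearMap.apply ℝ ℂ v) (f := fderiv ℝ f)
    ((ContinuousLinearMap.apply ℝ ℂ v).analyticAt _) hf.fderiv

theorem analyticAt_dx {f : ℂ → ℂ} {ζ : ℂ} (hf : AnalyticAt ℝ f ζ) : AnalyticAt ℝ (dx f) ζ :=
  analyticAt_fderiv_apply hf 1

theorem analyticAt_dy {f : ℂ → ℂ} {ζ : ℂ} (hf : AnalyticAt ℝ f ζ) : AnalyticAt ℝ (dy f) ζ :=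
  analyticAt_fderiv_apply hf Complex.I

theorem fderiv_fderiv_apply {f : ℂ → ℂ} {ζ : ℂ} (hf : AnalyticAt ℝ f ζ) (v w : ℂ) :
    fderiv ℝ (fun ξ => fderiv ℝ f ξ v) ζ w = fderiv ℝ (fderiv ℝ f) ζ w v := by
  have h := (ContinuousLinearMap.apply ℝ ℂ v).hasFDerivAt.comp ζ hf.fderiv.differentiableAt.hasFDerivAt
  have h2 : HasFDerivAt (fun ξ => fderiv ℝ f ξ v)
      ((ContinuousLinearMap.apply ℝ ℂ v).comp (fderiv ℝ (fderiv ℝ f) ζ)) ζ := h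
  rw [h2.fderiv]
  rfl

theorem dx_dy_comm {f : ℂ → ℂ} {ζ : ℂ} (hf : AnalyticAt ℝ f ζ) : dx (dy f) ζ = dy (dx f) ζ := by
  have hs : IsSymmSndFDerivAt ℝ f ζ := (hf.contDiffAt (n := 2)).isSymmSndFDerivAt (by simp)
  exact (fderiv_fderiv_apply hf Complex.I 1).trans
    ((hs 1 Complex.I).trans (fderiv_fderiv_apply hf 1 Complex.I).symm)

/-- `∂_x² + ∂_y² = (∂_x - i ∂_y) (∂_x + i ∂_y)`. -/
theorem dx_dx_add_dy_dy {f : ℂ → ℂ} {ζ : ℂ} (hf : AnalyticAt ℝ f ζ) :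
    dx (dx f) ζ + dy (dy f) ζ = dx (fun ξ => dx f ξ + Complex.I * dy f ξ) ζ -
      Complex.I * dy (fun ξ => dx f ξ + Complex.I * dy f ξ) ζ := by
  have h1 := (analyticAt_dx hf).differentiableAt.hasFDerivAt
  have h2 := (analyticAt_dy hf).differentiableAt.hasFDerivAt
  have h3 : HasFDerivAt (fun ξ => dx f ξ + Complex.I * dy f ξ)
      (fderiv ℝ (dx f) ζ + Complex.I • fderiv ℝ (dy f) ζ) ζ := h1.add (h2.const_mul Complex.I)
  have e1 : dx (fun ξ => dx f ξ + Complex.I * dy f ξ) ζ = dx (dx f) ζ + Complex.I * dx (dy f) ζ := by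
    rw [dx, h3.fderiv]; rfl
  have e2 : dy (fun ξ => dx f ξ + Complex.I * dy f ξ) ζ = dy (dx f) ζ + Complex.I * dy (dy f) ζ := by
    rw [dy, h3.fderiv]; rfl
  rw [e1, e2, dx_dy_comm hf]
  linear_combination (dy (dy f) ζ) * Complex.I_sq

/-- `2 ∂/∂w` of `Im(w)^t G(conj w)` for holomorphic `G`. -/
theorem del_im_rpow_mul_conj {G : ℂ → ℂ} {ζ : ℂ} (t : ℝ) (hζ : 0 < ζ.im) (c : ℂ)
    (hG : DifferentiableAt ℂ G ((starRingEnd ℂ) ζ)) :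
    dx (fun ξ : ℂ => c * ((ξ.im ^ t : ℝ) : ℂ) * G ((starRingEnd ℂ) ξ)) ζ -
      Complex.I * dy (fun ξ : ℂ => c * ((ξ.im ^ t : ℝ) : ℂ) * G ((starRingEnd ℂ) ξ)) ζ =
    -Complex.I * c * t * ((ζ.im ^ (t - 1) : ℝ) : ℂ) * G ((starRingEnd ℂ) ζ) := by
  have h1 : HasFDerivAt G ((fderiv ℂ G ((starRingEnd ℂ) ζ)).restrictScalars ℝ) ((starRingEnd ℂ) ζ) :=
    hG.hasFDerivAt.restrictScalars ℝ
  have h2 : HasFDerivAt (fun ξ : ℂ => (starRingEnd ℂ) ξ) (Complex.conjCLE : ℂ →L[ℝ] ℂ) ζ :=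
    Complex.conjCLE.hasFDerivAt
  have h3 := ((hasFDerivAt_im_rpow t hζ).const_mul c).fun_mul (h1.comp ζ h2)
  have h4 : HasFDerivAt (fun ξ : ℂ => c * ((ξ.im ^ t : ℝ) : ℂ) * G ((starRingEnd ℂ) ξ)) _ ζ := h3
  have h5 : fderiv ℂ G ((starRingEnd ℂ) ζ) (-Complex.I) =
      -Complex.I * fderiv ℂ G ((starRingEnd ℂ) ζ) 1 := by
    rw [← smul_eq_mul, ← map_smul, smul_eq_mul, mul_one]
  rw [dx, dy, h4.fderiv]
  simp only [_root_.add_apply, _root_.smul_apply, ContinuousLinearMap.comp_apply,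
    ContinuousLinearMap.coe_restrictScalars', ContinuousLinearEquiv.coe_coe, Complex.conjCLE_apply,
    map_one, Complex.conj_I, smul_eq_mul, Complex.imCLM_apply, Complex.ofRealCLM_apply,
    Complex.one_im, Complex.I_im, Function.comp_apply, h5]
  push_cast
  linear_combination (c * ((ζ.im ^ t : ℝ) : ℂ) * fderiv ℂ G ((starRingEnd ℂ) ζ) 1) * Complex.I_sq

/-- After factoring the Euclidean Laplacian as (∂_x - i∂_y)(∂_x + i∂_y), the outer operator sees
G(w̄) as a constant and only differentiates y^(s-1). The factor s - 1 so obtained matches the weight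
1 - s of the first order term. -/
theorem laplacian_expr_eq_zero {f G : ℂ → ℂ} {ζ : ℂ} {s : ℝ} (hf : AnalyticAt ℝ f ζ) (hζ : 0 < ζ.im)
    (hG : DifferentiableAt ℂ G ((starRingEnd ℂ) ζ))
    (h : ∀ᶠ ξ in 𝓝 ζ, dx f ξ + Complex.I * dy f ξ =
      Complex.I * s * ((ξ.im ^ (s - 1) : ℝ) : ℂ) * G ((starRingEnd ℂ) ξ)) :
    -((ζ.im : ℂ) ^ 2) * (dx (dx f) ζ + dy (dy f) ζ)
      + Complex.I * (1 - s) * (ζ.im : ℂ) * (dx f ζ + Complex.I * dy f ζ) = 0 := by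
  rw [dx_dx_add_dy_dy hf, dx, dy, EventuallyEq.fderiv_eq h, h.self_of_nhds]
  have h1 := del_im_rpow_mul_conj (s - 1) hζ (Complex.I * s) hG
  rw [dx, dy] at h1
  rw [h1]
  have e2 : ((ζ.im ^ (s - 1) : ℝ) : ℂ) = ((ζ.im ^ (s - 1 - 1) : ℝ) : ℂ) * ζ.im := by
    rw [← Complex.ofReal_mul, ← Real.rpow_add_one hζ.ne', sub_add_cancel]
  rw [e2]
  push_cast
  ring

theorem eventually_nhdsNE_coe {w : ℍ} {P : ℍ → Prop} (h : ∀ᶠ w' in 𝓝[≠] w, P w') :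
    ∀ᶠ ξ in 𝓝[≠] (w : ℂ), 0 < ξ.im ∧ P (ofComplex ξ) := by
  have h1 : Tendsto (fun ξ : ℂ => (ofComplex ξ : ℍ)) (𝓝[≠] (w : ℂ)) (𝓝[≠] w) := by
    rw [tendsto_nhdsWithin_iff]
    constructor
    · have := (UpperHalfPlane.contMDiffAt_ofComplex (n := 0) w.im_pos).continuousAt
      have h2 : Tendsto (fun ξ : ℂ => (ofComplex ξ : ℍ)) (𝓝 (w : ℂ)) (𝓝 (ofComplex (w : ℂ))) := this
      rw [ofComplex_apply] at h2
      exact h2.mono_left nhdsWithin_le_nhds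
    · filter_upwards [nhdsWithin_le_nhds (eventually_im_pos w.im_pos), self_mem_nhdsWithin]
        with ξ h2 h3 h4
      apply h3
      rw [Set.mem_singleton_iff] at h4 ⊢
      rw [← h4, ofComplex_apply_of_im_pos h2]
  filter_upwards [h1.eventually h, nhdsWithin_le_nhds (eventually_im_pos w.im_pos)] with ξ h2 h3
  exact ⟨h3, h2⟩

theorem eventually_offOrbit_coe (z w : ℍ) :
    ∀ᶠ ξ in 𝓝[≠] (w : ℂ), 0 < ξ.im ∧ OffOrbit z (ofComplex ξ) :=
  eventually_nhdsNE_coe (eventually_offOrbit z w)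

theorem eq_of_eventuallyEq_nhdsNE {f g : ℂ → ℂ} {ζ : ℂ} (hf : ContinuousAt f ζ)
    (hg : ContinuousAt g ζ) (h : ∀ᶠ ξ in 𝓝[≠] ζ, f ξ = g ξ) : f ζ = g ζ :=
  tendsto_nhds_unique ((hf.tendsto.mono_left nhdsWithin_le_nhds).congr' h)
    (hg.tendsto.mono_left nhdsWithin_le_nhds)

theorem dbar_weightedPsi_of_offOrbit {m : ℤ} (hm : 4 < m) (N : ℕ) {z : ℍ} {ξ : ℂ} (hξ : 0 < ξ.im)
    (h : OffOrbit z (ofComplex ξ)) :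
    dx (fun ξ : ℂ => weightedPsi m N z (ofComplex ξ)) ξ +
      Complex.I * dy (fun ξ : ℂ => weightedPsi m N z (ofComplex ξ)) ξ =
    Complex.I * ((m : ℝ) / 2 - 1 : ℝ) * ((ξ.im ^ ((m : ℝ) / 2 - 1 - 1) : ℝ) : ℂ) *
      cuspSeries m N z ((starRingEnd ℂ) ξ) := by
  have h1 := dbar_weightedPsi hm N h
  rw [ofComplex_apply_of_im_pos hξ] at h1
  exact h1

/-- A point of the SL₂(ℤ)-orbit of z may still be regular, for instance if it is not in the
Γ₀(N)-orbit. The formula extends to such points by continuity from punctured neighbourhoods, which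
avoid the orbit. -/
theorem dbar_weightedPsi_of_regularAt {m : ℤ} (hm : 4 < m) (N : ℕ) {z w : ℍ}
    (h : RegularAt (weightedPsi m N z) w) :
    dx (fun ξ : ℂ => weightedPsi m N z (ofComplex ξ)) w +
      Complex.I * dy (fun ξ : ℂ => weightedPsi m N z (ofComplex ξ)) w =
    Complex.I * ((m : ℝ) / 2 - 1 : ℝ) * ((w.im ^ ((m : ℝ) / 2 - 1 - 1) : ℝ) : ℂ) *
      cuspSeries m N z ((starRingEnd ℂ) w) := by
  have hG : ContinuousAt (fun ξ : ℂ => cuspSeries m N z ((starRingEnd ℂ) ξ)) w :=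
    ContinuousAt.comp (g := cuspSeries m N z)
      (differentiableAt_cuspSeries hm N z (conj_coe_im_neg w)).continuousAt
      Complex.continuous_conj.continuousAt
  have hi : ContinuousAt (fun ξ : ℂ => ((ξ.im ^ ((m : ℝ) / 2 - 1 - 1) : ℝ) : ℂ)) w :=
    (hasFDerivAt_im_rpow _ w.im_pos).continuousAt
  have h1 := (analyticAt_dx h).continuousAt
  have h2 := (analyticAt_dy h).continuousAt
  refine eq_of_eventuallyEq_nhdsNE (f := fun ξ => dx (fun ξ : ℂ => weightedPsi m N z (ofComplex ξ)) ξ +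
    Complex.I * dy (fun ξ : ℂ => weightedPsi m N z (ofComplex ξ)) ξ) (g := fun ξ =>
    Complex.I * ((m : ℝ) / 2 - 1 : ℝ) * ((ξ.im ^ ((m : ℝ) / 2 - 1 - 1) : ℝ) : ℂ) *
      cuspSeries m N z ((starRingEnd ℂ) ξ)) (by fun_prop) (by fun_prop) ?_
  filter_upwards [eventually_offOrbit_coe z w] with ξ hξ
  exact dbar_weightedPsi_of_offOrbit hm N hξ.1 hξ.2

theorem laplacian_weightedPsi {m : ℤ} (hm : 4 < m) (N : ℕ) {z w : ℍ}
    (h : RegularAt (weightedPsi m N z) w) : laplacian (4 - m) (weightedPsi m N z) w = 0 := by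
  have hc : Complex.I * (((4 - m : ℤ) : ℂ) / 2) = Complex.I * (1 - ((m : ℝ) / 2 - 1 : ℝ)) := by
    push_cast; ring
  have key : laplacian (4 - m) (weightedPsi m N z) w =
    -(((w : ℂ).im : ℂ) ^ 2) * (dx (dx fun ξ : ℂ => weightedPsi m N z (ofComplex ξ)) w +
        dy (dy fun ξ : ℂ => weightedPsi m N z (ofComplex ξ)) w)
      + Complex.I * (1 - ((m : ℝ) / 2 - 1 : ℝ)) * ((w : ℂ).im : ℂ) *
        (dx (fun ξ : ℂ => weightedPsi m N z (ofComplex ξ)) w +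
          Complex.I * dy (fun ξ : ℂ => weightedPsi m N z (ofComplex ξ)) w) := by
    rw [laplacian, hc]
    rfl
  rw [key]
  have hreg : ∀ᶠ ξ in 𝓝 (w : ℂ), AnalyticAt ℝ (fun ξ : ℂ => weightedPsi m N z (ofComplex ξ)) ξ :=
    h.eventually_analyticAt
  refine laplacian_expr_eq_zero h w.im_pos
    (differentiableAt_cuspSeries hm N z (conj_coe_im_neg w)) ?_
  filter_upwards [hreg, eventually_im_pos w.im_pos] with ξ h1 h2
  have h3 := dbar_weightedPsi_of_regularAt hm N (z := z) (w := ⟨ξ, h2⟩) h1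
  exact h3

theorem xi_weightedPsi {m : ℤ} (hm : 4 < m) (N : ℕ) {z w : ℍ}
    (h : RegularAt (weightedPsi m N z) w) : xi (4 - m) (weightedPsi m N z) w =
      ((m : ℝ) / 2 - 1 : ℝ) * (starRingEnd ℂ) (cuspSeries m N z ((starRingEnd ℂ) w)) := by
  have h1 := dbar_weightedPsi_of_regularAt hm N h
  rw [xi, h1]
  have h2 : w.im ^ (((4 - m : ℤ) : ℝ) / 2) * w.im ^ ((m : ℝ) / 2 - 1 - 1) = 1 := by
    rw [← Real.rpow_add w.im_pos]
    push_cast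
    rw [show (4 - (m : ℝ)) / 2 + ((m : ℝ) / 2 - 1 - 1) = 0 by ring, Real.rpow_zero]
  have h3 : ((w.im ^ (((4 - m : ℤ) : ℝ) / 2) : ℝ) : ℂ) * ((w.im ^ ((m : ℝ) / 2 - 1 - 1) : ℝ) : ℂ) = 1 := by
    exact_mod_cast h2
  simp only [map_mul, Complex.conj_I, Complex.conj_ofReal, map_div₀, map_one, map_ofNat]
  linear_combination (-Complex.I ^ 2 * ((m : ℝ) / 2 - 1 : ℝ) *
    (starRingEnd ℂ) (cuspSeries m N z ((starRingEnd ℂ) w))) * h3 -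
    ((m : ℝ) / 2 - 1 : ℝ) * (starRingEnd ℂ) (cuspSeries m N z ((starRingEnd ℂ) w)) * Complex.I_sq

/-! ### Modularity and behaviour at the cusps -/

theorem slash_weightedPsi {m : ℤ} {N : ℕ} (hmN : Odd m → 4 ∣ N) (z : ℍ) {L : SL(2, ℤ)}
    (hL : L ∈ CongruenceSubgroup.Gamma0 N) (w : ℍ) :
    slash (4 - m) (weightedPsi m N z) L w = weightedPsi m N z w := by
  change autFactor (4 - m) L w * weightedPsi m N z (L • w) = _
  rw [weightedPsi, weightedPsi, Psi, Psi,
    ← (Equiv.mulLeft (⟨L, hL⟩ : CongruenceSubgroup.Gamma0 N)).tsum_eq, ← tsum_mul_left,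
    ← tsum_mul_left, ← tsum_mul_left]
  refine tsum_congr fun M => ?_
  rw [psiTerm_eq, psiTerm_eq]
  change autFactor (4 - m) L w * ((((L • w).im ^ ((m : ℝ) / 2 - 1) : ℝ) : ℂ) *
    (autFactor m (L * M) z * psiKernel m (-1) (L • w) ((L * (M : SL(2, ℤ))) • z))) = _
  rw [autFactor_cocycle hmN hL M.2, mul_smul]
  linear_combination autFactor m M z * kernel_transform m L ((M : SL(2, ℤ)) • z) w

/-- The cusp form which is the image of `weightedPsi` under `ξ`. -/
noncomputable def xiImage (m : ℤ) (N : ℕ) (z w : ℍ) : ℂ :=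
  ((m : ℝ) / 2 - 1 : ℝ) * (starRingEnd ℂ) (cuspSeries m N z ((starRingEnd ℂ) w))

theorem slash_xiImage {m : ℤ} {N : ℕ} (hmN : Odd m → 4 ∣ N) (z : ℍ) {L : SL(2, ℤ)}
    (hL : L ∈ CongruenceSubgroup.Gamma0 N) (w : ℍ) :
    slash m (xiImage m N z) L w = xiImage m N z w := by
  change autFactor m L w * xiImage m N z (L • w) = _
  have h : (starRingEnd ℂ) (autFactor m L w) * cuspSeries m N z ((starRingEnd ℂ) ((L • w : ℍ) : ℂ)) =
      cuspSeries m N z ((starRingEnd ℂ) (w : ℂ)) := by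
    rw [cuspSeries, cuspSeries,
      ← (Equiv.mulLeft (⟨L, hL⟩ : CongruenceSubgroup.Gamma0 N)).tsum_eq, ← tsum_mul_left]
    refine tsum_congr fun M => ?_
    change (starRingEnd ℂ) (autFactor m L w) * (autFactor m (L * M) z *
      ((((L * (M : SL(2, ℤ))) • z : ℍ) : ℂ) - (starRingEnd ℂ) ((L • w : ℍ) : ℂ)) ^
        (-((m : ℝ) / 2 - 1 + 1 : ℝ) : ℂ)) = autFactor m M z *
      ((((M : SL(2, ℤ)) • z : ℍ) : ℂ) - (starRingEnd ℂ) (w : ℂ)) ^ (-((m : ℝ) / 2 - 1 + 1 : ℝ) : ℂ)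
    rw [autFactor_cocycle hmN hL M.2, mul_smul, sub_add_cancel, ← Complex.ofReal_neg]
    linear_combination autFactor m M z * cuspKernel_transform m L ((M : SL(2, ℤ)) • z) w
  rw [xiImage, xiImage, ← h, map_mul, Complex.conj_conj]
  ring

/-- The expansion at the cusp L∞ is a series over L⁻¹Γ₀(N), which embeds in SL₂(ℤ); the majorant for
the full modular group therefore covers all cusps at once. -/
theorem exists_tsum_inv_mul_le {m : ℤ} (hm : 4 < m) (N : ℕ) (z : ℍ) (L : SL(2, ℤ)) :
    ∃ C y₀ : ℝ, ∀ w : ℍ, y₀ ≤ w.im → ∃ b : CongruenceSubgroup.Gamma0 N → ℝ, Summable b ∧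
      ∑' M, b M ≤ C * w.im ^ (-((m : ℝ) / 2 - 1)) ∧ ∀ M : CongruenceSubgroup.Gamma0 N,
        ‖autFactor m (L⁻¹ * M) z‖ * ‖psiKernel m (-1) w ((L⁻¹ * (M : SL(2, ℤ))) • z)‖ ≤ b M ∧
        ‖autFactor m (L⁻¹ * M) z‖ * ‖((((L⁻¹ * (M : SL(2, ℤ))) • z : ℍ) : ℂ) -
          (starRingEnd ℂ) (w : ℂ)) ^ ((-((m : ℝ) / 2) : ℝ) : ℂ)‖ ≤ b M := by
  have hk : (2 : ℝ) < (m : ℝ) / 2 := by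
    have : (4 : ℝ) < m := by exact_mod_cast hm
    linarith
  obtain ⟨C, y₀, h⟩ := exists_tsum_kernel_le hk z
  refine ⟨C, y₀, fun w hw => ?_⟩
  obtain ⟨b, hb, hbC, hle⟩ := h w hw
  have hinj : Function.Injective fun M : CongruenceSubgroup.Gamma0 N => L⁻¹ * (M : SL(2, ℤ)) :=
    fun M M' hMM' => Subtype.ext (mul_left_cancel hMM')
  have hb0 : ∀ M, 0 ≤ b M := fun M => le_trans (by positivity) (hle M).2
  refine ⟨_, hb.comp_injective hinj, ?_, fun M => ⟨?_, ?_⟩⟩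
  · rw [show -((m : ℝ) / 2 - 1) = 1 - (m : ℝ) / 2 by ring]
    exact (tsum_comp_le_tsum_of_inj hb hb0 hinj).trans hbC
  · rw [norm_autFactor, norm_psiKernel_neg_one]
    exact (hle _).1
  · rw [norm_autFactor, Complex.norm_cpow_real]
    exact (hle _).2

theorem norm_denomPow (m : ℤ) (L : SL(2, ℤ)) (w : ℍ) : ‖denomPow m L w‖ = ‖autFactor m L w‖ := by
  rw [autFactor, norm_mul, norm_slashMultiplier, one_mul]

theorem boundedAtCusps_weightedPsi {m : ℤ} (hm : 4 < m) (N : ℕ) (z : ℍ) :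
    BoundedAtCusps (4 - m) (weightedPsi m N z) := by
  intro L
  obtain ⟨C, y₀, h⟩ := exists_tsum_inv_mul_le hm N z L
  rw [isBoundedAtImInfty_iff]
  refine ⟨C, y₀, fun w hw => ?_⟩
  obtain ⟨b, hb, hbC, hle⟩ := h w hw
  have hw0 := w.im_pos
  rw [atCusp, weightedPsi, Psi, ← tsum_mul_left, ← tsum_mul_left]
  refine (tsum_of_norm_bounded (hb.mul_left (w.im ^ ((m : ℝ) / 2 - 1))).hasSum fun M => ?_).trans ?_
  · obtain ⟨M', hM'⟩ : ∃ M', M' = L⁻¹ * (M : SL(2, ℤ)) := ⟨_, rfl⟩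
    have hM : (M : SL(2, ℤ)) = L * M' := by rw [hM']; group
    have hb1 := (hle M).1
    rw [← hM'] at hb1
    -- Only norms are compared, so L need not lie in Γ₀(N): absolute values of automorphy factors
    -- satisfy the cocycle relation on all of SL₂(ℤ).
    have h1 := congrArg norm (kernel_transform m L (M' • z) w)
    rw [norm_mul, norm_mul, norm_mul, norm_mul] at h1
    rw [psiTerm_eq, hM, norm_mul, norm_mul, norm_mul, norm_denomPow, norm_autFactor_mul, mul_smul]
    have h2 : ‖((w.im ^ ((m : ℝ) / 2 - 1) : ℝ) : ℂ)‖ = w.im ^ ((m : ℝ) / 2 - 1) := by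
      rw [Complex.norm_real, Real.norm_of_nonneg (by positivity)]
    rw [h2] at h1
    calc _ = ‖autFactor m M' z‖ * (w.im ^ ((m : ℝ) / 2 - 1) * ‖psiKernel m (-1) w (M' • z)‖) := by
          linear_combination ‖autFactor m M' z‖ * h1
      _ = w.im ^ ((m : ℝ) / 2 - 1) *
          (‖autFactor m M' z‖ * ‖psiKernel m (-1) w (M' • z)‖) := by ring
      _ ≤ _ := by gcongr
  · rw [tsum_mul_left]
    calc _ ≤ w.im ^ ((m : ℝ) / 2 - 1) * (C * w.im ^ (-((m : ℝ) / 2 - 1))) := by gcongr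
      _ = C * (w.im ^ ((m : ℝ) / 2 - 1) * w.im ^ (-((m : ℝ) / 2 - 1))) := by ring
      _ = C := by rw [← Real.rpow_add hw0]; simp

theorem zeroAtCusps_xiImage {m : ℤ} (hm : 4 < m) (N : ℕ) (z : ℍ) (L : SL(2, ℤ)) :
    IsZeroAtImInfty (atCusp m (xiImage m N z) L) := by
  have hs : 0 < (m : ℝ) / 2 - 1 := by
    have : (4 : ℝ) < m := by exact_mod_cast hm
    linarith
  obtain ⟨C, y₀, h⟩ := exists_tsum_inv_mul_le hm N z L
  rw [isZeroAtImInfty_iff]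
  intro ε hε
  have hlim : Tendsto (fun y : ℝ => ((m : ℝ) / 2 - 1) * (C * y ^ (-((m : ℝ) / 2 - 1)))) atTop (𝓝 0) := by
    simpa using ((tendsto_rpow_neg_atTop hs).const_mul C).const_mul ((m : ℝ) / 2 - 1)
  obtain ⟨A, hA⟩ := Filter.eventually_atTop.mp (hlim.eventually (ge_mem_nhds hε))
  refine ⟨max A y₀, fun w hw => ?_⟩
  refine le_trans ?_ (hA w.im ((le_max_left _ _).trans hw))
  obtain ⟨b, hb, hbC, hle⟩ := h w ((le_max_right _ _).trans hw)
  have key : ‖denomPow m L w‖ * ‖cuspSeries m N z ((starRingEnd ℂ) ((L • w : ℍ) : ℂ))‖ ≤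
      ∑' M, b M := by
    rw [← norm_mul, cuspSeries, ← tsum_mul_left]
    refine tsum_of_norm_bounded hb.hasSum fun M => ?_
    obtain ⟨M', hM'⟩ : ∃ M', M' = L⁻¹ * (M : SL(2, ℤ)) := ⟨_, rfl⟩
    have hM : (M : SL(2, ℤ)) = L * M' := by rw [hM']; group
    have hb1 := (hle M).2
    rw [← hM'] at hb1
    have h1 := congrArg norm (cuspKernel_transform m L (M' • z) w)
    rw [norm_mul, norm_mul, RCLike.norm_conj] at h1
    rw [orbitCoeff, orbitPoint, hM, norm_mul, norm_mul, norm_denomPow, norm_autFactor_mul, mul_smul,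
      sub_add_cancel, ← Complex.ofReal_neg]
    calc _ = ‖autFactor m M' z‖ * ‖(((M' • z : ℍ) : ℂ) -
          (starRingEnd ℂ) (w : ℂ)) ^ ((-((m : ℝ) / 2) : ℝ) : ℂ)‖ := by
          linear_combination ‖autFactor m M' z‖ * h1
      _ ≤ _ := hb1
  rw [atCusp, xiImage, norm_mul, norm_mul, RCLike.norm_conj, Complex.norm_real,
    Real.norm_of_nonneg hs.le]
  calc _ = ((m : ℝ) / 2 - 1) * (‖denomPow m L w‖ *
        ‖cuspSeries m N z ((starRingEnd ℂ) ((L • w : ℍ) : ℂ))‖) := by ring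
    _ ≤ _ := mul_le_mul_of_nonneg_left (key.trans hbC) hs.le

theorem differentiableOn_xiImage {m : ℤ} (hm : 4 < m) (N : ℕ) (z : ℍ) :
    DifferentiableOn ℂ (fun ξ : ℂ => xiImage m N z (ofComplex ξ)) {ξ : ℂ | 0 < ξ.im} := by
  intro ξ hξ
  have hξ' : 0 < ξ.im := hξ
  have h1 : DifferentiableAt ℂ (cuspSeries m N z) ((starRingEnd ℂ) ξ) :=
    differentiableAt_cuspSeries hm N z (by simpa using hξ')
  have h2 := h1.conj_conj.const_mul (((m : ℝ) / 2 - 1 : ℝ) : ℂ)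
  rw [Complex.conj_conj] at h2
  refine (h2.congr_of_eventuallyEq ?_).differentiableWithinAt
  filter_upwards [eventually_im_pos hξ'] with ζ hζ
  rw [xiImage, ofComplex_apply_of_im_pos hζ]
  rfl

theorem isCuspForm_xiImage {m : ℤ} (hm : 4 < m) {N : ℕ} (hmN : Odd m → 4 ∣ N) (z : ℍ) :
    IsCuspForm m N (xiImage m N z) where
  holo := differentiableOn_xiImage hm N z
  slash_eq := fun _ hL w => slash_xiImage hmN z hL w
  zero_at_cusps := zeroAtCusps_xiImage hm N z

/-! ### Local behaviour at the poles -/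

/-- Splitting off the summands singular at `w₀`. -/
theorem weightedPsi_eq_add {m : ℤ} (hm : 4 < m) (N : ℕ) (z w₀ : ℍ) :
    ∃ (S : ℂ) (A : ℂ → ℂ), AnalyticAt ℝ A w₀ ∧ ∀ w : ℍ, weightedPsi m N z w =
      S * (((w.im ^ ((m : ℝ) / 2 - 1) : ℝ) : ℂ) *
        ((w₀ : ℂ) - (starRingEnd ℂ) (w : ℂ)) ^ (-(((m : ℝ) / 2 - 1 : ℝ) : ℂ))) *
        ((w₀ : ℂ) - w)⁻¹ + A w := by
  have hfin : {M : CongruenceSubgroup.Gamma0 N | orbitPoint N z M = w₀}.Finite := by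
    refine ((finite_smul_near z w₀).preimage Subtype.val_injective.injOn).subset fun M hM => ?_
    have hM' : orbitPoint N z M = w₀ := hM
    change ‖orbitPoint N z M - w₀‖ < w₀.im / 2
    rw [hM', sub_self, norm_zero]
    exact half_pos w₀.im_pos
  set B := hfin.toFinset with hB
  obtain ⟨ρ, hρ, b, hb, h⟩ := exists_bound_orbit hm N z (conj_coe_im_neg w₀)
  obtain ⟨δ, hδ, hδ'⟩ := exists_le_norm_smul_sub z w₀
  have hA := analyticAt_kernelSeries (a := fun M : {M // M ∉ B} => orbitCoeff m N z M)
    (u := fun M : {M // M ∉ B} => orbitPoint N z M) (s := (m : ℝ) / 2 - 1)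
    (hb.comp_injective (Subtype.val_injective (p := (· ∉ B)))) (ζ₀ := w₀) hρ hδ
    (fun M => orbitPoint_im_pos N z M)
    (fun M => hδ' M.1 fun hM => M.2 (hfin.mem_toFinset.mpr hM))
    (fun σ hσ => ⟨(h σ hσ).1, fun M => (h σ hσ).2 M⟩)
  refine ⟨∑ M ∈ B, orbitCoeff m N z M, _,
    (analyticAt_im_rpow ((m : ℝ) / 2 - 1) w₀.im_pos).fun_mul (analyticAt_comp_conj hA), fun w => ?_⟩
  rw [weightedPsi, Psi, ← (summable_psiTerm hm N z w).sum_add_tsum_subtype_compl B, mul_add]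
  congr 1
  · rw [Finset.mul_sum, Finset.sum_mul, Finset.sum_mul]
    refine Finset.sum_congr rfl fun M hM => ?_
    rw [hB, Set.Finite.mem_toFinset] at hM
    have hM' : orbitPoint N z M = w₀ := hM
    rw [psiTerm_neg_one_eq, hM']
    ring
  · rw [coe_im]
    congr 1
    exact tsum_congr fun M => psiTerm_neg_one_eq m N z w M

theorem polar_weightedPsi {m : ℤ} (hm : 4 < m) (N : ℕ) (z w₀ : ℍ) :
    ∃ n : ℕ, ∃ C : ℝ, ∀ᶠ w : ℍ in 𝓝 w₀, ‖((w : ℂ) - w₀) ^ n * weightedPsi m N z w‖ ≤ C := by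
  obtain ⟨S, A, hA, h⟩ := weightedPsi_eq_add hm N z w₀
  set K : ℍ → ℂ := fun w => S * (((w.im ^ ((m : ℝ) / 2 - 1) : ℝ) : ℂ) *
        ((w₀ : ℂ) - (starRingEnd ℂ) (w : ℂ)) ^ (-(((m : ℝ) / 2 - 1 : ℝ) : ℂ))) with hK
  have hKc : ContinuousAt K w₀ := by
    apply ContinuousAt.mul continuousAt_const
    apply ContinuousAt.mul
    · exact ContinuousAt.comp (g := fun ξ : ℂ => ((ξ.im ^ ((m : ℝ) / 2 - 1) : ℝ) : ℂ)) (f := ((↑) : ℍ → ℂ))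
        (analyticAt_im_rpow _ w₀.im_pos).continuousAt continuous_coe.continuousAt
    · refine ContinuousAt.cpow ?_ continuousAt_const (Or.inr (sub_conj_im_pos w₀ w₀).ne')
      exact continuousAt_const.sub
        (Complex.continuous_conj.continuousAt.comp continuous_coe.continuousAt)
  have hAc : ContinuousAt (fun w : ℍ => A w) w₀ :=
    ContinuousAt.comp (g := A) (f := ((↑) : ℍ → ℂ)) hA.continuousAt continuous_coe.continuousAt
  have hc : ContinuousAt (fun w : ℍ => ‖K w‖ + ‖((w : ℂ) - w₀) * A w‖) w₀ :=
    hKc.norm.add (((continuous_coe.continuousAt).sub continuousAt_const).mul hAc).norm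
  refine ⟨1, _, (hc.eventually (gt_mem_nhds (lt_add_one _))).mono fun w hw => le_trans ?_ hw.le⟩
  rw [pow_one, h w, mul_add]
  refine (norm_add_le _ _).trans (add_le_add_left ?_ _)
  by_cases hw0 : (w : ℂ) = w₀
  · rw [hw0, sub_self, zero_mul, norm_zero]
    exact norm_nonneg _
  · have h1 : (w₀ : ℂ) - w ≠ 0 := sub_ne_zero.mpr (Ne.symm hw0)
    rw [show ((w : ℂ) - w₀) * (S * (((w.im ^ ((m : ℝ) / 2 - 1) : ℝ) : ℂ) *
        ((w₀ : ℂ) - (starRingEnd ℂ) (w : ℂ)) ^ (-(((m : ℝ) / 2 - 1 : ℝ) : ℂ))) *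
        ((w₀ : ℂ) - w)⁻¹) = -K w by rw [hK]; field_simp; ring, norm_neg]

/-- The kernel is the sum of a simple pole and of a real analytic function. -/
theorem exists_kernel_decomposition (s : ℝ) (w₀ : ℍ) :
    ∃ (c : ℂ) (A : ℂ → ℂ), AnalyticAt ℝ A w₀ ∧ ∀ᶠ w : ℍ in 𝓝[≠] w₀, ((w.im ^ s : ℝ) : ℂ) *
        ((w₀ : ℂ) - (starRingEnd ℂ) (w : ℂ)) ^ (-(s : ℂ)) * ((w₀ : ℂ) - w)⁻¹ =
      c * ((w₀ : ℂ) - w)⁻¹ + A w := by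
  -- With τ = (w - w₀)/(w₀ - w̄) one has 2iy = (1 + τ)(w₀ - w̄), hence y^s (w₀ - w̄)^(-s) =
  -- (2i)^(-s) (1 + τ)^s. Writing (1 + τ)^s = 1 + τψ(τ) separates the pole, because τ/(w₀ - w) =
  -- -1/(w₀ - w̄) is real analytic at w₀.
  set φ : ℂ → ℂ := fun t => (1 + t) ^ (s : ℂ) with hφ
  have hφd : DifferentiableOn ℂ φ (Metric.ball 0 1) := by
    intro t ht
    refine (DifferentiableAt.cpow_const (by fun_prop) (Or.inl ?_)).differentiableWithinAt
    rw [mem_ball_zero_iff] at ht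
    have := (Complex.abs_re_le_norm t).trans_lt ht
    rw [abs_lt] at this
    simp only [Complex.add_re, Complex.one_re]
    linarith
  have hψ : AnalyticAt ℂ (dslope φ 0) 0 :=
    ((Complex.differentiableOn_dslope (Metric.ball_mem_nhds 0 one_pos)).mpr hφd).analyticAt
      (Metric.ball_mem_nhds 0 one_pos)
  set τ : ℂ → ℂ := fun ξ => (ξ - w₀) * ((w₀ : ℂ) - (starRingEnd ℂ) ξ)⁻¹ with hτ
  have hconj : AnalyticAt ℝ (fun ξ : ℂ => (starRingEnd ℂ) ξ) w₀ :=
    (Complex.conjCLE : ℂ →L[ℝ] ℂ).analyticAt _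
  have hinv : AnalyticAt ℝ (fun ξ : ℂ => ((w₀ : ℂ) - (starRingEnd ℂ) ξ)⁻¹) w₀ :=
    (analyticAt_const.sub hconj).fun_inv (sub_conj_ne_zero w₀ w₀)
  have hτa : AnalyticAt ℝ τ w₀ := (analyticAt_id.sub analyticAt_const).fun_mul hinv
  have hτ0 : τ w₀ = 0 := by simp [hτ]
  have hψτ : AnalyticAt ℝ (fun ξ => dslope φ 0 (τ ξ)) w₀ := by
    refine AnalyticAt.fun_comp (g := dslope φ 0) ?_ hτa
    rw [hτ0]
    exact hψ.restrictScalars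
  refine ⟨(2 * Complex.I) ^ (-(s : ℂ)), fun ξ => -(2 * Complex.I) ^ (-(s : ℂ)) *
    (((w₀ : ℂ) - (starRingEnd ℂ) ξ)⁻¹ * dslope φ 0 (τ ξ)),
    analyticAt_const.fun_mul (hinv.fun_mul hψτ), ?_⟩
  have hsmall : ∀ᶠ w : ℍ in 𝓝 w₀, ‖τ w‖ < 1 := by
    have h1 : ContinuousAt (fun w : ℍ => ‖τ w‖) w₀ :=
      (ContinuousAt.comp (g := τ) (f := ((↑) : ℍ → ℂ)) hτa.continuousAt
        continuous_coe.continuousAt).norm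
    have h2 := h1.tendsto
    rw [hτ0, norm_zero] at h2
    exact h2.eventually (gt_mem_nhds one_pos)
  filter_upwards [nhdsWithin_le_nhds hsmall, self_mem_nhdsWithin] with w hw hne
  have hne' : (w : ℂ) ≠ w₀ := fun h => hne (by
    rw [Set.mem_singleton_iff]; exact UpperHalfPlane.ext h)
  have hd : (w₀ : ℂ) - w ≠ 0 := sub_ne_zero.mpr (Ne.symm hne')
  have hp := sub_conj_ne_zero w₀ w
  have hp' := sub_conj_im_pos w₀ w
  have hτw : τ w ≠ 0 := mul_ne_zero (sub_ne_zero.mpr hne') (inv_ne_zero hp)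
  have h1 : 1 + τ w = 2 * Complex.I * w.im * ((w₀ : ℂ) - (starRingEnd ℂ) (w : ℂ))⁻¹ := by
    have h2 : (w : ℂ) - (starRingEnd ℂ) (w : ℂ) = 2 * Complex.I * w.im := by
      apply Complex.ext <;> simp
      ring
    rw [hτ, ← h2]
    field_simp
    ring
  have hslit : 1 + τ w ≠ 0 := by
    rw [h1]
    have : (w.im : ℂ) ≠ 0 := by exact_mod_cast w.im_pos.ne'
    simp [hp, this]
  have hre : 0 < (1 + τ w).re := by
    have := (Complex.abs_re_le_norm (τ w)).trans_lt hw
    rw [abs_lt] at this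
    simp only [Complex.add_re, Complex.one_re]
    linarith
  have hlog2I : Complex.log (2 * Complex.I) = (Real.log 2 : ℝ) + Real.pi / 2 * Complex.I := by
    rw [show (2 * Complex.I : ℂ) = ((2 : ℝ) : ℂ) * Complex.I by push_cast; ring,
      Complex.log_ofReal_mul (by norm_num) Complex.I_ne_zero, Complex.log_I]
  have hlog : Complex.log (1 + τ w) + Complex.log ((w₀ : ℂ) - (starRingEnd ℂ) (w : ℂ)) =
      Complex.log (2 * Complex.I) + Real.log w.im := by
    have h3 : (1 + τ w) * ((w₀ : ℂ) - (starRingEnd ℂ) (w : ℂ)) = ((w.im * 2 : ℝ) : ℂ) * Complex.I := by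
      rw [h1]; push_cast; field_simp
    have h4 : Complex.log (1 + τ w) + Complex.log ((w₀ : ℂ) - (starRingEnd ℂ) (w : ℂ)) =
        Complex.log ((1 + τ w) * ((w₀ : ℂ) - (starRingEnd ℂ) (w : ℂ))) := by
      refine (Complex.log_mul hslit hp ?_).symm
      have a1 := arg_pos_of_im_pos hp'
      have a2 := arg_lt_pi_of_im_pos hp'
      have a3 := Complex.abs_arg_lt_pi_div_two_iff.mpr (Or.inl hre)
      rw [abs_lt] at a3
      have hpi := Real.pi_pos
      refine ⟨by linarith, ?_⟩
      -- An argument sum above π would make the imaginary part of the product negative, whereas the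
      -- product is 2iy.
      by_contra! hcon
      have h5 := im_mul_eq (1 + τ w) ((w₀ : ℂ) - (starRingEnd ℂ) (w : ℂ))
      rw [h3] at h5
      have h6 := Real.sin_pos_of_pos_of_lt_pi (x := (1 + τ w).arg +
        ((w₀ : ℂ) - (starRingEnd ℂ) (w : ℂ)).arg - Real.pi) (by linarith) (by linarith)
      rw [Real.sin_sub_pi] at h6
      have h7 : 0 < ‖1 + τ w‖ * ‖(w₀ : ℂ) - (starRingEnd ℂ) (w : ℂ)‖ := by positivity
      have h8 : (((w.im * 2 : ℝ) : ℂ) * Complex.I).im = w.im * 2 := by simp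
      rw [h8] at h5
      have := w.im_pos
      nlinarith
    rw [h4, h3, Complex.log_ofReal_mul (by have := w.im_pos; positivity) Complex.I_ne_zero,
      Complex.log_I, hlog2I, Real.log_mul w.im_pos.ne' (by norm_num)]
    push_cast
    ring
  have hmain : ((w.im ^ s : ℝ) : ℂ) * ((w₀ : ℂ) - (starRingEnd ℂ) (w : ℂ)) ^ (-(s : ℂ)) =
      (2 * Complex.I) ^ (-(s : ℂ)) * φ (τ w) := by
    rw [hφ]
    simp only
    rw [Complex.cpow_def_of_ne_zero hp, Complex.cpow_def_of_ne_zero hslit,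
      Complex.cpow_def_of_ne_zero (by simp), Real.rpow_def_of_pos w.im_pos, ← Complex.exp_add,
      Complex.ofReal_exp, ← Complex.exp_add]
    congr 1
    push_cast
    linear_combination (-(s : ℂ)) * hlog
  rw [hmain, dslope_of_ne _ hτw, slope_def_field]
  have hφ0 : φ 0 = 1 := by simp [hφ]
  have hτinv : ((w₀ : ℂ) - (starRingEnd ℂ) (w : ℂ))⁻¹ = -τ w * ((w₀ : ℂ) - w)⁻¹ := by
    rw [hτ]; field_simp; ring
  rw [hφ0, sub_zero, hτinv]
  field_simp
  ring

theorem singularitiesArePoles_weightedPsi {m : ℤ} (hm : 4 < m) (N : ℕ) (z : ℍ) :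
    SingularitiesArePoles (weightedPsi m N z) := by
  intro w₀
  obtain ⟨S, A, hA, h⟩ := weightedPsi_eq_add hm N z w₀
  obtain ⟨c, A', hA', h'⟩ := exists_kernel_decomposition ((m : ℝ) / 2 - 1) w₀
  refine ⟨fun ξ => S * c * ((w₀ : ℂ) - ξ)⁻¹, fun ξ => S * A' ξ + A ξ, ?_,
    (analyticAt_const.fun_mul hA').fun_add hA, ?_⟩
  · exact (MeromorphicAt.const _ _).fun_mul ((MeromorphicAt.const _ _).fun_sub (MeromorphicAt.id _)).fun_inv
  · filter_upwards [h'] with w hw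
    rw [h w]
    linear_combination S * hw

theorem isPolarHarmonicCusp_weightedPsi {m : ℤ} (hm : 4 < m) {N : ℕ} (hmN : Odd m → 4 ∣ N) (z : ℍ) :
    IsPolarHarmonicCusp (4 - m) N (weightedPsi m N z) where
  isPolarHarmonicMaassForm :=
    { analytic := fun w => (eventually_offOrbit z w).mono fun _ h => regularAt_weightedPsi hm N h
      slash_eq := fun _ hL w => slash_weightedPsi hmN z hL w
      harmonic := fun _ h => laplacian_weightedPsi hm N h
      polar := polar_weightedPsi hm N z
      growth := fun L => ⟨0, by
        have h : atCusp (4 - m) (weightedPsi m N z) L =O[atImInfty] (1 : ℍ → ℝ) :=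
          boundedAtCusps_weightedPsi hm N z L
        have h1 : (fun w : ℍ => Real.exp (0 * w.im)) = 1 := by
          funext w; rw [zero_mul, Real.exp_zero, Pi.one_apply]
        rwa [h1]⟩ }
  singularitiesArePoles := singularitiesArePoles_weightedPsi hm N z
  boundedAtCusps := boundedAtCusps_weightedPsi hm N z
  hasCuspidalXiImage := ⟨xiImage m N z, by
    rw [sub_sub_cancel]; exact isCuspForm_xiImage hm hmN z, fun _ h => xi_weightedPsi hm N h⟩

/-! ### Cosets of translations and the function H -/

/-- A representative of a coset of the group of translations. -/
noncomputable def cosetRep {N : ℕ} (q : TranslationCosets N) : SL(2, ℤ) :=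
  (Quotient.out q : CongruenceSubgroup.Gamma0 N)

theorem T_zpow_mul_row (n : ℤ) (M : SL(2, ℤ)) : (ModularGroup.T ^ n * M) 1 = M 1 := by
  funext i
  fin_cases i <;> simp

theorem T_zpow_mem_Gamma0 (N : ℕ) (n : ℤ) : ModularGroup.T ^ n ∈ CongruenceSubgroup.Gamma0 N := by
  rw [mem_Gamma0_iff]
  simp [ModularGroup.coe_T_zpow]

theorem mk_eq_mk_of_eq_T_zpow_mul {N : ℕ} {M M' : CongruenceSubgroup.Gamma0 N} {n : ℤ}
    (h : (M' : SL(2, ℤ)) = ModularGroup.T ^ n * M) :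
    (Quotient.mk _ M : TranslationCosets N) = Quotient.mk _ M' := by
  refine Quotient.sound (QuotientGroup.rightRel_apply.mpr (Subgroup.mem_subgroupOf.mpr ?_))
  refine Subgroup.mem_zpowers_iff.mpr ⟨n, ?_⟩
  simp [h]

theorem cosetRep_row_injective (N : ℕ) :
    Function.Injective fun q : TranslationCosets N => (cosetRep q) 1 := by
  intro q q' h
  obtain ⟨n, hn⟩ := eq_T_zpow_mul (congrFun h 0) (congrFun h 1)
  have := mk_eq_mk_of_eq_T_zpow_mul hn
  rwa [Quotient.out_eq, Quotient.out_eq] at this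

theorem exists_eq_T_zpow_mul_cosetRep {N : ℕ} (M : CongruenceSubgroup.Gamma0 N) :
    ∃ n : ℤ, (M : SL(2, ℤ)) =
      ModularGroup.T ^ n * cosetRep (Quotient.mk _ M : TranslationCosets N) := by
  have h := Quotient.mk_out (s := QuotientGroup.rightRel (translations N)) M
  obtain ⟨n, hn⟩ := Subgroup.mem_zpowers_iff.mp
    (Subgroup.mem_subgroupOf.mp (QuotientGroup.rightRel_apply.mp h))
  refine ⟨n, ?_⟩
  rw [hn, cosetRep]
  simp

/-- Every element of `Γ₀(N)` is in a unique way the product of a translation and a coset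
representative. -/
noncomputable def cosetEquiv (N : ℕ) : TranslationCosets N × ℤ ≃ CongruenceSubgroup.Gamma0 N :=
  Equiv.ofBijective
    (fun p => ⟨ModularGroup.T ^ p.2 * cosetRep p.1,
      mul_mem (T_zpow_mem_Gamma0 N p.2) (Quotient.out p.1).2⟩) (by
    constructor
    · rintro ⟨q, n⟩ ⟨q', n'⟩ h
      have h' : ModularGroup.T ^ n * cosetRep q = ModularGroup.T ^ n' * cosetRep q' :=
        congrArg Subtype.val h
      have hrow := congrArg (fun M : SL(2, ℤ) => M 1) h'
      simp only [T_zpow_mul_row] at hrow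
      obtain rfl := cosetRep_row_injective N hrow
      have hT := congrArg (fun M : SL(2, ℤ) => M 0 1) (mul_right_cancel h')
      simp only [ModularGroup.coe_T_zpow] at hT
      simpa using hT
    · intro M
      obtain ⟨n, hn⟩ := exists_eq_T_zpow_mul_cosetRep M
      exact ⟨(_, n), Subtype.ext hn.symm⟩)

theorem coe_cosetEquiv {N : ℕ} (q : TranslationCosets N) (n : ℤ) :
    (cosetEquiv N (q, n) : SL(2, ℤ)) = ModularGroup.T ^ n * cosetRep q := rfl

theorem summable_norm_cd_cosetRep {k : ℝ} (hk : 2 < k) (N : ℕ) (z : ℍ) :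
    Summable fun q : TranslationCosets N => ‖cd (cosetRep q) z‖ ^ (-k) :=
  Summable.of_nonneg_of_le (fun _ => Real.rpow_nonneg (norm_nonneg _) _)
    (fun q => norm_cd_rpow_le (by linarith) z (cosetRep q))
    (((EisensteinSeries.summable_one_div_norm_rpow hk).mul_left _).comp_injective
      (cosetRep_row_injective N))

theorem summable_norm_autFactor_cosetRep {m : ℤ} (hm : 4 < m) (N : ℕ) (z : ℍ) :
    Summable fun q : TranslationCosets N => ‖autFactor m (cosetRep q) z‖ := by
  have : (4 : ℝ) < m := by exact_mod_cast hm
  simpa only [norm_autFactor] using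
    summable_norm_cd_cosetRep (show 2 < (m : ℝ) / 2 by linarith) N z

/-- Since |cz + d|^(-4) = (Im(Mz)/Im z)², convergence of the series with exponent 4 over the cosets
leaves room for finitely many large imaginary parts only. -/
theorem finite_le_im_cosetRep_smul (N : ℕ) (z : ℍ) {δ : ℝ} (hδ : 0 < δ) :
    {q : TranslationCosets N | δ ≤ (cosetRep q • z).im}.Finite := by
  have hz := z.im_pos
  have h := (summable_norm_cd_cosetRep (k := 4) (by norm_num) N z).tendsto_cofinite_zero
  have hc : 0 < (δ / z.im) ^ 2 := by positivity
  have hfin : {q : TranslationCosets N | ¬ ‖cd (cosetRep q) z‖ ^ (-4 : ℝ) < (δ / z.im) ^ 2}.Finite :=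
    h.eventually (gt_mem_nhds hc)
  refine hfin.subset fun q hq => not_lt.mpr ?_
  have hq' : δ ≤ (cosetRep q • z).im := hq
  have hcd : 0 < ‖cd (cosetRep q) z‖ := norm_pos_iff.mpr (cd_ne_zero _ z)
  have h1 : δ / z.im ≤ (‖cd (cosetRep q) z‖ ^ 2)⁻¹ := by
    have h2 := im_smul_mul (cosetRep q) z
    rw [div_le_iff₀ hz, ← h2, mul_comm, mul_assoc, mul_inv_cancel₀ (by positivity), mul_one]
    exact hq'
  calc _ ≤ ((‖cd (cosetRep q) z‖ ^ 2)⁻¹) ^ 2 := by gcongr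
    _ = _ := by
      rw [Real.rpow_neg hcd.le, inv_pow, ← pow_mul]
      norm_cast

theorem hTerm_eq (m : ℤ) (N : ℕ) (z w : ℍ) (q : TranslationCosets N) :
    hTerm m N z w q = autFactor m (cosetRep q) z * hKernel w (cosetRep q • z) := by
  conv_lhs => rw [← Quotient.out_eq q]
  rfl

theorem norm_inv_one_sub_exp_le {δ : ℝ} (hδ : 0 < δ) {u ξ : ℂ} (h : u.im + δ ≤ ξ.im) :
    1 - Complex.exp (2 * Real.pi * Complex.I * (ξ - u)) ≠ 0 ∧
    ‖1 / (1 - Complex.exp (2 * Real.pi * Complex.I * (ξ - u)))‖ ≤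
      (1 - Real.exp (-(2 * Real.pi * δ)))⁻¹ := by
  have hpi := Real.pi_pos
  have h1 : ‖Complex.exp (2 * Real.pi * Complex.I * (ξ - u))‖ ≤ Real.exp (-(2 * Real.pi * δ)) := by
    rw [Complex.norm_exp]
    refine Real.exp_le_exp.mpr ?_
    have : (2 * Real.pi * Complex.I * (ξ - u)).re = -(2 * Real.pi * (ξ.im - u.im)) := by simp
    rw [this]
    nlinarith
  have h2 : Real.exp (-(2 * Real.pi * δ)) < 1 := Real.exp_lt_one_iff.mpr (by nlinarith)
  have h3 := norm_sub_norm_le 1 (Complex.exp (2 * Real.pi * Complex.I * (ξ - u)))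
  rw [norm_one] at h3
  have h4 : 1 - Real.exp (-(2 * Real.pi * δ)) ≤
      ‖1 - Complex.exp (2 * Real.pi * Complex.I * (ξ - u))‖ := by linarith
  refine ⟨norm_pos_iff.mp (by linarith), ?_⟩
  rw [norm_div, norm_one, one_div]
  exact inv_anti₀ (by linarith) h4

/-- All but finitely many cosets satisfy Im(Mz) < Im(w)/2, where the kernel is uniformly bounded.
The exceptional ones, which include any undefined summand, do not affect convergence. -/
theorem summable_hTerm {m : ℤ} (hm : 4 < m) (N : ℕ) (z w : ℍ) : Summable (hTerm m N z w) := by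
  have hw := half_pos w.im_pos
  refine Summable.of_norm_bounded_eventually
    ((summable_norm_autFactor_cosetRep hm N z).mul_right (1 - Real.exp (-(2 * Real.pi * (w.im / 2))))⁻¹)
    ((finite_le_im_cosetRep_smul N z hw).subset fun q hq => ?_)
  by_contra hlt
  have hlt' : ¬ w.im / 2 ≤ (cosetRep q • z).im := hlt
  rw [not_le] at hlt'
  refine hq ?_
  change ‖hTerm m N z w q‖ ≤ _
  rw [hTerm_eq, norm_mul]
  refine mul_le_mul_of_nonneg_left ?_ (norm_nonneg _)
  refine (norm_inv_one_sub_exp_le hw (u := ((cosetRep q • z : ℍ) : ℂ)) (ξ := w) ?_).2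
  rw [coe_im, coe_im]
  linarith

/-- Near ξ₀ the finitely many cosets with Im(Mz) ≥ Im(ξ₀)/4 contribute a finite sum of meromorphic
functions. The others converge normally on Im ξ > Im(ξ₀)/2 and add up to a holomorphic function. -/
theorem meromorphicOn_H {m : ℤ} (hm : 4 < m) (N : ℕ) (z : ℍ) :
    MeromorphicOn (fun ξ : ℂ => H m N z (ofComplex ξ)) {ξ : ℂ | 0 < ξ.im} := by
  intro ξ₀ hξ₀
  have hξ₀' : 0 < ξ₀.im := hξ₀
  have hδ : 0 < ξ₀.im / 4 := by positivity
  set F : TranslationCosets N → ℂ → ℂ := fun q ξ => autFactor m (cosetRep q) z *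
    (1 / (1 - Complex.exp (2 * Real.pi * Complex.I * (ξ - (cosetRep q • z : ℍ))))) with hF
  set B := (finite_le_im_cosetRep_smul N z hδ).toFinset with hB
  set U : Set ℂ := {ξ | ξ₀.im / 2 < ξ.im} with hU
  have hUo : IsOpen U := isOpen_lt continuous_const Complex.continuous_im
  have hU₀ : ξ₀ ∈ U := half_lt_self hξ₀'
  have hbd : ∀ (q : {q // q ∉ B}) (ξ : ℂ), ξ ∈ U →
      ((cosetRep q.1 • z : ℍ) : ℂ).im + ξ₀.im / 4 ≤ ξ.im := by
    intro q ξ hξ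
    have hq : ¬ ξ₀.im / 4 ≤ (cosetRep q.1 • z).im := fun h => q.2 (Set.Finite.mem_toFinset _ |>.mpr h)
    rw [not_le] at hq
    have hξ' : ξ₀.im / 2 < ξ.im := hξ
    rw [coe_im]
    linarith
  have htail : DifferentiableOn ℂ (fun ξ => ∑' q : {q // q ∉ B}, F q ξ) U := by
    refine Complex.differentiableOn_tsum_of_summable_norm
      (((summable_norm_autFactor_cosetRep hm N z).mul_right
        (1 - Real.exp (-(2 * Real.pi * (ξ₀.im / 4))))⁻¹).comp_injective
          (Subtype.val_injective (p := (· ∉ B)))) (fun q ξ hξ => ?_) hUo (fun q ξ hξ => ?_)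
    · have h := (norm_inv_one_sub_exp_le hδ (hbd q ξ hξ)).1
      apply DifferentiableAt.differentiableWithinAt
      have hd : DifferentiableAt ℂ (fun ξ : ℂ => 1 - Complex.exp (2 * Real.pi * Complex.I *
          (ξ - (cosetRep q.1 • z : ℍ)))) ξ := by fun_prop
      exact ((differentiableAt_const (1 : ℂ)).fun_div hd h).const_mul _
    · rw [hF, norm_mul]
      exact mul_le_mul_of_nonneg_left (norm_inv_one_sub_exp_le hδ (hbd q ξ hξ)).2 (norm_nonneg _)
  have hmer : ∀ q, MeromorphicAt (F q) ξ₀ := fun q => by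
    have h : AnalyticAt ℂ (fun ξ : ℂ => 1 - Complex.exp (2 * Real.pi * Complex.I *
        (ξ - (cosetRep q • z : ℍ)))) ξ₀ := by fun_prop
    exact (MeromorphicAt.const _ _).fun_mul ((MeromorphicAt.const _ _).fun_div h.meromorphicAt)
  refine ((MeromorphicAt.fun_sum (s := B) fun q _ => hmer q).fun_add
    (htail.analyticAt (hUo.mem_nhds hU₀)).meromorphicAt).congr ?_
  refine Filter.EventuallyEq.filter_mono ?_ nhdsWithin_le_nhds
  filter_upwards [eventually_im_pos hξ₀'] with ξ hξ
  have hterm : ∀ q, hTerm m N z (ofComplex ξ) q = F q ξ := fun q => by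
    rw [hTerm_eq, hKernel, ofComplex_apply_of_im_pos hξ]
  rw [H, ← (summable_hTerm hm N z (ofComplex ξ)).sum_add_tsum_subtype_compl B]
  simp only [hterm]

/-! ### The Fourier expansion and the meromorphic part -/

theorem two_pi_I_mul_sub_re (u w : ℍ) :
    (2 * Real.pi * Complex.I * ((u : ℂ) - w)).re = 2 * Real.pi * (w.im - u.im) := by
  simp
  ring

theorem psiTerm_cosetEquiv (m : ℤ) (N : ℕ) (z w : ℍ) (q : TranslationCosets N) (n : ℤ) :
    psiTerm m (-1) N z w (cosetEquiv N (q, n)) = autFactor m (cosetRep q) z *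
      ((((cosetRep q • z : ℍ) : ℂ) + n - w)⁻¹ *
        (((cosetRep q • z : ℍ) : ℂ) + n - (starRingEnd ℂ) (w : ℂ)) ^
          (-(((m : ℝ) / 2 - 1 : ℝ) : ℂ))) := by
  have hrow := T_zpow_mul_row n (cosetRep q)
  rw [psiTerm_neg_one_eq, orbitCoeff, orbitPoint, coe_cosetEquiv, mul_smul,
    ModularGroup.coe_T_zpow_smul_eq, autFactor, autFactor, slashMultiplier, slashMultiplier,
    denomPow, denomPow, congrFun hrow 0, congrFun hrow 1]
  ring

/-- The constant relating the weighted elliptic Poincaré series to `H`. -/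
noncomputable def meromorphicPartConst (m : ℤ) : ℂ := Real.pi / (2 * Complex.I) ^ ((m : ℂ) / 2 - 2)

/-- The summands of the double series expansion of the weighted elliptic Poincaré series. -/
noncomputable def expansionTerm (m : ℤ) (N : ℕ) (z w : ℍ) (q : TranslationCosets N) (n : ℤ) : ℂ :=
  meromorphicPartConst m * (autFactor m (cosetRep q) z *
    tailExp ((m : ℝ) / 2 - 1) (4 * Real.pi * w.im)
      (2 * Real.pi * Complex.I * (((cosetRep q • z : ℍ) : ℂ) - w)) ((-n : ℤ) : ℝ))

theorem summable_expansionTerm {m : ℤ} (hm : 4 < m) (N : ℕ) (z : ℍ) {B : ℝ}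
    (hB : ∀ M : SL(2, ℤ), (M • z).im ≤ B) {w : ℍ} (hw : B < w.im) :
    Summable fun p : TranslationCosets N × ℤ => expansionTerm m N z w p.1 p.2 := by
  have hm' : (4 : ℝ) < m := by exact_mod_cast hm
  have hs : 1 < (m : ℝ) / 2 - 1 := by linarith
  have hpi := Real.pi_pos
  have hw0 := w.im_pos
  -- A decay rate valid for all cosets: Re l = 2π(Im w - Im u) is at least 2π(Im w - B), which
  -- governs one end. It is below 2π Im w, which leaves the gap π Im w to 3c/4 = 3π Im w at the
  -- other end.
  set a := min (2 * Real.pi * (w.im - B)) (Real.pi * w.im) with ha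
  have ha0 : 0 < a := lt_min (by nlinarith) (by positivity)
  have hsum : Summable fun n : ℤ => Real.exp (-a * |(n : ℝ)|) := by
    have h := Real.summable_exp_nat_mul_iff.mpr (neg_lt_zero.mpr ha0)
    refine Summable.of_nat_of_neg ?_ ?_ <;>
    · refine h.congr fun n => ?_
      simp [mul_comm]
  refine Summable.of_norm_bounded
    ((((summable_norm_autFactor_cosetRep hm N z).mul_of_nonneg (hsum.mul_left (4 ^ ((m : ℝ) / 2 - 1)))
      (fun _ => norm_nonneg _) (fun _ => by positivity)).mul_left ‖meromorphicPartConst m‖)) ?_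
  rintro ⟨q, n⟩
  rw [expansionTerm, norm_mul, norm_mul]
  gcongr
  have hu := (cosetRep q • z).im_pos
  have huB := hB (cosetRep q)
  have h := norm_tailExp_le (a := a) hs (show 0 < 4 * Real.pi * w.im by positivity)
    (l := 2 * Real.pi * Complex.I * (((cosetRep q • z : ℍ) : ℂ) - w))
    (by
      rw [two_pi_I_mul_sub_re]
      refine (min_le_left _ _).trans ?_
      gcongr)
    (by
      rw [two_pi_I_mul_sub_re]
      have := min_le_right (2 * Real.pi * (w.im - B)) (Real.pi * w.im)
      nlinarith) ((-n : ℤ) : ℝ)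
  simpa using h

theorem tsum_expansionTerm {m : ℤ} (hm : 4 < m) (N : ℕ) (z : ℍ) {w : ℍ} (q : TranslationCosets N)
    (hw : (cosetRep q • z).im < w.im) :
    ∑' n : ℤ, expansionTerm m N z w q n = ((w.im ^ ((m : ℝ) / 2 - 1) : ℝ) : ℂ) *
      ∑' n : ℤ, psiTerm m (-1) N z w (cosetEquiv N (q, n)) := by
  have hm' : (4 : ℝ) < m := by exact_mod_cast hm
  have h := tsum_translate_kernel (s := (m : ℝ) / 2 - 1) (by linarith) hw
  simp only [psiTerm_cosetEquiv, expansionTerm, tsum_mul_left]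
  rw [mul_left_comm ((w.im ^ ((m : ℝ) / 2 - 1) : ℝ) : ℂ), h, meromorphicPartConst,
    ← (Equiv.neg ℤ).tsum_eq (fun n : ℤ => tailExp ((m : ℝ) / 2 - 1) (4 * Real.pi * w.im)
      (2 * Real.pi * Complex.I * (((cosetRep q • z : ℍ) : ℂ) - w)) (n : ℝ)),
    show (((m : ℝ) / 2 - 1 : ℝ) : ℂ) - 1 = (m : ℂ) / 2 - 2 by push_cast; ring]
  simp only [Equiv.neg_apply]
  ring

/-- Absolute convergence allows summing first over each coset of ⟨T⟩. Poisson summation then applies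
in every coset, because w lies above the whole orbit of z. -/
theorem weightedPsi_eq_tsum {m : ℤ} (hm : 4 < m) (N : ℕ) (z : ℍ) {B : ℝ}
    (hB : ∀ M : SL(2, ℤ), (M • z).im ≤ B) {w : ℍ} (hw : B < w.im) :
    weightedPsi m N z w = ∑' q : TranslationCosets N, ∑' n : ℤ, expansionTerm m N z w q n := by
  have h := ((cosetEquiv N).summable_iff.mpr (summable_psiTerm hm N z w)).tsum_prod
  rw [weightedPsi, Psi, ← (cosetEquiv N).tsum_eq]
  simp only [Function.comp_apply] at h
  rw [h, ← tsum_mul_left]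
  exact tsum_congr fun q => (tsum_expansionTerm hm N z q ((hB _).trans_lt hw)).symm

theorem hasSum_hKernel {u w : ℍ} (huw : u.im < w.im) :
    HasSum (fun n : ℤ => if 0 ≤ n then Complex.exp (2 * Real.pi * Complex.I * ((u : ℂ) - w) * (-n : ℤ))
      else 0) (hKernel w u) := by
  have hnorm : ‖Complex.exp (2 * Real.pi * Complex.I * ((w : ℂ) - u))‖ < 1 := by
    rw [Complex.norm_exp, two_pi_I_mul_sub_re]
    refine Real.exp_lt_one_iff.mpr ?_
    have := Real.pi_pos
    nlinarith
  have h := hasSum_geometric_of_norm_lt_one hnorm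
  rw [hKernel, one_div]
  have hinj : Function.Injective ((↑) : ℕ → ℤ) := Nat.cast_injective
  refine (hinj.hasSum_iff fun n hn => ?_).mp (h.congr_fun fun n => ?_)
  · rw [if_neg]
    intro h0
    exact hn ⟨n.toNat, Int.toNat_of_nonneg h0⟩
  · rw [Function.comp_apply, if_pos (Int.natCast_nonneg n), ← Complex.exp_nat_mul]
    congr 1
    push_cast
    ring

/-- For n ≥ 0 the tail is evaluated at -4πn Im w ≤ 0, where it equals 1. These terms are therefore
holomorphic in w and reproduce the geometric series of `hKernel`. -/
theorem expansionTerm_of_nonneg {m : ℤ} (hm : 4 < m) (N : ℕ) (z w : ℍ) (q : TranslationCosets N)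
    {n : ℤ} (hn : 0 ≤ n) :
    expansionTerm m N z w q n = meromorphicPartConst m * (autFactor m (cosetRep q) z *
      Complex.exp (2 * Real.pi * Complex.I * (((cosetRep q • z : ℍ) : ℂ) - w) * (-n : ℤ))) := by
  have hm' : (4 : ℝ) < m := by exact_mod_cast hm
  have hn' : (0 : ℝ) ≤ n := by exact_mod_cast hn
  have hw := w.im_pos
  rw [expansionTerm, tailExp, gammaTail_of_nonpos (by linarith)]
  · simp
  · push_cast
    have := mul_nonneg (show 0 ≤ 4 * Real.pi * w.im by positivity) hn'
    linarith

/-- The coefficients of the meromorphic part. -/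
noncomputable def coeffPlus (m : ℤ) (N : ℕ) (z : ℍ) (n : ℤ) : ℂ :=
  if 0 ≤ n then meromorphicPartConst m * ∑' q : TranslationCosets N, autFactor m (cosetRep q) z *
    Complex.exp (-(2 * Real.pi * Complex.I * n * (cosetRep q • z : ℍ))) else 0

/-- The coefficients of the nonmeromorphic part. -/
noncomputable def coeffMinus (m : ℤ) (N : ℕ) (z : ℍ) (n : ℤ) : ℂ :=
  if 0 ≤ n then 0 else meromorphicPartConst m / Real.Gamma ((m : ℝ) / 2 - 1) *
    ∑' q : TranslationCosets N, autFactor m (cosetRep q) z *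
      Complex.exp (-(2 * Real.pi * Complex.I * n * (cosetRep q • z : ℍ)))

theorem tsum_expansionTerm_of_nonneg {m : ℤ} (hm : 4 < m) (N : ℕ) (z w : ℍ) {n : ℤ} (hn : 0 ≤ n) :
    ∑' q, expansionTerm m N z w q n =
      coeffPlus m N z n * Complex.exp (2 * Real.pi * Complex.I * n * w) := by
  rw [coeffPlus, if_pos hn, mul_assoc, ← tsum_mul_right, ← tsum_mul_left]
  refine tsum_congr fun q => ?_
  rw [expansionTerm_of_nonneg hm N z w q hn, mul_assoc (autFactor m _ z), ← Complex.exp_add]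
  congr 3
  push_cast
  ring

theorem tsum_expansionTerm_of_neg {m : ℤ} (hm : 4 < m) (N : ℕ) (z w : ℍ) {n : ℤ} (hn : ¬ 0 ≤ n) :
    ∑' q, expansionTerm m N z w q n =
      coeffMinus m N z n * (incGamma ((m : ℝ) / 2 - 1) (-4 * Real.pi * n * w.im) : ℂ) *
        Complex.exp (2 * Real.pi * Complex.I * n * w) := by
  have hm' : (4 : ℝ) < m := by exact_mod_cast hm
  have hn' : (n : ℝ) < 0 := by exact_mod_cast not_le.mp hn
  have hw := w.im_pos
  rw [coeffMinus, if_neg hn, mul_assoc, mul_assoc, ← tsum_mul_right, ← tsum_mul_left]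
  refine tsum_congr fun q => ?_
  have harg : 4 * Real.pi * w.im * ((-n : ℤ) : ℝ) = -4 * Real.pi * n * w.im := by push_cast; ring
  have h0 : 0 ≤ -4 * Real.pi * n * w.im := by
    have := mul_pos (mul_pos Real.pi_pos (neg_pos.mpr hn')) hw
    linarith
  have hexp : Complex.exp (2 * Real.pi * Complex.I * (((cosetRep q • z : ℍ) : ℂ) - w) *
      (((-n : ℤ) : ℝ) : ℂ)) = Complex.exp (-(2 * Real.pi * Complex.I * n * (cosetRep q • z : ℍ))) *
        Complex.exp (2 * Real.pi * Complex.I * n * w) := by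
    rw [← Complex.exp_add]
    congr 1
    push_cast
    ring
  rw [expansionTerm, tailExp, harg, gammaTail_of_nonneg (by linarith) h0, hexp]
  push_cast
  ring

/-- The half n ≥ 0 of the double series is absolutely summable. Summing over n first gives H, and
summing over the cosets first gives the Fourier coefficients. -/
theorem hasSum_meromorphicPart {m : ℤ} (hm : 4 < m) (N : ℕ) (z : ℍ) {B : ℝ}
    (hB : ∀ M : SL(2, ℤ), (M • z).im ≤ B) {w : ℍ} (hw : B < w.im) :
    HasSum (fun n : ℤ => coeffPlus m N z n * Complex.exp (2 * Real.pi * Complex.I * n * w))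
      (meromorphicPartConst m * H m N z w) := by
  set f : TranslationCosets N × ℤ → ℂ :=
    fun p => if 0 ≤ p.2 then expansionTerm m N z w p.1 p.2 else 0 with hf
  have hsum : Summable f := by
    have h := (summable_expansionTerm hm N z hB hw).indicator {p | 0 ≤ p.2}
    refine h.congr fun p => ?_
    rw [Set.indicator_apply]
    rfl
  have h1 : ∀ q, HasSum (fun n => f (q, n)) (meromorphicPartConst m * hTerm m N z w q) := fun q => by
    have h := ((hasSum_hKernel ((hB (cosetRep q)).trans_lt hw)).mul_left
      (autFactor m (cosetRep q) z)).mul_left (meromorphicPartConst m)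
    rw [hTerm_eq]
    refine h.congr_fun fun n => ?_
    rw [hf]
    simp only
    split_ifs with hn
    · rw [expansionTerm_of_nonneg hm N z w q hn]
    · simp
  have h2 : ∑' p, f p = meromorphicPartConst m * H m N z w := by
    rw [hsum.tsum_prod, H, ← tsum_mul_left]
    exact tsum_congr fun q => (h1 q).tsum_eq
  rw [← h2]
  have h3 := ((Equiv.prodComm _ _).hasSum_iff.mpr hsum.hasSum).prod_fiberwise
    fun n => (((Equiv.prodComm _ _).summable_iff.mpr hsum).prod_factor n).hasSum
  refine h3.congr_fun fun n => ?_
  change _ = ∑' q, f (q, n)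
  by_cases hn : 0 ≤ n
  · rw [← tsum_expansionTerm_of_nonneg hm N z w hn]
    exact tsum_congr fun q => (if_pos hn).symm
  · rw [coeffPlus, if_neg hn, zero_mul]
    exact tsum_zero.symm.trans (tsum_congr fun q => (if_neg hn).symm)

/-- Subtracting the meromorphic part from the full double series leaves exactly the terms with n <
0, where the tail is a genuine incomplete gamma value divided by Γ(κ - 1). -/
theorem hasSum_weightedPsi_sub {m : ℤ} (hm : 4 < m) (N : ℕ) (z : ℍ) {B : ℝ}
    (hB : ∀ M : SL(2, ℤ), (M • z).im ≤ B) {w : ℍ} (hw : B < w.im) :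
    HasSum (fun n : ℤ => coeffMinus m N z n *
      (incGamma ((m : ℝ) / 2 - 1) (-4 * Real.pi * n * w.im) : ℂ) *
        Complex.exp (2 * Real.pi * Complex.I * n * w))
      (weightedPsi m N z w - meromorphicPartConst m * H m N z w) := by
  have hsum := summable_expansionTerm hm N z hB hw
  have h := ((Equiv.prodComm _ _).hasSum_iff.mpr hsum.hasSum).prod_fiberwise
    fun n => (((Equiv.prodComm _ _).summable_iff.mpr hsum).prod_factor n).hasSum
  rw [hsum.tsum_prod, ← weightedPsi_eq_tsum hm N z hB hw] at h
  refine (h.sub (hasSum_meromorphicPart hm N z hB hw)).congr_fun fun n => ?_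
  simp only [Function.comp_apply, Equiv.prodComm_apply, Prod.swap]
  by_cases hn : 0 ≤ n
  · rw [tsum_expansionTerm_of_nonneg hm N z w hn, coeffMinus, if_pos hn, sub_self, zero_mul, zero_mul]
  · rw [tsum_expansionTerm_of_neg hm N z w hn, coeffPlus, if_neg hn, zero_mul, sub_zero]

theorem hasMeromorphicPart_weightedPsi {m : ℤ} (hm : 4 < m) (N : ℕ) (z : ℍ) :
    HasMeromorphicPart (4 - m) (weightedPsi m N z) fun w => meromorphicPartConst m * H m N z w := by
  obtain ⟨B, -, hB⟩ := exists_im_smul_le z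
  refine ⟨fun ξ hξ => (MeromorphicAt.const _ _).fun_mul (meromorphicOn_H hm N z ξ hξ),
    coeffPlus m N z, coeffMinus m N z, 0, B, fun n hn => if_neg (not_le.mpr hn),
    fun n hn => if_pos hn, fun w hw => ⟨hasSum_meromorphicPart hm N z hB hw, ?_⟩⟩
  -- In weight λ = 2 - κ the gamma parameter 1 - λ is κ - 1, the exponent s of the Poisson
  -- summation.
  rw [show 1 - ((4 - m : ℤ) : ℝ) / 2 = (m : ℝ) / 2 - 1 by push_cast; ring]
  exact hasSum_weightedPsi_sub hm N z hB hw

end PolarMaass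

theorem proposition4p1 (m : ℤ) (hm : 4 < m) (N : ℕ) (hN : 0 < N) (hmN : Odd m → 4 ∣ N) (z : ℍ) :
    (∀ 𝔷 : ℍ, Summable (PolarMaass.psiTerm m (-1) N z 𝔷)) ∧
    (∀ 𝔷 : ℍ, Summable (PolarMaass.hTerm m N z 𝔷)) ∧
    PolarMaass.IsPolarHarmonicCusp (4 - m) N
      (fun 𝔷 : ℍ => ((𝔷.im ^ ((m : ℝ) / 2 - 1) : ℝ) : ℂ) * PolarMaass.Psi m (-1) N z 𝔷) ∧
    PolarMaass.HasMeromorphicPart (4 - m)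
      (fun 𝔷 : ℍ => ((𝔷.im ^ ((m : ℝ) / 2 - 1) : ℝ) : ℂ) * PolarMaass.Psi m (-1) N z 𝔷)
      (fun 𝔷 : ℍ =>
        (Real.pi : ℂ) / (2 * Complex.I) ^ ((m : ℂ) / 2 - 2) * PolarMaass.H m N z 𝔷) :=
  ⟨PolarMaass.summable_psiTerm hm N z, PolarMaass.summable_hTerm hm N z,
    PolarMaass.isPolarHarmonicCusp_weightedPsi hm hmN z,
    PolarMaass.hasMeromorphicPart_weightedPsi hm N z⟩
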